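/- **Setting.** All manifolds are smooth, finite-dimensional, Hausdorff, $\sigma$-compact and without boundary. Let $\zeta\colon Z\to M$ be an AV-bundle, i.e. a smooth principal bundle with structure group $(\mathbb R,+)$; for $z,w$ in one fibre let $w-z\in\mathbb R$ be the number $t$ with $z+t=w$. The set $\mathrm{Sec}(Z)$ of smooth sections is an affine space over $C^\infty(M)$. For $\sigma\in\mathrm{Sec}(Z)$ let $F_\sigma\in C^\infty(Z)$, $F_\sigma(z)=\sigma(\zeta(z))-z$, and let $X_Z$ be the vector field $-\partial_s$ on $Z$, i.e. $X_Z(u)(z)=-\frac{d}{dt}\big|_{t=0}u(z+t)$, so that $X_Z(F_\sigma)=1$. * Sections of the vector bundle $\tilde TZ=TZ/\mathbb R\to M$ are the vector fields $X$ on $Z$ with $[X_Z,X]=0$. * Sections of the vector bundle $\tilde LZ\to M$ are the operators $D=X+\varphi X_Z-X_Z(\varphi)$ on $C^\infty(Z)$, where $[X_Z,X]=0$ and $\varphi\in C^\infty(Z)$ is affine along the fibres, $X_Z(X_Z(\varphi))=0$. Both are Lie algebroids over $M$ with the commutator bracket; the anchors are given by $X(f)\circ\zeta=X(f\circ\zeta)$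 and $\rho(D)(f)\circ\zeta=D(f\circ\zeta)-D(1)\,(f\circ\zeta)$. Let $\mathrm d$ be the Lie algebroid (Chevalley–Eilenberg) differential on the graded spaces $\mathcal A(\tilde T^*Z)=\bigoplus_n\mathrm{Sec}(\bigwedge^n\tilde T^*Z)$ and $\mathcal A(\tilde L^*Z)=\bigoplus_n\mathrm{Sec}(\bigwedge^n\tilde L^*Z)$ of forms. The one-form $\varphi^0$ on $\tilde LZ$ is defined by $[D,X_Z]=\varphi^0(D)X_Z$, equivalently $\varphi^0(D)\circ\zeta=D(1)$. Sections act on $\sigma\in\mathrm{Sec}(Z)$ by $X(\sigma)\circ\zeta=X(F_\sigma)$ and $D(\sigma)\circ\zeta=D(F_\sigma)$, with values in $C^\infty(M)$. An element $\Lambda$ of $\mathrm{Sec}(\bigwedge^2\tilde TZ)$ or $\mathrm{Sec}(\bigwedge^2\tilde LZ)$ represents the bracket $\{\cdot,\cdot\}_\Lambda\colon\mathrm{Sec}(Z)\times\mathrm{Sec}(Z)\to C^\infty(M)$ that is linear in $\Lambda$ over $C^\infty(M)$ and for $\Lambda=X\wedge Y$ is $\{\sigma,\sigma'\}_\Lambda=X(\sigma)Y(\sigma')-Y(\sigma)X(\sigma')$.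 An *affine Lie bracket* on $\mathrm{Sec}(Z)$ is a map $\{\cdot,\cdot\}\colon\mathrm{Sec}(Z)\times\mathrm{Sec}(Z)\to C^\infty(M)$ that is affine over $\mathbb R$ in each argument, skew-symmetric, and satisfies $$\{\sigma_1,\{\sigma_2,\sigma_3\}\}_v^2+\{\sigma_2,\{\sigma_3,\sigma_1\}\}_v^2+\{\sigma_3,\{\sigma_1,\sigma_2\}\}_v^2=0,$$ where $\{\sigma,\cdot\}_v^2\colon C^\infty(M)\to C^\infty(M)$ is the linear part of $\{\sigma,\cdot\}$. It is an *aff-Poisson* (resp. *aff-Jacobi*) bracket if for every $\sigma$ the linear part of $\{\sigma,\cdot\}$ is a derivation of $C^\infty(M)$ (resp. a linear differential operator of order at most one, $f\mapsto X(f)+hf$). For sections $X,Y$ put $i_{X\wedge Y}\omega=\omega(X,Y,\dots)$ (zero on forms of degree less than $2$) and $i_{\varphi^0}(X\wedge Y)=\varphi^0(X)Y-\varphi^0(Y)X$, extended linearly to bisections; $|\omega|$ is the degree of $\omega$. **Theorem.** (a) $\Lambda\in\mathrm{Sec}(\bigwedge^2\tilde TZ)$ represents an aff-Poisson bracket on $Z$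 if and only if the Lie differential $$\pounds_\Lambda=i_\Lambda\circ\mathrm d-\mathrm d\circ i_\Lambda,$$ an operator of degree $-1$ on $\mathcal A(\tilde T^*Z)$, is a homology operator, i.e. $(\pounds_\Lambda)^2=0$. (b) $\mathcal J\in\mathrm{Sec}(\bigwedge^2\tilde LZ)$ represents an aff-Jacobi bracket on $Z$ if and only if for every $t\in\mathbb R$ the Jacobi–Lie differential $$\pounds^{\varphi^0,t}_{\mathcal J}(\omega)=i_{\mathcal J}\mathrm d\omega-\mathrm d\,i_{\mathcal J}\omega+(|\omega|+t)\,i_{i_{\varphi^0}\mathcal J}\,\omega+\varphi^0\wedge i_{\mathcal J}\omega,$$ an operator of degree $-1$ on $\mathcal A(\tilde L^*Z)$, is a homology operator, i.e. $(\pounds^{\varphi^0,t}_{\mathcal J})^2=0$. When they are defined, the homology of $\pounds_\Lambda$ is called the aff-Poisson homology and that of $\pounds^{\varphi^0,0}_{\mathcal J}$ the aff-Jacobi homology. -/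

import Mathlib

open scoped Manifold ContDiff

namespace AVGeometry

section Calculus

/-- Forms of degree `k` of a Lie algebroid over a manifold `M`, where `R` is the ring of functions on
`M` and `A` the `R`-module of sections: the alternating `R`-multilinear maps `A × ⋯ × A → R`. -/
abbrev Form (R A : Type*) [CommRing R] [AddCommGroup A] [Module R A] (k : ℕ) :=
  A [⋀^Fin k]→ₗ[R] R

variable {R A : Type*} [CommRing R] [Algebra ℝ R] [LieRing A] [LieAlgebra ℝ A] [Module R A]
  [LieRingModule A R] [LieRinehartRing R A] [LieRinehartAlgebra ℝ R A]

variable {k : ℕ}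

/-- `w ↦ ∑ⱼ η(w₁, …, [X, wⱼ], …, w_k)`, as a real multilinear map. -/
noncomputable def bracketInsert (η : Form R A k) (X : A) : MultilinearMap ℝ (fun _ : Fin k => A) R :=
  ∑ j, ((η.toMultilinearMap.restrictScalars ℝ).compLinearMap
    (Function.update (fun _ => LinearMap.id) j (LieAlgebra.ad ℝ A X)))

theorem bracketInsert_apply (η : Form R A k) (X : A) (w : Fin k → A) :
    bracketInsert η X w = ∑ j, η (Function.update w j ⁅X, w j⁆) := by
  simp only [bracketInsert, _root_.sum_apply, MultilinearMap.compLinearMap_apply]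
  refine Finset.sum_congr rfl fun j _ => ?_
  change η _ = η _
  congr 1
  funext i
  by_cases h : i = j
  · subst h; simp
  · simp [h]

/-- `w ↦ X(η(w)) - ½ ∑ⱼ η(w₁, …, [X, wⱼ], …, w_k)`. -/
noncomputable def cochainAux (η : Form R A k) (X : A) : A [⋀^Fin k]→ₗ[ℝ] R where
  toMultilinearMap :=
    ((LieModule.toEnd ℝ A R X).compMultilinearMap (η.toMultilinearMap.restrictScalars ℝ))
      - (1 / 2 : ℝ) • bracketInsert η X
  map_eq_zero_of_eq' := by
    intro w a b hab hne
    have h2 : bracketInsert η X w = 0 := by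
      rw [bracketInsert_apply, Fintype.sum_eq_add a b hne]
      · have : Function.update w b ⁅X, w b⁆ = Function.update w a ⁅X, w a⁆ ∘ Equiv.swap a b := by
          funext i
          by_cases hi : i = a
          · subst hi; simp [hne, hab, hne.symm]
          · by_cases hi' : i = b
            · subst hi'; simp [hab]
            · simp [hi, hi', Equiv.swap_apply_of_ne_of_ne]
        rw [this, η.map_swap _ hne, add_neg_cancel]
      · rintro j ⟨hja, hjb⟩
        refine η.map_eq_zero_of_eq _ ?_ hne
        simp [hja.symm, hjb.symm, hab]
    have h1 : η w = 0 := η.map_eq_zero_of_eq w hab hne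
    change ⁅X, η w⁆ - (1 / 2 : ℝ) • bracketInsert η X w = 0
    rw [h1, h2]; simp

theorem cochainAux_apply (η : Form R A k) (X : A) (w : Fin k → A) :
    cochainAux η X w = ⁅X, η w⁆ - (1 / 2 : ℝ) • ∑ j, η (Function.update w j ⁅X, w j⁆) := by
  rw [← bracketInsert_apply]; rfl

/-- `cochainAux` as a linear map in the section `X`. -/
noncomputable def cochainAuxL (η : Form R A k) : A →ₗ[ℝ] A [⋀^Fin k]→ₗ[ℝ] R where
  toFun X := cochainAux η X
  map_add' X Y := by
    ext w
    simp only [cochainAux_apply, AlternatingMap.add_apply, add_lie, AlternatingMap.map_update_add,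
      Finset.sum_add_distrib, smul_add]
    abel
  map_smul' c X := by
    ext w
    have h : ∀ j, η (Function.update w j (c • ⁅X, w j⁆)) =
        c • η (Function.update w j ⁅X, w j⁆) := fun j => by
      have := η.map_update_smul w j (algebraMap ℝ R c) ⁅X, w j⁆
      rwa [algebraMap_smul, algebraMap_smul] at this
    simp only [cochainAux_apply, AlternatingMap.smul_apply, smul_lie, h, ← Finset.smul_sum,
      smul_sub, RingHom.id_apply]
    rw [smul_comm]

/-- The Lie algebroid differential of a form, as a real multilinear map. -/
noncomputable def extDerivAux (η : Form R A k) : A [⋀^Fin (k + 1)]→ₗ[ℝ] R :=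
  AlternatingMap.alternatizeUncurryFin (cochainAuxL η)

theorem extDerivAux_apply (η : Form R A k) (v : Fin (k + 1) → A) :
    extDerivAux η v = ∑ i : Fin (k + 1), (-1 : ℤ) ^ (i : ℕ) •
      (⁅v i, η (i.removeNth v)⁆ - (1 / 2 : ℝ) •
        ∑ j, η (Function.update (i.removeNth v) j ⁅v i, i.removeNth v j⁆)) := by
  simp only [extDerivAux, AlternatingMap.alternatizeUncurryFin_apply]
  exact Finset.sum_congr rfl fun i _ => congrArg _ (cochainAux_apply η (v i) _)

theorem extDerivAux_smul_zero (η : Form R A k) (f : R) (x : A) (v : Fin k → A) :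
    extDerivAux η (Fin.cons (f • x) v : Fin (k + 1) → A) =
      f • extDerivAux η (Fin.cons x v : Fin (k + 1) → A) := by
  have hsk : ∀ y : A, ⁅f • x, y⁆ = f • ⁅x, y⁆ - ⁅y, f⁆ • x := fun y => by
    rw [← lie_skew, LieRinehartRing.leibniz_smul_right, neg_add, ← smul_neg, lie_skew]; abel
  rw [extDerivAux_apply, extDerivAux_apply]
  cases k with
  | zero => simp
  | succ n =>
    have e0 : ∀ y : A, (0 : Fin (n + 2)).removeNth (Fin.cons y v : Fin (n + 2) → A) = v :=
      fun y => by simp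
    have es : ∀ (y : A) (i : Fin (n + 1)), i.succ.removeNth (Fin.cons y v : Fin (n + 2) → A) =
        Fin.cons y (i.removeNth v) := fun y i => by
      funext a
      refine Fin.cases ?_ (fun a => ?_) a <;> simp [Fin.removeNth_apply]
    have key : ∀ (j : Fin (n + 1)), η (Function.update v j x) =
        (-1 : ℤ) ^ (j : ℕ) • η (Fin.cons x (j.removeNth v) : Fin (n + 1) → A) := fun j => by
      rw [← Fin.insertNth_removeNth, AlternatingMap.map_insertNth]; rfl
    have hadd : ∀ (y z : A) (w : Fin n → A), η (Fin.cons (y + z) w : Fin (n + 1) → A) =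
        η (Fin.cons y w : Fin (n + 1) → A) + η (Fin.cons z w : Fin (n + 1) → A) :=
      fun y z w => η.toMultilinearMap.cons_add w y z
    have hsm : ∀ (r : R) (y : A) (w : Fin n → A), η (Fin.cons (r • y) w : Fin (n + 1) → A) =
        r • η (Fin.cons y w : Fin (n + 1) → A) :=
      fun r y w => η.toMultilinearMap.cons_smul w r y
    have hd : ∀ (y z : A) (w : Fin n → A) (j : Fin n),
        Function.update (Fin.cons y w : Fin (n + 1) → A) j.succ z =
          Fin.cons y (Function.update w j z) := fun y z w j => (Fin.cons_update ..).symm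
    have h2 : algebraMap ℝ R (1 / 2) + algebraMap ℝ R (1 / 2) = 1 := by
      rw [← map_add]; norm_num
    have t0 : (⁅f • x, η v⁆ - (1 / 2 : ℝ) • ∑ j, η (Function.update v j ⁅f • x, v j⁆)) =
        f * (⁅x, η v⁆ - (1 / 2 : ℝ) • ∑ j, η (Function.update v j ⁅x, v j⁆)) +
        ∑ j : Fin (n + 1), (-1 : ℤ) ^ (j : ℕ) • (algebraMap ℝ R (1 / 2) *
          (⁅v j, f⁆ * η (Fin.cons x (j.removeNth v) : Fin (n + 1) → A))) := by
      simp only [hsk, AlternatingMap.map_update_sub, AlternatingMap.map_update_smul, key,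
        LieRinehartRing.lie_smul_eq_mul, Algebra.smul_def, Finset.sum_sub_distrib,
        mul_sub, Finset.mul_sum, Algebra.algebraMap_self, RingHom.id_apply]
      rw [sub_sub_eq_add_sub, sub_add_eq_add_sub]
      congr 2
      · exact Finset.sum_congr rfl fun j _ => by ring
      · exact funext fun j => by ring
    have ti : ∀ i : Fin (n + 1),
        (⁅v i, η (Fin.cons (f • x) (i.removeNth v) : Fin (n + 1) → A)⁆ - (1 / 2 : ℝ) •
          ∑ j, η (Function.update (Fin.cons (f • x) (i.removeNth v) : Fin (n + 1) → A) j
            ⁅v i, (Fin.cons (f • x) (i.removeNth v) : Fin (n + 1) → A) j⁆)) =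
        f * (⁅v i, η (Fin.cons x (i.removeNth v) : Fin (n + 1) → A)⁆ - (1 / 2 : ℝ) •
          ∑ j, η (Function.update (Fin.cons x (i.removeNth v) : Fin (n + 1) → A) j
            ⁅v i, (Fin.cons x (i.removeNth v) : Fin (n + 1) → A) j⁆)) +
        algebraMap ℝ R (1 / 2) *
          (⁅v i, f⁆ * η (Fin.cons x (i.removeNth v) : Fin (n + 1) → A)) := fun i => by
      simp only [Fin.sum_univ_succ (n := n), Fin.cons_zero, Fin.cons_succ,
        Fin.update_cons_zero, hd, hsm, hadd, LieRinehartRing.leibniz_smul_right,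
        LieRinehartRing.leibniz_mul_right, smul_eq_mul, Algebra.smul_def, ← Finset.mul_sum]
      linear_combination (-(⁅v i, f⁆ * η (Fin.cons x (i.removeNth v) : Fin (n + 1) → A))) * h2
    rw [Fin.sum_univ_succ, Fin.sum_univ_succ (n := n + 1)]
    simp only [e0, es, Fin.cons_zero, Fin.cons_succ, t0, ti, smul_add, Finset.sum_add_distrib,
      Fin.val_zero, pow_zero, one_smul, Fin.val_succ, smul_eq_mul, mul_add, Finset.mul_sum,
      mul_smul_comm, pow_succ, mul_neg, mul_one, neg_smul, Finset.sum_neg_distrib]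
    abel

theorem extDerivAux_update_smul (η : Form R A k) (v : Fin (k + 1) → A) (i : Fin (k + 1)) (f : R)
    (x : A) : extDerivAux η (Function.update v i (f • x)) =
      f • extDerivAux η (Function.update v i x) := by
  have h : ∀ y : A, extDerivAux η (Function.update v i y) =
      (-1 : ℤ) ^ (i : ℕ) • extDerivAux η (Fin.cons y (i.removeNth v) : Fin (k + 1) → A) :=
    fun y => by
      rw [← Fin.insertNth_removeNth, AlternatingMap.map_insertNth]; rfl
  rw [h, h, extDerivAux_smul_zero, smul_comm]

/-- The Lie algebroid differential (Chevalley-Eilenberg, or de Rham, differential)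
`(dη)(X₀, …, X_k) = ∑ᵢ (-1)ⁱ Xᵢ(η(…, X̂ᵢ, …)) + ∑_{i<j} (-1)^{i+j} η([Xᵢ, Xⱼ], …, X̂ᵢ, …, X̂ⱼ, …)`.
The second sum is written over all ordered pairs `i ≠ j`, with `[Xᵢ, Xⱼ]` in the place of `Xⱼ` and
with a factor `½`; here `X(f)` is the anchor action `⁅X, f⁆`. -/
noncomputable def extDeriv (k : ℕ) : Form R A k →ₗ[ℝ] Form R A (k + 1) where
  toFun η :=
    { toFun := extDerivAux η
      map_update_add' := fun {_} v i x y => (extDerivAux η).map_update_add' v i x y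
      map_update_smul' := fun {inst} v i f x => by
        rw [Subsingleton.elim inst (instDecidableEqFin _)]
        exact extDerivAux_update_smul η v i f x
      map_eq_zero_of_eq' := (extDerivAux η).map_eq_zero_of_eq' }
  map_add' η θ := by
    ext v
    change extDerivAux (η + θ) v = extDerivAux η v + extDerivAux θ v
    simp only [extDerivAux_apply, AlternatingMap.add_apply, lie_add]
    rw [← Finset.sum_add_distrib]
    refine Finset.sum_congr rfl fun i _ => ?_
    rw [Finset.sum_add_distrib]
    simp only [smul_add, smul_sub]
    abel
  map_smul' c η := by
    ext v
    change extDerivAux (c • η) v = c • extDerivAux η v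
    simp only [extDerivAux_apply, AlternatingMap.smul_apply, lie_smul, ← Finset.smul_sum]
    rw [Finset.smul_sum]
    refine Finset.sum_congr rfl fun i _ => ?_
    rw [smul_comm c ((-1 : ℤ) ^ (i : ℕ)), smul_sub c, smul_comm c (1 / 2 : ℝ)]

theorem extDeriv_apply (η : Form R A k) (v : Fin (k + 1) → A) :
    extDeriv k η v = ∑ i : Fin (k + 1), (-1 : ℤ) ^ (i : ℕ) •
      (⁅v i, η (i.removeNth v)⁆ - (1 / 2 : ℝ) •
        ∑ j, η (Function.update (i.removeNth v) j ⁅v i, i.removeNth v j⁆)) :=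
  extDerivAux_apply η v

theorem extDeriv_zero_apply (η : Form R A 0) (X : A) :
    extDeriv 0 η ![X] = ⁅X, η ![]⁆ := by
  simp [extDeriv_apply]

theorem extDeriv_one_apply (η : Form R A 1) (X Y : A) :
    extDeriv 1 η ![X, Y] = ⁅X, η ![Y]⁆ - ⁅Y, η ![X]⁆ - η ![⁅X, Y⁆] := by
  have e0 : (0 : Fin 2).removeNth ![X, Y] = ![Y] := by ext i; fin_cases i; rfl
  have e1 : (1 : Fin 2).removeNth ![X, Y] = ![X] := by ext i; fin_cases i; rfl
  have e2 : ∀ y z : A, Function.update ![y] 0 z = ![z] := fun y z => by ext i; fin_cases i; rfl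
  have h3 : η ![⁅Y, X⁆] = - η ![⁅X, Y⁆] := by
    rw [← lie_skew, ← e2 X, ← e2 X ⁅X, Y⁆, AlternatingMap.map_update_neg]
  rw [extDeriv_apply, Fin.sum_univ_two, e0, e1]
  simp only [Fin.sum_univ_succ, Finset.univ_eq_empty, Finset.sum_empty, e2]
  simp [h3]
  module

end Calculus

section Contraction

variable {R A N : Type*} [CommRing R] [AddCommGroup A] [Module R A] [AddCommGroup N] [Module R N]

/-- The linear map on the exterior square given by `X ∧ Y ↦ B X Y`, for an alternating `B`. -/
noncomputable def liftTwo (B : A →ₗ[R] A →ₗ[R] N) (hB : ∀ X, B X X = 0) : ⋀[R]^2 A →ₗ[R] N :=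
  exteriorPower.alternatingMapLinearEquiv
    { toFun := fun v => B (v 0) (v 1)
      map_update_add' := fun {inst} v i x y => by
        rw [Subsingleton.elim inst (instDecidableEqFin _)]
        fin_cases i <;> simp
      map_update_smul' := fun {inst} v i c x => by
        rw [Subsingleton.elim inst (instDecidableEqFin _)]
        fin_cases i <;> simp
      map_eq_zero_of_eq' := fun v i j h hij => by
        fin_cases i <;> fin_cases j <;> simp_all }

@[simp]
theorem liftTwo_ιMulti (B : A →ₗ[R] A →ₗ[R] N) (hB : ∀ X, B X X = 0) (X Y : A) :
    liftTwo B hB (exteriorPower.ιMulti R 2 ![X, Y]) = B X Y := by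
  simp [liftTwo]

/-- `i_X η = η(X, …)`. -/
noncomputable def contractOne (k : ℕ) (X : A) : Form R A (k + 1) →ₗ[R] Form R A k where
  toFun η := η.curryLeft X
  map_add' _ _ := rfl
  map_smul' _ _ := rfl

theorem contractOne_apply (k : ℕ) (X : A) (η : Form R A (k + 1)) :
    contractOne k X η = η.curryLeft X := rfl

/-- The contraction `i_Λ` of forms with a bisection, `i_{X ∧ Y} η = i_Y i_X η = η(X, Y, …)`. -/
noncomputable def contractTwo (k : ℕ) : ⋀[R]^2 A →ₗ[R] Form R A (k + 2) →ₗ[R] Form R A k :=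
  liftTwo
    (LinearMap.mk₂ R
      (fun X Y => (contractOne k Y ∘ₗ contractOne (k + 1) X : Form R A (k + 2) →ₗ[R] Form R A k))
      (fun X X' Y => LinearMap.ext fun η => by simp [contractOne_apply])
      (fun c X Y => LinearMap.ext fun η => by simp [contractOne_apply])
      (fun X Y Y' => LinearMap.ext fun η => by simp [contractOne_apply])
      (fun c X Y => LinearMap.ext fun η => by simp [contractOne_apply]))
    (fun X => LinearMap.ext fun η => by simp [contractOne_apply])

theorem contractTwo_ιMulti (k : ℕ) (X Y : A) (η : Form R A (k + 2)) (v : Fin k → A) :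
    contractTwo k (exteriorPower.ιMulti R 2 ![X, Y]) η v =
      η (Matrix.vecCons X (Matrix.vecCons Y v)) := by
  rw [contractTwo, liftTwo_ιMulti]
  rfl

/-- The contraction of a bisection with a one-form, `i_φ (X ∧ Y) = φ(X) Y - φ(Y) X`. -/
noncomputable def contractForm (φ : Module.Dual R A) : ⋀[R]^2 A →ₗ[R] A :=
  liftTwo
    (LinearMap.mk₂ R (fun X Y => φ X • Y - φ Y • X)
      (fun X X' Y => by simp only [map_add]; module) (fun c X Y => by simp only [map_smul]; module)
      (fun X Y Y' => by simp only [map_add]; module) (fun c X Y => by simp only [map_smul]; module))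
    (fun X => by simp)

/-- The exterior product with a one-form,
`(φ ∧ η)(X₀, …, X_k) = ∑ᵢ (-1)ⁱ φ(Xᵢ) η(…, X̂ᵢ, …)`. -/
noncomputable def wedgeOne (φ : Module.Dual R A) (k : ℕ) : Form R A k →ₗ[R] Form R A (k + 1) where
  toFun η := AlternatingMap.alternatizeUncurryFin (φ.smulRight η)
  map_add' η θ := by ext v; simp [AlternatingMap.alternatizeUncurryFin_apply, Finset.sum_add_distrib]
  map_smul' c η := by
    ext v
    simp [AlternatingMap.alternatizeUncurryFin_apply, Finset.mul_sum, mul_left_comm]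

end Contraction

section LieDifferential

variable {R A : Type*} [CommRing R] [Algebra ℝ R] [LieRing A] [LieAlgebra ℝ A] [Module R A]
  [LieRingModule A R] [LieRinehartRing R A] [LieRinehartAlgebra ℝ R A]

instance (k : ℕ) : IsScalarTower ℝ R (Form R A k) :=
  ⟨fun c f η => AlternatingMap.ext fun v => smul_assoc c f (η v)⟩

/-- The Lie differential `£_Λ = i_Λ ∘ d - d ∘ i_Λ` of a bisection, an operator of degree `-1` on
forms; it is `0` on forms of degree `0`, and `i_Λ` is `0` on forms of degree `1`. -/
noncomputable def lieDiff (Λ : ⋀[R]^2 A) : (k : ℕ) → Form R A (k + 1) →ₗ[ℝ] Form R A k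
  | 0 => (contractTwo 0 Λ).restrictScalars ℝ ∘ₗ extDeriv 1
  | k + 1 => (contractTwo (k + 1) Λ).restrictScalars ℝ ∘ₗ extDeriv (k + 2) -
      extDeriv k ∘ₗ (contractTwo k Λ).restrictScalars ℝ

/-- The Jacobi-Lie differential `£_J η + (|η| + t) i_{i_φ J} η + φ ∧ i_J η`, where `|η|` is the
degree of `η`; an operator of degree `-1` on forms. -/
noncomputable def jacobiLieDiff (φ : Module.Dual R A) (t : ℝ) (J : ⋀[R]^2 A) :
    (k : ℕ) → Form R A (k + 1) →ₗ[ℝ] Form R A k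
  | 0 => lieDiff J 0 + (1 + t) • (contractOne 0 (contractForm φ J)).restrictScalars ℝ
  | k + 1 => lieDiff J (k + 1) +
      ((k + 2 : ℝ) + t) • (contractOne (k + 1) (contractForm φ J)).restrictScalars ℝ +
      (wedgeOne φ k ∘ₗ contractTwo k J).restrictScalars ℝ

/-- An operator of degree `-1` on forms is a homology operator if its square is zero. -/
def IsHomologyOperator (D : (k : ℕ) → Form R A (k + 1) →ₗ[ℝ] Form R A k) : Prop :=
  ∀ k, D k ∘ₗ D (k + 1) = 0

/-- The chain complex of a homology operator on forms. -/
noncomputable def formComplex (D : (k : ℕ) → Form R A (k + 1) →ₗ[ℝ] Form R A k)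
    (hD : IsHomologyOperator D) : ChainComplex (ModuleCat ℝ) ℕ :=
  ChainComplex.of (fun k => ModuleCat.of ℝ (Form R A k)) (fun k => ModuleCat.ofHom (D k))
    fun k => by rw [← ModuleCat.ofHom_comp, hD k]; rfl

/-- The homology of a homology operator on forms. For `D = lieDiff Λ` this is the aff-Poisson
homology, for `D = jacobiLieDiff φ 0 J` the aff-Jacobi homology. -/
noncomputable def formHomology (D : (k : ℕ) → Form R A (k + 1) →ₗ[ℝ] Form R A k)
    (hD : IsHomologyOperator D) (k : ℕ) : ModuleCat ℝ :=
  (formComplex D hD).homology k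

end LieDifferential

end AVGeometry

noncomputable section

namespace AVGeometry

variable {E F M Z : Type*} [NormedAddCommGroup E] [NormedSpace ℝ E]
  [NormedAddCommGroup F] [NormedSpace ℝ F]
  [TopologicalSpace M] [ChartedSpace E M] [TopologicalSpace Z] [ChartedSpace F Z]

/-- The real algebra of smooth functions on a manifold `N` modelled on `V`. -/
def SmoothFn (V N : Type*) [NormedAddCommGroup V] [NormedSpace ℝ V] [TopologicalSpace N]
    [ChartedSpace V N] := C^∞⟮𝓘(ℝ, V), N; ℝ⟯

section SmoothFn

variable {V N : Type*} [NormedAddCommGroup V] [NormedSpace ℝ V] [TopologicalSpace N]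
  [ChartedSpace V N]

instance : CommRing (SmoothFn V N) := inferInstanceAs (CommRing C^∞⟮𝓘(ℝ, V), N; ℝ⟯)

instance : Algebra ℝ (SmoothFn V N) := inferInstanceAs (Algebra ℝ C^∞⟮𝓘(ℝ, V), N; ℝ⟯)

instance : FunLike (SmoothFn V N) N ℝ := inferInstanceAs (FunLike C^∞⟮𝓘(ℝ, V), N; ℝ⟯ N ℝ)

@[ext]
theorem SmoothFn.ext {f g : SmoothFn V N} (h : ∀ x, f x = g x) : f = g := DFunLike.ext _ _ h

theorem SmoothFn.contMDiff (f : SmoothFn V N) : ContMDiff 𝓘(ℝ, V) 𝓘(ℝ, ℝ) ∞ f := f.2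

@[simp]
theorem SmoothFn.add_apply (f g : SmoothFn V N) (x : N) : (f + g) x = f x + g x := rfl

@[simp]
theorem SmoothFn.mul_apply (f g : SmoothFn V N) (x : N) : (f * g) x = f x * g x := rfl

@[simp]
theorem SmoothFn.zero_apply (x : N) : (0 : SmoothFn V N) x = 0 := rfl

@[simp]
theorem SmoothFn.one_apply (x : N) : (1 : SmoothFn V N) x = 1 := rfl

@[simp]
theorem SmoothFn.smul_apply (c : ℝ) (f : SmoothFn V N) (x : N) : (c • f) x = c * f x := rfl

end SmoothFn

/-- An AV-bundle (bundle of affine values) `Z → M`: a smooth principal bundle with structure group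
`(ℝ, +)`. The fundamental action of `t : ℝ` on `z : Z` is written `t +ᵥ z`; if `z, w` are in one
fibre, then `w - z` is the number `t` such that `t +ᵥ z = w`. -/
structure AVBundle (E F M Z : Type*) [NormedAddCommGroup E] [NormedSpace ℝ E]
    [NormedAddCommGroup F] [NormedSpace ℝ F] [TopologicalSpace M] [ChartedSpace E M]
    [TopologicalSpace Z] [ChartedSpace F Z] [AddAction ℝ Z] where
  proj : Z → M
  contMDiff_proj : ContMDiff 𝓘(ℝ, F) 𝓘(ℝ, E) ∞ proj
  contMDiff_vadd : ContMDiff (𝓘(ℝ, ℝ).prod 𝓘(ℝ, F)) 𝓘(ℝ, F) ∞ fun p : ℝ × Z => p.1 +ᵥ p.2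
  proj_vadd : ∀ (t : ℝ) (z : Z), proj (t +ᵥ z) = proj z
  exists_trivialization : ∀ m : M, ∃ (U : Set M) (e : OpenPartialHomeomorph Z (M × ℝ)),
    IsOpen U ∧ m ∈ U ∧ e.source = proj ⁻¹' U ∧ e.target = U ×ˢ Set.univ ∧
    ContMDiffOn 𝓘(ℝ, F) (𝓘(ℝ, E).prod 𝓘(ℝ, ℝ)) ∞ e e.source ∧
    ContMDiffOn (𝓘(ℝ, E).prod 𝓘(ℝ, ℝ)) 𝓘(ℝ, F) ∞ e.symm e.target ∧
    (∀ z ∈ e.source, (e z).1 = proj z) ∧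
    ∀ z ∈ e.source, ∀ t : ℝ, (e (t +ᵥ z)).2 = (e z).2 + t

namespace AVBundle
variable [AddAction ℝ Z] (P : AVBundle E F M Z)

/-- Smooth sections of an AV-bundle. -/
@[ext]
structure Section where
  toFun : M → Z
  contMDiff_toFun : ContMDiff 𝓘(ℝ, E) 𝓘(ℝ, F) ∞ toFun
  proj_toFun : ∀ m, P.proj (toFun m) = m

theorem exists_vadd_eq {P : AVBundle E F M Z} {z w : Z} (h : P.proj z = P.proj w) : ∃ t : ℝ, t +ᵥ z = w := by
  obtain ⟨U, e, -, hm, hs, -, -, -, h1, h2⟩ := P.exists_trivialization (P.proj z)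
  have hz : z ∈ e.source := by rw [hs]; exact hm
  have hw : w ∈ e.source := by rw [hs]; change P.proj w ∈ U; rwa [← h]
  refine ⟨(e w).2 - (e z).2, ?_⟩
  have hz' : ((e w).2 - (e z).2) +ᵥ z ∈ e.source := by
    rw [hs]; change P.proj _ ∈ U; rwa [P.proj_vadd]
  refine e.injOn hz' hw (Prod.ext ?_ ?_)
  · rw [h1 _ hz', h1 _ hw, P.proj_vadd, h]
  · rw [h2 _ hz]; ring

theorem proj_surjective : Function.Surjective P.proj := fun m => by
  obtain ⟨U, e, -, hm, hs, ht, -, -, h1, -⟩ := P.exists_trivialization m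
  have : ((m, 0) : M × ℝ) ∈ e.target := by rw [ht]; exact ⟨hm, trivial⟩
  refine ⟨e.symm (m, 0), ?_⟩
  rw [← h1 _ (e.map_target this), e.right_inv this]

/-- The affine function `z ↦ σ(π z) - z` on `Z` attached to a section `σ`. -/
def affFun (σ : P.Section) : SmoothFn F Z where
  val z := (exists_vadd_eq (σ.proj_toFun (P.proj z)).symm).choose
  property := by
    intro z₀
    obtain ⟨U, e, hU, hm, hs, -, he, -, h1, h2⟩ := P.exists_trivialization (P.proj z₀)
    have hopen : P.proj ⁻¹' U ∈ nhds z₀ :=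
      (hU.preimage P.contMDiff_proj.continuous).mem_nhds hm
    have hc : ContMDiffOn 𝓘(ℝ, F) 𝓘(ℝ, ℝ) ∞
        (fun z => (e (σ.toFun (P.proj z))).2 - (e z).2) (P.proj ⁻¹' U) := by
      have a : ContMDiffOn 𝓘(ℝ, F) 𝓘(ℝ, ℝ) ∞ (fun z => (e z).2) (P.proj ⁻¹' U) := by
        rw [← hs]; exact contMDiff_snd.comp_contMDiffOn he
      have b : ContMDiffOn 𝓘(ℝ, F) 𝓘(ℝ, F) ∞ (fun z => σ.toFun (P.proj z)) (P.proj ⁻¹' U) :=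
        (σ.contMDiff_toFun.comp P.contMDiff_proj).contMDiffOn
      refine (a.comp b fun z hz => ?_).sub a
      change P.proj _ ∈ U
      rw [σ.proj_toFun]
      exact hz
    refine (hc.contMDiffAt hopen).congr_of_eventuallyEq ?_
    filter_upwards [hopen] with z hz
    have h := (exists_vadd_eq (σ.proj_toFun (P.proj z)).symm).choose_spec
    have : (e (_ +ᵥ z)).2 = _ := congrArg (fun w => (e w).2) h
    rw [h2 z (by rw [hs]; exact hz)] at this
    linarith

theorem affFun_vadd (σ : P.Section) (z : Z) : P.affFun σ z +ᵥ z = σ.toFun (P.proj z) :=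
  (exists_vadd_eq (σ.proj_toFun (P.proj z)).symm).choose_spec

theorem vadd_left_injective (P : AVBundle E F M Z) {s t : ℝ} {z : Z} (h : s +ᵥ z = t +ᵥ z) : s = t := by
  obtain ⟨U, e, -, hm, hs, -, -, -, -, h2⟩ := P.exists_trivialization (P.proj z)
  have hz : z ∈ e.source := by rw [hs]; exact hm
  have := congrArg (fun w => (e w).2) h
  simp only [h2 z hz] at this
  linarith

theorem affFun_eq (σ : P.Section) {z : Z} {t : ℝ} (h : t +ᵥ z = σ.toFun (P.proj z)) :
    P.affFun σ z = t :=
  P.vadd_left_injective ((P.affFun_vadd σ z).trans h.symm)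

/-- The pull-back `f ↦ f ∘ π` of functions from `M` to `Z`. -/
def pull : SmoothFn E M →ₐ[ℝ] SmoothFn F Z where
  toFun f := ⟨fun z => f (P.proj z), f.contMDiff.comp P.contMDiff_proj⟩
  map_one' := rfl
  map_mul' _ _ := rfl
  map_zero' := rfl
  map_add' _ _ := rfl
  commutes' _ := rfl

theorem pull_apply (f : SmoothFn E M) (z : Z) : P.pull f z = f (P.proj z) := rfl

theorem pull_injective : Function.Injective P.pull := fun f g h => by
  ext m
  obtain ⟨z, rfl⟩ := P.proj_surjective m
  exact DFunLike.congr_fun h z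

theorem contMDiff_orbit (P : AVBundle E F M Z) (u : SmoothFn F Z) :
    ContMDiff (𝓘(ℝ, F).prod 𝓘(ℝ, ℝ)) 𝓘(ℝ, ℝ) ∞ fun p : Z × ℝ => u (p.2 +ᵥ p.1) :=
  u.contMDiff.comp (P.contMDiff_vadd.comp (contMDiff_snd.prodMk contMDiff_fst))

theorem differentiable_orbit (P : AVBundle E F M Z) (u : SmoothFn F Z) (z : Z) :
    Differentiable ℝ fun t : ℝ => u (t +ᵥ z) := by
  have : ContMDiff 𝓘(ℝ, ℝ) 𝓘(ℝ, ℝ) ∞ fun t : ℝ => u (t +ᵥ z) :=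
    (P.contMDiff_orbit u).comp (contMDiff_const.prodMk contMDiff_id)
  exact this.contDiff.differentiable (by simp)

variable [IsManifold 𝓘(ℝ, F) ∞ Z]

/-- The fundamental vector field `X_Z = -∂_s` on `Z`, as a derivation of the smooth functions; it is
normalized by `X_Z(σ ∘ π - id) = 1` for all sections `σ`. -/
def fundField : Derivation ℝ (SmoothFn F Z) (SmoothFn F Z) :=
  Derivation.mk'
    { toFun := fun u => ⟨fun z => - deriv (fun t : ℝ => u (t +ᵥ z)) 0, by
        have h : ∀ z₀ : Z, ContMDiffAt 𝓘(ℝ, F) 𝓘(ℝ, ℝ) ∞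
            (fun z => deriv (fun t : ℝ => u (t +ᵥ z)) 0) z₀ := fun z₀ => by
          have : IsManifold 𝓘(ℝ, F) 1 Z := IsManifold.of_le (n := ∞) (by simp)
          have := ContMDiffAt.mfderiv_apply (n := ∞) (m := ∞) (x₀ := z₀)
            (fun (z : Z) (t : ℝ) => u (t +ᵥ z)) (fun _ => (0 : ℝ)) id (fun _ => (1 : ℝ))
            ((P.contMDiff_orbit u) _) contMDiffAt_const contMDiffAt_id contMDiffAt_const
            (by simp)
          simpa [inTangentCoordinates_model_space, mfderiv_eq_fderiv] using this
        exact fun z₀ => (h z₀).neg⟩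
      map_add' := fun u v => by
        ext z
        change -deriv ((fun t : ℝ => u (t +ᵥ z)) + fun t : ℝ => v (t +ᵥ z)) 0 =
          -deriv _ 0 + -deriv _ 0
        rw [deriv_add (P.differentiable_orbit u z 0) (P.differentiable_orbit v z 0), neg_add]
      map_smul' := fun c u => by
        ext z
        change -deriv (c • fun t : ℝ => u (t +ᵥ z)) 0 = c • -deriv _ 0
        rw [deriv_const_smul _ (P.differentiable_orbit u z 0), smul_neg] }
    (fun u v => by
      ext z
      change -deriv ((fun t : ℝ => u (t +ᵥ z)) * fun t : ℝ => v (t +ᵥ z)) 0 =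
          u z * -deriv _ 0 + v z * -deriv _ 0
      rw [deriv_mul (P.differentiable_orbit u z 0) (P.differentiable_orbit v z 0)]
      simp only [zero_vadd]
      ring)

theorem fundField_apply (u : SmoothFn F Z) (z : Z) :
    P.fundField u z = - deriv (fun t : ℝ => u (t +ᵥ z)) 0 := rfl

theorem fundField_pull (f : SmoothFn E M) : P.fundField (P.pull f) = 0 := by
  ext z
  rw [fundField_apply]
  simp [pull_apply, P.proj_vadd]

theorem fundField_affFun (σ : P.Section) : P.fundField (P.affFun σ) = 1 := by
  ext z
  have : (fun t : ℝ => P.affFun σ (t +ᵥ z)) = fun t => P.affFun σ z - t := by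
    funext t
    refine P.affFun_eq σ ?_
    rw [P.proj_vadd, vadd_vadd, sub_add_cancel, affFun_vadd]
  rw [fundField_apply, this]
  simp

theorem exists_pull_eq {u : SmoothFn F Z} (hu : P.fundField u = 0) :
    ∃ f, P.pull f = u := by
  have hinv : ∀ (t : ℝ) (z : Z), u (t +ᵥ z) = u z := fun t z => by
    have hd : ∀ s, deriv (fun t : ℝ => u (t +ᵥ z)) s = 0 := fun s => by
      have h0 : deriv (fun t : ℝ => u (t +ᵥ (s +ᵥ z))) 0 = 0 := by
        have := DFunLike.congr_fun hu (s +ᵥ z)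
        rw [fundField_apply] at this
        simpa using this
      have h1 := deriv_comp_add_const (fun t : ℝ => u (t +ᵥ z)) s 0
      rw [zero_add] at h1
      rw [← h1]
      simpa only [vadd_vadd] using h0
    have := is_const_of_deriv_eq_zero (P.differentiable_orbit u z) hd t 0
    simpa using this
  have hfib : ∀ z w, P.proj z = P.proj w → u z = u w := fun z w h => by
    obtain ⟨t, rfl⟩ := exists_vadd_eq h
    exact (hinv t z).symm
  refine ⟨⟨fun m => u (P.proj_surjective m).choose, fun m => ?_⟩, ?_⟩
  · obtain ⟨U, e, hU, hm, hs, ht, -, he, h1, h2⟩ := P.exists_trivialization m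
    have hc : ContMDiffOn 𝓘(ℝ, E) 𝓘(ℝ, ℝ) ∞ (fun m => u (e.symm (m, 0))) U := by
      refine u.contMDiff.comp_contMDiffOn (he.comp (t := e.target)
        (contMDiffOn_id.prodMk contMDiffOn_const) fun m hm => ?_)
      rw [ht]; exact ⟨hm, trivial⟩
    refine (hc.contMDiffAt (hU.mem_nhds hm)).congr_of_eventuallyEq ?_
    filter_upwards [hU.mem_nhds hm] with m hm
    refine hfib _ _ ?_
    have : ((m, 0) : M × ℝ) ∈ e.target := by rw [ht]; exact ⟨hm, trivial⟩
    rw [(P.proj_surjective m).choose_spec, ← h1 _ (e.map_target this), e.right_inv this]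
  · ext z
    exact hfib _ _ (P.proj_surjective (P.proj z)).choose_spec

/-- The function on `M` whose pull-back is a given basic function on `Z`. -/
def descend (u : SmoothFn F Z) (hu : P.fundField u = 0) : SmoothFn E M :=
  (P.exists_pull_eq hu).choose

theorem pull_descend (u : SmoothFn F Z) (hu : P.fundField u = 0) :
    P.pull (P.descend u hu) = u :=
  (P.exists_pull_eq hu).choose_spec

/-- Sections of the bundle `T̃Z = TZ/ℝ` of affine derivations (the Atiyah algebroid of `Z`): the
invariant vector fields on `Z`, i.e. those commuting with `X_Z`, with the commutator bracket. -/
def TildeT : LieSubalgebra ℝ (Derivation ℝ (SmoothFn F Z) (SmoothFn F Z)) where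
  carrier := {X | ⁅P.fundField, X⁆ = 0}
  add_mem' := fun {X Y} hX hY => by
    change ⁅_, _⁆ = _ at hX hY
    change ⁅_, X + Y⁆ = _
    rw [lie_add, hX, hY, add_zero]
  zero_mem' := lie_zero P.fundField
  smul_mem' := fun c X hX => by
    change ⁅_, _⁆ = _ at hX
    change ⁅_, c • X⁆ = _
    rw [lie_smul, hX, smul_zero]
  lie_mem' := fun {X Y} hX hY => by
    change ⁅_, _⁆ = _ at hX hY
    change ⁅_, ⁅X, Y⁆⁆ = _
    rw [leibniz_lie, hX, hY, zero_lie, lie_zero, add_zero]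

theorem tildeT_comm (X : P.TildeT) (u : SmoothFn F Z) :
    P.fundField (X.1 u) = X.1 (P.fundField u) := by
  have h : ⁅P.fundField, X.1⁆ = 0 := X.2
  have := DFunLike.congr_fun h u
  rw [Derivation.commutator_apply] at this
  exact sub_eq_zero.1 this

namespace TildeT

variable {P}

theorem mem_iff {X : Derivation ℝ (SmoothFn F Z) (SmoothFn F Z)} :
    X ∈ P.TildeT ↔ ∀ u, P.fundField (X u) = X (P.fundField u) := by
  refine ⟨fun h u => P.tildeT_comm ⟨X, h⟩ u, fun h => ?_⟩
  change ⁅_, _⁆ = _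
  ext1 u
  rw [Derivation.commutator_apply, h, sub_self, Derivation.coe_zero, Pi.zero_apply]

instance : SMul (SmoothFn E M) P.TildeT where
  smul f X := ⟨P.pull f • X.1, mem_iff.2 fun u => by
    simp only [Derivation.smul_apply, smul_eq_mul, Derivation.leibniz, fundField_pull,
      tildeT_comm, mul_zero, add_zero]⟩

@[simp]
theorem coe_smul (f : SmoothFn E M) (X : P.TildeT) (u : SmoothFn F Z) :
    (f • X).1 u = P.pull f * X.1 u := rfl

@[ext]
theorem ext {X Y : P.TildeT} (h : ∀ u, X.1 u = Y.1 u) : X = Y :=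
  Subtype.ext (Derivation.ext h)

@[simp]
theorem coe_add (X Y : P.TildeT) (u : SmoothFn F Z) : (X + Y).1 u = X.1 u + Y.1 u := rfl

theorem coe_lie (X Y : P.TildeT) (u : SmoothFn F Z) :
    (⁅X, Y⁆ : P.TildeT).1 u = X.1 (Y.1 u) - Y.1 (X.1 u) := by
  change ⁅X.1, Y.1⁆ u = _
  rw [Derivation.commutator_apply]

instance : Module (SmoothFn E M) P.TildeT where
  one_smul X := by ext1 u; simp
  mul_smul f g X := by ext1 u; simp [mul_assoc]
  smul_zero f := by ext1 u; exact mul_zero _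
  smul_add f X Y := by ext1 u; simp [mul_add]
  add_smul f g X := by ext1 u; simp [add_mul]
  zero_smul X := by ext1 u; simp

theorem fundField_anchor (X : P.TildeT) (f : SmoothFn E M) :
    P.fundField (X.1 (P.pull f)) = 0 := by
  rw [tildeT_comm, fundField_pull, map_zero]

/-- The anchor of `T̃Z`: `X(f) ∘ π = X(f ∘ π)`. -/
instance : Bracket P.TildeT (SmoothFn E M) where
  bracket X f := P.descend (X.1 (P.pull f)) (fundField_anchor X f)

theorem pull_anchor (X : P.TildeT) (f : SmoothFn E M) : P.pull ⁅X, f⁆ = X.1 (P.pull f) :=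
  P.pull_descend _ _

instance : LieRingModule P.TildeT (SmoothFn E M) where
  add_lie X Y f := P.pull_injective (by simp [pull_anchor])
  lie_add X f g := P.pull_injective (by simp [pull_anchor])
  leibniz_lie X Y f := P.pull_injective (by simp [pull_anchor, Derivation.commutator_apply])

instance : LieRinehartRing (SmoothFn E M) P.TildeT where
  lie_smul_eq_mul' f g X := P.pull_injective (by simp [pull_anchor])
  leibniz_mul_right' X f g := P.pull_injective (by simp [pull_anchor]; ring)
  leibniz_smul_right' X Y f := by
    ext1 u
    simp [pull_anchor, Derivation.commutator_apply]
    ring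

instance : LieRinehartAlgebra ℝ (SmoothFn E M) P.TildeT where
  smul_assoc c f X := by ext1 u; simp
  smul_lie c X f := P.pull_injective (by simp [pull_anchor])
  lie_smul c X f := P.pull_injective (by simp [pull_anchor])


theorem fundField_eval (σ : P.Section) (X : P.TildeT) : P.fundField (X.1 (P.affFun σ)) = 0 := by
  rw [tildeT_comm, fundField_affFun, Derivation.map_one_eq_zero]

/-- The action of affine derivations on a section `σ` of `Z`, `X ↦ X(σ)`, where `X(σ)` is the
function on `M` with `X(σ) ∘ π = X(σ ∘ π - id)`. It is linear over the functions on `M`. -/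
def eval (σ : P.Section) : Module.Dual (SmoothFn E M) P.TildeT where
  toFun X := P.descend (X.1 (P.affFun σ)) (fundField_eval σ X)
  map_add' X Y := P.pull_injective (by simp only [pull_descend, map_add, coe_add])
  map_smul' f X := P.pull_injective (by
    simp only [pull_descend, coe_smul, smul_eq_mul, map_mul, RingHom.id_apply])

theorem pull_eval (σ : P.Section) (X : P.TildeT) : P.pull (eval σ X) = X.1 (P.affFun σ) :=
  P.pull_descend _ (fundField_eval σ X)

end TildeT

attribute [local instance] LieRing.ofAssociativeRing

/-- Sections of the bundle `L̃Z` of affine first-order differential operators on `Z`, with the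
commutator bracket: the operators `X + φ X_Z - X_Z(φ)` on functions on `Z`, where `X` is an
invariant vector field and `φ` a function on `Z` that is affine along the fibres. -/
def TildeL : LieSubalgebra ℝ (Module.End ℝ (SmoothFn F Z)) where
  carrier := {D | ∃ X ∈ P.TildeT, ∃ φ : SmoothFn F Z, P.fundField (P.fundField φ) = 0 ∧
    ∀ u, D u = X u + (φ * P.fundField u - P.fundField φ * u)}
  add_mem' := by
    rintro D D' ⟨X, hX, φ, hφ, h⟩ ⟨X', hX', φ', hφ', h'⟩
    refine ⟨X + X', P.TildeT.add_mem hX hX', φ + φ', by simp [hφ, hφ'], fun u => ?_⟩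
    rw [LinearMap.add_apply, h, h', Derivation.add_apply, map_add]
    ring
  zero_mem' := ⟨0, P.TildeT.zero_mem, 0, by simp, fun u => by simp⟩
  smul_mem' := by
    rintro c D ⟨X, hX, φ, hφ, h⟩
    refine ⟨c • X, P.TildeT.smul_mem c hX, c • φ, by simp [hφ], fun u => ?_⟩
    rw [LinearMap.smul_apply, h, Derivation.smul_apply, Derivation.map_smul, smul_add, smul_sub,
      smul_mul_assoc, smul_mul_assoc]
  lie_mem' := by
    rintro D D' ⟨X, hX, φ, hφ, h⟩ ⟨X', hX', φ', hφ', h'⟩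
    have c := TildeT.mem_iff.1 hX
    have c' := TildeT.mem_iff.1 hX'
    refine ⟨⁅X, X'⁆, P.TildeT.lie_mem hX hX',
      X φ' - X' φ + (φ * P.fundField φ' - φ' * P.fundField φ), ?_, fun u => ?_⟩
    · simp [c, c', hφ, hφ']
    · simp only [LieRing.of_associative_ring_bracket, LinearMap.sub_apply, Module.End.mul_apply,
        h, h', Derivation.commutator_apply, map_add, map_sub, Derivation.leibniz, smul_eq_mul, c,
        c', hφ, hφ']
      ring

namespace TildeL

variable {P}

theorem leibniz (D : P.TildeL) (u v : SmoothFn F Z) :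
    D.1 (u * v) = D.1 u * v + u * D.1 v - D.1 1 * (u * v) := by
  obtain ⟨X, hX, φ, hφ, h⟩ := D.2
  simp only [h, Derivation.leibniz, smul_eq_mul, Derivation.map_one_eq_zero]
  ring

theorem comm (D : P.TildeL) (u : SmoothFn F Z) :
    P.fundField (D.1 u) = D.1 (P.fundField u) - D.1 1 * P.fundField u := by
  obtain ⟨X, hX, φ, hφ, h⟩ := D.2
  simp only [h, Derivation.leibniz, smul_eq_mul, Derivation.map_one_eq_zero, map_add, map_sub, hφ,
    TildeT.mem_iff.1 hX]
  ring

instance : SMul (SmoothFn E M) P.TildeL where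
  smul f D := ⟨P.pull f • D.1, by
    obtain ⟨X, hX, φ, hφ, h⟩ := D.2
    refine ⟨P.pull f • X, (f • (⟨X, hX⟩ : P.TildeT)).2, P.pull f * φ, ?_, fun u => ?_⟩
    · simp [fundField_pull, hφ]
    · simp [fundField_pull, h]
      ring⟩

@[simp]
theorem coe_smul (f : SmoothFn E M) (D : P.TildeL) (u : SmoothFn F Z) :
    (f • D).1 u = P.pull f * D.1 u := rfl

@[ext]
theorem ext {D D' : P.TildeL} (h : ∀ u, D.1 u = D'.1 u) : D = D' :=
  Subtype.ext (LinearMap.ext h)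

theorem coe_lie (D D' : P.TildeL) (u : SmoothFn F Z) :
    (⁅D, D'⁆ : P.TildeL).1 u = D.1 (D'.1 u) - D'.1 (D.1 u) := rfl

instance : Module (SmoothFn E M) P.TildeL where
  one_smul X := by ext1 u; simp
  mul_smul f g X := by ext1 u; simp [mul_assoc]
  smul_zero f := by ext1 u; exact mul_zero _
  smul_add f X Y := by ext1 u; simp [mul_add]
  add_smul f g X := by ext1 u; simp [add_mul]
  zero_smul X := by ext1 u; simp

/-- The anchor of `L̃Z`: the vector field part of `f ∘ π ↦ D(f ∘ π)`. -/
instance : Bracket P.TildeL (SmoothFn E M) where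
  bracket D f := P.descend (D.1 (P.pull f) - D.1 1 * P.pull f) (by
    simp [comm, fundField_pull])

theorem pull_anchor (D : P.TildeL) (f : SmoothFn E M) :
    P.pull ⁅D, f⁆ = D.1 (P.pull f) - D.1 1 * P.pull f :=
  P.pull_descend _ _

instance : LieRingModule P.TildeL (SmoothFn E M) where
  add_lie D D' f := P.pull_injective (by simp [pull_anchor]; ring)
  lie_add D f g := P.pull_injective (by simp [pull_anchor]; ring)
  leibniz_lie D D' f := P.pull_injective (by
    simp only [pull_anchor, map_add, map_sub, coe_lie, leibniz _ (_ : SmoothFn F Z) (P.pull f)]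
    ring)

instance : LieRinehartRing (SmoothFn E M) P.TildeL where
  lie_smul_eq_mul' f g D := P.pull_injective (by simp [pull_anchor]; ring)
  leibniz_mul_right' D f g := P.pull_injective (by
    simp only [pull_anchor, map_add, map_mul, smul_eq_mul, leibniz D (P.pull f)]
    ring)
  leibniz_smul_right' D D' f := by
    ext1 u
    change (⁅D, f • D'⁆ : P.TildeL).1 u = (f • ⁅D, D'⁆ : P.TildeL).1 u + (⁅D, f⁆ • D').1 u
    simp only [coe_lie, coe_smul, pull_anchor, leibniz D (P.pull f)]
    ring

instance : LieRinehartAlgebra ℝ (SmoothFn E M) P.TildeL where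
  smul_assoc c f D := by ext1 u; simp
  smul_lie c D f := P.pull_injective (by simp [pull_anchor, smul_sub])
  lie_smul c D f := P.pull_injective (by simp [pull_anchor, smul_sub])

theorem fundField_apply_one (D : P.TildeL) : P.fundField (D.1 1) = 0 := by simp [comm]

/-- The canonical closed one-form `φ⁰` on `L̃Z`: `φ⁰(D) ∘ π = D(1)`; by `lie_fundField` it is
determined by `[D, X_Z] = φ⁰(D) X_Z`. -/
def phi : Module.Dual (SmoothFn E M) P.TildeL where
  toFun D := P.descend (D.1 1) (fundField_apply_one D)
  map_add' D D' := P.pull_injective (by simp [pull_descend])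
  map_smul' f D := P.pull_injective (by simp [pull_descend])

theorem pull_phi (D : P.TildeL) : P.pull (phi D) = D.1 1 :=
  P.pull_descend _ (fundField_apply_one D)

theorem lie_fundField (D : P.TildeL) :
    ⁅D.1, (P.fundField : Module.End ℝ (SmoothFn F Z))⁆ =
      P.pull (phi D) • (P.fundField : Module.End ℝ (SmoothFn F Z)) := by
  ext1 u
  change D.1 (P.fundField u) - P.fundField (D.1 u) = P.pull (phi D) * P.fundField u
  rw [comm, pull_phi]
  ring

theorem fundField_eval (σ : P.Section) (D : P.TildeL) : P.fundField (D.1 (P.affFun σ)) = 0 := by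
  simp [comm, fundField_affFun]

/-- The action of affine first-order differential operators on a section `σ` of `Z`,
`D ↦ D(σ)`, where `D(σ) ∘ π = D(σ ∘ π - id)`. -/
def eval (σ : P.Section) : Module.Dual (SmoothFn E M) P.TildeL where
  toFun D := P.descend (D.1 (P.affFun σ)) (fundField_eval σ D)
  map_add' D D' := P.pull_injective (by simp [pull_descend])
  map_smul' f D := P.pull_injective (by simp [pull_descend])

theorem pull_eval (σ : P.Section) (D : P.TildeL) : P.pull (eval σ D) = D.1 (P.affFun σ) :=
  P.pull_descend _ (fundField_eval σ D)

end TildeL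

section Brackets

variable {P}

/-- The affine structure on sections: a function `f` on `M` acts by `(f +ᵥ σ)(m) = f(m) +ᵥ σ(m)`. -/
instance : VAdd (SmoothFn E M) P.Section where
  vadd f σ :=
    { toFun := fun m => f m +ᵥ σ.toFun m
      contMDiff_toFun := P.contMDiff_vadd.comp (f.contMDiff.prodMk σ.contMDiff_toFun)
      proj_toFun := fun m => by rw [P.proj_vadd, σ.proj_toFun] }

/-- `T : Sec(Z) → C^∞(M)` is affine over `ℝ`, with linear part `L`. -/
def IsAffineWith (T : P.Section → SmoothFn E M) (L : SmoothFn E M →ₗ[ℝ] SmoothFn E M) : Prop :=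
  ∀ (f : SmoothFn E M) (σ : P.Section), T (f +ᵥ σ) = T σ + L f

/-- Affine derivations: affine maps whose linear part is a derivation of the functions on `M`. -/
def IsAffineDerivation (T : P.Section → SmoothFn E M) : Prop :=
  ∃ X : Derivation ℝ (SmoothFn E M) (SmoothFn E M), IsAffineWith T X

/-- Affine first-order differential operators: affine maps whose linear part is a linear first-order
differential operator `f ↦ X(f) + h f` on the functions on `M`. -/
def IsAffineFirstOrder (T : P.Section → SmoothFn E M) : Prop :=
  ∃ (X : Derivation ℝ (SmoothFn E M) (SmoothFn E M)) (h : SmoothFn E M),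
    IsAffineWith T (X + LinearMap.mulLeft ℝ h)

/-- `{σ, f}_v²`: the linear part, in the second argument, of a bi-affine bracket. -/
def linPart (B : P.Section → P.Section → SmoothFn E M) (σ : P.Section) (f : SmoothFn E M) :
    SmoothFn E M :=
  B σ (f +ᵥ σ) - B σ σ

/-- Affine Lie brackets on the sections of `Z`. -/
structure IsAffineLieBracket (B : P.Section → P.Section → SmoothFn E M) : Prop where
  affine_left : ∀ τ, ∃ L, IsAffineWith (fun σ => B σ τ) L
  affine_right : ∀ σ, ∃ L, IsAffineWith (B σ) L
  skew : ∀ σ τ, B σ τ = - B τ σ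
  jacobi : ∀ σ₁ σ₂ σ₃,
    linPart B σ₁ (B σ₂ σ₃) + linPart B σ₂ (B σ₃ σ₁) + linPart B σ₃ (B σ₁ σ₂) = 0

/-- Aff-Poisson brackets. -/
def IsAffPoisson (B : P.Section → P.Section → SmoothFn E M) : Prop :=
  IsAffineLieBracket B ∧ ∀ σ, IsAffineDerivation (B σ)

/-- Aff-Jacobi brackets. -/
def IsAffJacobi (B : P.Section → P.Section → SmoothFn E M) : Prop :=
  IsAffineLieBracket B ∧ ∀ σ, IsAffineFirstOrder (B σ)

/-- The bracket represented by a bisection of `T̃Z`; for `Λ = X ∧ Y` it is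
`{σ, τ} = X(σ) Y(τ) - Y(σ) X(τ)`. -/
def bracketT (Λ : ⋀[SmoothFn E M]^2 P.TildeT) (σ τ : P.Section) : SmoothFn E M :=
  exteriorPower.pairingDual (SmoothFn E M) P.TildeT 2
    (exteriorPower.ιMulti (SmoothFn E M) 2 ![TildeT.eval σ, TildeT.eval τ]) Λ

theorem bracketT_ιMulti (X Y : P.TildeT) (σ τ : P.Section) :
    bracketT (exteriorPower.ιMulti (SmoothFn E M) 2 ![X, Y]) σ τ =
      TildeT.eval σ X * TildeT.eval τ Y - TildeT.eval σ Y * TildeT.eval τ X := by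
  rw [bracketT, exteriorPower.pairingDual_ιMulti_ιMulti, Matrix.det_fin_two]
  simp
  ring

/-- The bracket represented by a bisection of `L̃Z`; for `J = D ∧ D'` it is
`{σ, τ} = D(σ) D'(τ) - D'(σ) D(τ)`. -/
def bracketL (J : ⋀[SmoothFn E M]^2 P.TildeL) (σ τ : P.Section) : SmoothFn E M :=
  exteriorPower.pairingDual (SmoothFn E M) P.TildeL 2
    (exteriorPower.ιMulti (SmoothFn E M) 2 ![TildeL.eval σ, TildeL.eval τ]) J

theorem bracketL_ιMulti (D D' : P.TildeL) (σ τ : P.Section) :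
    bracketL (exteriorPower.ιMulti (SmoothFn E M) 2 ![D, D']) σ τ =
      TildeL.eval σ D * TildeL.eval τ D' - TildeL.eval σ D' * TildeL.eval τ D := by
  rw [bracketL, exteriorPower.pairingDual_ιMulti_ιMulti, Matrix.det_fin_two]
  simp
  ring

end Brackets

end AVBundle

end AVGeometry

end

set_option linter.unusedSectionVars false

/-! Part (a) is the case φ = 0 of (b) (`jacobiLieDiff_zero`), so the argument runs over any
Lie-Rinehart algebra with a closed one-form φ. The only data from Z are one-forms ev σ, one for each
section σ, with ev(f + σ) = ev σ + df + fφ and d(ev σ) = -φ ∧ ev σ; the bracket is J(ev σ, ev τ).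

Write j = i_J and D_s = d + s φ∧, so that D_s² = 0. The commutator of j with φ∧ is the contraction
with i_φ J, and therefore on n-forms the Jacobi-Lie differential is L = j D_{n+t} - D_{n+t-1} j
(`jacobiLieOp_projOp`). The operator K = 2 j D_{s-1} j - D_{s-2} j² - j² D_s does not depend on s
(`schoutenOp_eq`), and expanding gives 2L² = K D_{n+t} + D_{n+t-2} K on n-forms (`jacobiLieOp_sq`).
K has degree -3, is linear over functions and anticommutes with contractions: it is, up to a factor,
the contraction with a twisted Schouten square of J. On ev σ₁ ∧ ev σ₂ ∧ ev σ₃ it equals -2 times the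
Jacobiator of the bracket (`schoutenOp_wedgeOp_three`).

If the Jacobi identity holds, K vanishes on products of the ev σ. These span the dual module
locally, so K = 0 and L² = 0 for every t. Conversely, L² = 0 for t = 1, applied to f α ∧ β with α =
ev σ₁ and β = ev σ₂, says that the Jacobiator of α, β, df + fφ is zero
(`jacobiator_twistedDiff_eq_zero`). Any third section is f + σ₁, and the Jacobiator of α, β, α is
zero, so the Jacobi identity follows.

Geometry enters through the local spanning. Forms are alternating maps on the module of global
sections, so what is needed is, at each point, a function χ not vanishing there with χY = ∑ c_i(Y)
X_i for all Y and c_i in the span of the ev σ (`TildeT.hasFrame`, `TildeL.hasFrame`). This rests on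
Hadamard's lemma, by which a derivation on Z is determined by its values on pull-backs and on one
F_σ, and on the existence of a global section. -/

namespace AVGeometry

/-! ### Operators on families of forms of all degrees -/

section Total

variable (R A : Type*) [CommRing R] [Algebra ℝ R] [LieRing A] [LieAlgebra ℝ A] [Module R A]
  [LieRingModule A R] [LieRinehartRing R A] [LieRinehartAlgebra ℝ R A]

/-- Families of forms, one in each degree. -/
abbrev Total := (n : ℕ) → Form R A n

/-- The ring of real operators on families of forms. -/
def Op := Module.End ℝ (Total R A)

noncomputable instance : Ring (Op R A) := inferInstanceAs (Ring (Module.End ℝ (Total R A)))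

noncomputable instance : Algebra ℝ (Op R A) :=
  inferInstanceAs (Algebra ℝ (Module.End ℝ (Total R A)))

instance : FunLike (Op R A) (Total R A) (Total R A) :=
  inferInstanceAs (FunLike (Module.End ℝ (Total R A)) _ _)

instance : LinearMapClass (Op R A) ℝ (Total R A) (Total R A) :=
  inferInstanceAs (LinearMapClass (Module.End ℝ (Total R A)) ℝ _ _)

variable {R A}

theorem Op.mul_apply (P Q : Op R A) (θ : Total R A) : (P * Q) θ = P (Q θ) := rfl

theorem Op.add_apply (P Q : Op R A) (θ : Total R A) : (P + Q) θ = P θ + Q θ := rfl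

theorem Op.sub_apply (P Q : Op R A) (θ : Total R A) : (P - Q) θ = P θ - Q θ := rfl

theorem Op.neg_apply (P : Op R A) (θ : Total R A) : (-P) θ = -P θ := rfl

theorem Op.zero_apply (θ : Total R A) : (0 : Op R A) θ = 0 := rfl

theorem Op.ext {P Q : Op R A} (h : ∀ θ n, P θ n = Q θ n) : P = Q :=
  DFunLike.ext _ _ fun θ => funext (h θ)

theorem Op.ext_apply {P Q : Op R A}
    (h : ∀ (θ : Total R A) n (v : Fin n → A), P θ n v = Q θ n v) : P = Q :=
  Op.ext fun θ n => AlternatingMap.ext (h θ n)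

/-- An operator of degree `1` on families of forms, given degree by degree. -/
def raise (f : ∀ n, Form R A n →ₗ[ℝ] Form R A (n + 1)) : Op R A :=
  (LinearMap.pi fun n => match n with
    | 0 => 0
    | n + 1 => f n ∘ₗ LinearMap.proj n : Module.End ℝ (Total R A))

/-- The differential on families of forms. -/
noncomputable def dOp : Op R A := raise extDeriv

/-- The exterior multiplication by a one-form on families of forms. -/
noncomputable def wedgeOp (φ : Module.Dual R A) : Op R A :=
  raise fun n => (wedgeOne φ n).restrictScalars ℝ

/-- The contraction with a section on families of forms. -/
noncomputable def contrOp (X : A) : Op R A :=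
  (LinearMap.pi fun n => (contractOne n X).restrictScalars ℝ ∘ₗ LinearMap.proj (n + 1) : Module.End ℝ (Total R A))

/-- The contraction with a bisection on families of forms. -/
noncomputable def contrTwoOp (J : ⋀[R]^2 A) : Op R A :=
  (LinearMap.pi fun n => (contractTwo n J).restrictScalars ℝ ∘ₗ LinearMap.proj (n + 2) : Module.End ℝ (Total R A))

/-- The multiplication by a function on families of forms. -/
def mulOp (f : R) : Op R A :=
  (LinearMap.pi fun n => ((LinearMap.lsmul R (Form R A n) f).restrictScalars ℝ) ∘ₗ LinearMap.proj n : Module.End ℝ (Total R A))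

/-- The Lie derivative on families of forms. -/
noncomputable def lieOp (X : A) : Op R A := contrOp X * dOp + dOp * contrOp X

/-- The operator that multiplies forms by their degree. -/
def degOp : Op R A := (LinearMap.pi fun n => (n : ℝ) • LinearMap.proj n : Module.End ℝ (Total R A))

/-- The projection to a degree. -/
def projOp (k : ℕ) : Op R A := (LinearMap.pi fun n => if n = k then LinearMap.proj n else 0 : Module.End ℝ (Total R A))

/-- The constant function `1`, as a family of forms. -/
noncomputable def oneTotal : Total R A := Pi.single 0 (AlternatingMap.constOfIsEmpty R A (Fin 0) 1)

theorem dOp_succ (θ : Total R A) (n : ℕ) : dOp θ (n + 1) = extDeriv n (θ n) := rfl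

theorem wedgeOp_zero (φ : Module.Dual R A) (θ : Total R A) : wedgeOp φ θ 0 = 0 := rfl

theorem wedgeOp_succ (φ : Module.Dual R A) (θ : Total R A) (n : ℕ) :
    wedgeOp φ θ (n + 1) = wedgeOne φ n (θ n) := rfl

theorem contrOp_apply (X : A) (θ : Total R A) (n : ℕ) (v : Fin n → A) :
    contrOp X θ n v = θ (n + 1) (Fin.cons X v : Fin (n + 1) → A) := rfl

theorem contrTwoOp_apply (J : ⋀[R]^2 A) (θ : Total R A) (n : ℕ) :
    contrTwoOp J θ n = contractTwo n J (θ (n + 2)) := rfl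

theorem mulOp_apply (f : R) (θ : Total R A) (n : ℕ) : mulOp f θ n = f • θ n := rfl

theorem projOp_apply (k : ℕ) (θ : Total R A) (n : ℕ) :
    projOp k θ n = if n = k then θ n else 0 := by
  change (if n = k then LinearMap.proj n else 0 : Total R A →ₗ[ℝ] Form R A n) θ = _
  split_ifs <;> rfl

theorem mulOp_add (f g : R) : mulOp (A := A) (f + g) = mulOp f + mulOp g := by
  refine Op.ext_apply fun θ n v => ?_; exact add_mul _ _ _

theorem mulOp_mul (f g : R) : mulOp (A := A) (f * g) = mulOp f * mulOp g := by
  refine Op.ext_apply fun θ n v => ?_; exact mul_assoc _ _ _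

theorem mulOp_zero : mulOp (A := A) (0 : R) = 0 := by
  refine Op.ext_apply fun θ n v => ?_; exact zero_mul _

theorem mulOp_neg (f : R) : mulOp (A := A) (-f) = -mulOp f := by
  refine Op.ext_apply fun θ n v => ?_; exact neg_mul _ _

theorem mulOp_sub (f g : R) : mulOp (A := A) (f - g) = mulOp f - mulOp g := by
  rw [sub_eq_add_neg, mulOp_add, mulOp_neg, sub_eq_add_neg]

theorem contrOp_add (X Y : A) : contrOp (R := R) (X + Y) = contrOp X + contrOp Y := by
  refine Op.ext_apply fun θ n v => ?_
  change contractOne n (X + Y) (θ (n + 1)) v = contractOne n X (θ (n + 1)) v + contractOne n Y (θ (n + 1)) v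
  simp [contractOne_apply]

theorem contrOp_smul (f : R) (X : A) : contrOp (R := R) (f • X) = mulOp f * contrOp X := by
  refine Op.ext_apply fun θ n v => ?_
  change contractOne n (f • X) (θ (n + 1)) v = f * contractOne n X (θ (n + 1)) v
  simp [contractOne_apply]

theorem contrOp_zero : contrOp (R := R) (0 : A) = 0 := by
  simpa using contrOp_add (R := R) (0 : A) 0

theorem contrOp_neg (X : A) : contrOp (R := R) (-X) = -contrOp X := by
  rw [eq_neg_iff_add_eq_zero, ← contrOp_add, neg_add_cancel, contrOp_zero]

theorem contrOp_sub (X Y : A) : contrOp (R := R) (X - Y) = contrOp X - contrOp Y := by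
  rw [sub_eq_add_neg, contrOp_add, contrOp_neg, sub_eq_add_neg]

theorem contrTwoOp_add (J K : ⋀[R]^2 A) : contrTwoOp (J + K) = contrTwoOp J + contrTwoOp K := by
  refine Op.ext_apply fun θ n v => ?_
  change contractTwo n (J + K) (θ (n + 2)) v = contractTwo n J (θ (n + 2)) v + contractTwo n K (θ (n + 2)) v
  simp

theorem contrTwoOp_smul (f : R) (J : ⋀[R]^2 A) : contrTwoOp (f • J) = mulOp f * contrTwoOp J := by
  refine Op.ext_apply fun θ n v => ?_
  change contractTwo n (f • J) (θ (n + 2)) v = f * contractTwo n J (θ (n + 2)) v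
  simp

theorem contrTwoOp_zero : contrTwoOp (0 : ⋀[R]^2 A) = 0 := by
  simpa using contrTwoOp_add (0 : ⋀[R]^2 A) 0

theorem contrTwoOp_ιMulti (X Y : A) :
    contrTwoOp (exteriorPower.ιMulti R 2 ![X, Y]) = contrOp Y * contrOp X := by
  refine Op.ext_apply fun θ n v => ?_
  exact contractTwo_ιMulti n X Y (θ (n + 2)) v

theorem wedgeOp_add (φ ψ : Module.Dual R A) : wedgeOp (φ + ψ) = wedgeOp φ + wedgeOp ψ := by
  refine Op.ext_apply fun θ n v => ?_
  cases n with
  | zero => exact (add_zero _).symm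
  | succ n =>
    change wedgeOne (φ + ψ) n (θ n) v = wedgeOne φ n (θ n) v + wedgeOne ψ n (θ n) v
    simp [wedgeOne, AlternatingMap.alternatizeUncurryFin_apply, Finset.sum_add_distrib, add_mul]

theorem wedgeOp_smul (f : R) (φ : Module.Dual R A) :
    wedgeOp (f • φ) = mulOp f * wedgeOp φ := by
  refine Op.ext_apply fun θ n v => ?_
  cases n with
  | zero => exact (mul_zero _).symm
  | succ n =>
    change wedgeOne (f • φ) n (θ n) v = f * wedgeOne φ n (θ n) v
    simp [wedgeOne, AlternatingMap.alternatizeUncurryFin_apply, Finset.mul_sum, mul_left_comm,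
      mul_assoc]

theorem wedgeOp_zero' : wedgeOp (0 : Module.Dual R A) = 0 := by
  simpa using wedgeOp_add (0 : Module.Dual R A) 0

theorem wedgeOp_neg (φ : Module.Dual R A) : wedgeOp (-φ) = -wedgeOp φ := by
  rw [eq_neg_iff_add_eq_zero, ← wedgeOp_add, neg_add_cancel, wedgeOp_zero']

theorem wedgeOp_sub (φ ψ : Module.Dual R A) : wedgeOp (φ - ψ) = wedgeOp φ - wedgeOp ψ := by
  rw [sub_eq_add_neg, wedgeOp_add, wedgeOp_neg, sub_eq_add_neg]

theorem contrOp_mulOp (X : A) (f : R) : contrOp X * mulOp f = mulOp f * contrOp X := rfl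

theorem contrTwoOp_mulOp (J : ⋀[R]^2 A) (f : R) :
    contrTwoOp J * mulOp f = mulOp f * contrTwoOp J := by
  refine Op.ext_apply fun θ n v => ?_
  exact DFunLike.congr_fun ((contractTwo n J).map_smul f (θ (n + 2))) v

theorem wedgeOp_mulOp (φ : Module.Dual R A) (f : R) :
    wedgeOp φ * mulOp f = mulOp f * wedgeOp φ := by
  refine Op.ext_apply fun θ n v => ?_
  cases n with
  | zero => exact (mul_zero _).symm
  | succ n => exact DFunLike.congr_fun ((wedgeOne φ n).map_smul f (θ n)) v

theorem contrOp_contrOp_self (X : A) : contrOp (R := R) X * contrOp X = 0 := by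
  refine Op.ext_apply fun θ n v => ?_
  refine (θ (n + 2)).map_eq_zero_of_eq (i := 0) (j := 1) _ ?_ (by simp)
  rfl

theorem contrOp_anticomm (X Y : A) :
    contrOp (R := R) X * contrOp Y = -(contrOp Y * contrOp X) := by
  have h := contrOp_contrOp_self (R := R) (X + Y)
  rw [contrOp_add, add_mul, mul_add, mul_add, contrOp_contrOp_self, contrOp_contrOp_self] at h
  rw [eq_neg_iff_add_eq_zero]
  simpa using h

/-- Operators that commute with contractions are determined in degree `0`. -/
theorem op_ext_of_comm {P Q : Op R A} (h0 : ∀ θ, P θ 0 = Q θ 0)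
    (h : ∀ X, contrOp X * (P - Q) = (P - Q) * contrOp X) : P = Q := by
  rw [← sub_eq_zero]
  have : ∀ n θ, (P - Q) θ n = 0 := fun n => by
    induction n with
    | zero => exact fun θ => sub_eq_zero.2 (h0 θ)
    | succ n ih =>
      intro θ
      ext v
      -- The value on `v` is the value on the tail of the contraction with `v 0`, one degree lower.
      have := DFunLike.congr_fun (congrFun (DFunLike.congr_fun (h (v 0)) θ) n) (Fin.tail v)
      rw [Op.mul_apply, Op.mul_apply, ih, contrOp_apply, Fin.cons_self_tail] at this
      exact this
  refine Op.ext_apply fun θ n v => ?_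
  rw [this]; rfl

/-- Operators that anticommute with contractions are determined in degree `0`. -/
theorem op_ext_of_anticomm {P Q : Op R A} (h0 : ∀ θ, P θ 0 = Q θ 0)
    (h : ∀ X, contrOp X * (P - Q) = -((P - Q) * contrOp X)) : P = Q := by
  rw [← sub_eq_zero]
  have : ∀ n θ, (P - Q) θ n = 0 := fun n => by
    induction n with
    | zero => exact fun θ => sub_eq_zero.2 (h0 θ)
    | succ n ih =>
      intro θ
      ext v
      have := DFunLike.congr_fun (congrFun (DFunLike.congr_fun (h (v 0)) θ) n) (Fin.tail v)
      rw [Op.mul_apply, Op.neg_apply, Op.mul_apply, Pi.neg_apply, ih,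
        contrOp_apply, Fin.cons_self_tail] at this
      rw [this]; simp
  refine Op.ext_apply fun θ n v => ?_
  rw [this]; rfl

theorem removeNth_succ_cons {n : ℕ} (X : A) (v : Fin (n + 1) → A) (i : Fin (n + 1)) :
    i.succ.removeNth (Fin.cons X v : Fin (n + 2) → A) = Fin.cons X (i.removeNth v) := by
  funext a
  refine Fin.cases ?_ (fun a => ?_) a <;> simp [Fin.removeNth_apply]

theorem form_cons_smul {n : ℕ} (η : Form R A (n + 1)) (f : R) (X : A) (w : Fin n → A) :
    η (Fin.cons (f • X) w : Fin (n + 1) → A) = f • η (Fin.cons X w : Fin (n + 1) → A) :=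
  η.toMultilinearMap.cons_smul w f X

theorem form_update {n : ℕ} (η : Form R A (n + 1)) (v : Fin (n + 1) → A) (j : Fin (n + 1)) (x : A) :
    η (Function.update v j x) =
      (-1 : ℤ) ^ (j : ℕ) • η (Fin.cons x (j.removeNth v) : Fin (n + 1) → A) := by
  rw [← Fin.insertNth_removeNth, AlternatingMap.map_insertNth]; rfl

/-- Cartan's formula. In i_X dθ the summands in which X remains an argument cancel against d i_X θ.
The bracket of X with `v j` occurs once for each order of the pair, so the two factors 1/2 of
`extDeriv` add up to 1. -/
theorem lieOp_apply (X : A) (θ : Total R A) (n : ℕ) (v : Fin n → A) :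
    lieOp X θ n v = ⁅X, θ n v⁆ - ∑ j, θ n (Function.update v j ⁅X, v j⁆) := by
  cases n with
  | zero =>
    change extDeriv 0 (θ 0) (Fin.cons X v : Fin 1 → A) + 0 = _
    rw [extDeriv_apply]
    simp
  | succ n =>
    have hneg : ∀ y : A, ∀ w : Fin n → A, θ (n + 1) (Fin.cons (-y) w : Fin (n + 1) → A) =
        -θ (n + 1) (Fin.cons y w : Fin (n + 1) → A) := fun y w => by
      simpa using form_cons_smul (θ (n + 1)) (-1 : R) y w
    have hd : ∀ (y z : A) (w : Fin n → A) (j : Fin n),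
        Function.update (Fin.cons y w : Fin (n + 1) → A) j.succ z =
          Fin.cons y (Function.update w j z) := fun y z w j => (Fin.cons_update ..).symm
    have hs : ∀ (y : A) (w : Fin n → A), ∑ j, θ (n + 1) (Function.update (Fin.cons X w : Fin (n + 1) → A)
        j ⁅y, (Fin.cons X w : Fin (n + 1) → A) j⁆) = θ (n + 1) (Fin.cons ⁅y, X⁆ w : Fin (n + 1) → A) +
          ∑ j, θ (n + 1) (Fin.cons X (Function.update w j ⁅y, w j⁆) : Fin (n + 1) → A) := fun y w => by
      simp only [Fin.sum_univ_succ, Fin.update_cons_zero, hd, Fin.cons_zero, Fin.cons_succ]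
    change extDeriv (n + 1) (θ (n + 1)) (Fin.cons X v : Fin (n + 2) → A) +
      extDeriv n (contractOne n X (θ (n + 1))) v = _
    rw [extDeriv_apply, extDeriv_apply, Fin.sum_univ_succ]
    have h0 : (0 : Fin (n + 2)).removeNth (Fin.cons X v : Fin (n + 2) → A) = v := by simp
    simp only [removeNth_succ_cons, h0, Fin.cons_zero, Fin.cons_succ, Fin.val_zero, pow_zero, one_smul,
      hs]
    have hc : ∀ w : Fin n → A, contractOne n X (θ (n + 1)) w = θ (n + 1) (Fin.cons X w : Fin (n + 1) → A) :=
      fun _ => rfl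
    simp only [hc]
    have hk : ∑ j, θ (n + 1) (Function.update v j ⁅X, v j⁆) = -∑ j : Fin (n + 1), (-1 : ℤ) ^ (j : ℕ) •
        θ (n + 1) (Fin.cons ⁅v j, X⁆ (j.removeNth v) : Fin (n + 1) → A) := by
      rw [← Finset.sum_neg_distrib]
      refine Finset.sum_congr rfl fun j _ => ?_
      rw [form_update, ← lie_skew, hneg, smul_neg]
    rw [hk, sub_neg_eq_add, smul_neg, sub_neg_eq_add, add_assoc, add_assoc]
    congr 1
    rw [← Finset.sum_add_distrib, Finset.smul_sum, ← Finset.sum_add_distrib]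
    refine Finset.sum_congr rfl fun j _ => ?_
    simp only [Fin.val_succ, pow_succ, smul_add, smul_sub, mul_neg, mul_one, neg_smul]
    set a := θ (n + 1) (Fin.cons ⁅v j, X⁆ (j.removeNth v) : Fin (n + 1) → A)
    rw [smul_comm (1 / 2 : ℝ)]
    have h2 : a = (1 / 2 : ℝ) • a + (1 / 2 : ℝ) • a := by rw [← add_smul]; norm_num
    have h3 : (-1 : ℤ) ^ (j : ℕ) • a = (-1 : ℤ) ^ (j : ℕ) • (1 / 2 : ℝ) • a + (-1 : ℤ) ^ (j : ℕ) • (1 / 2 : ℝ) • a := by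
      rw [← smul_add, ← h2]
    rw [h3]
    abel

end Total
end AVGeometry

namespace AVGeometry

/-! ### Cartan calculus: commutation relations between d, contractions, Lie derivatives and φ∧ -/

section Cartan

variable {R A : Type*} [CommRing R] [Algebra ℝ R] [LieRing A] [LieAlgebra ℝ A] [Module R A]
  [LieRingModule A R] [LieRinehartRing R A] [LieRinehartAlgebra ℝ R A]

theorem contrOp_dOp (X : A) :
    contrOp (R := R) X * dOp = lieOp X - dOp * contrOp X := by
  rw [lieOp]; abel

theorem contrOp_lieOp (X Y : A) :
    contrOp (R := R) Y * lieOp X = lieOp X * contrOp Y - contrOp ⁅X, Y⁆ := by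
  refine Op.ext_apply fun θ n v => ?_
  change lieOp X θ (n + 1) (Fin.cons Y v : Fin (n + 1) → A) =
    lieOp X (contrOp Y θ) n v - contrOp ⁅X, Y⁆ θ n v
  have hd : ∀ (y z : A) (w : Fin n → A) (j : Fin n),
      Function.update (Fin.cons y w : Fin (n + 1) → A) j.succ z =
        Fin.cons y (Function.update w j z) := fun y z w j => (Fin.cons_update ..).symm
  simp only [lieOp_apply, Fin.sum_univ_succ, Fin.update_cons_zero, hd, Fin.cons_zero, Fin.cons_succ,
    contrOp_apply]
  abel

theorem lieOp_zero_apply (X : A) (θ : Total R A) (v : Fin 0 → A) :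
    lieOp X θ 0 v = ⁅X, θ 0 v⁆ := by
  rw [lieOp_apply]; simp

/-- The pattern of this section: the difference of the two sides commutes or anticommutes with every
contraction, so only forms of degree 0 in the result have to be compared. Here the commutation is
the Jacobi identity in `A`, and degree 0 says that the anchor preserves brackets. -/
theorem lieOp_lieOp (X Y : A) :
    lieOp (R := R) X * lieOp Y - lieOp Y * lieOp X = lieOp ⁅X, Y⁆ := by
  refine op_ext_of_comm (fun θ => ?_) fun Z => ?_
  · ext v
    change lieOp X (lieOp Y θ) 0 v - lieOp Y (lieOp X θ) 0 v = _
    simp only [lieOp_zero_apply]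
    rw [lie_lie]
  · have h1 := contrOp_lieOp (R := R) X Z
    have h2 := contrOp_lieOp (R := R) Y Z
    have h3 := contrOp_lieOp (R := R) ⁅X, Y⁆ Z
    have h4 := contrOp_lieOp (R := R) X ⁅Y, Z⁆
    have h5 := contrOp_lieOp (R := R) Y ⁅X, Z⁆
    have h6 : contrOp (R := R) ⁅⁅X, Y⁆, Z⁆ = contrOp ⁅X, ⁅Y, Z⁆⁆ - contrOp ⁅Y, ⁅X, Z⁆⁆ := by
      rw [← contrOp_sub, lie_lie]
    linear_combination (norm := noncomm_ring) h1 * lieOp Y + lieOp X * h2 - h2 * lieOp X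
      - lieOp Y * h1 - h3 + h4 - h5 + h6

theorem lieOp_mulOp (X : A) (f : R) :
    lieOp X * mulOp f = mulOp f * lieOp X + mulOp ⁅X, f⁆ := by
  refine Op.ext_apply fun θ n v => ?_
  change lieOp X (mulOp f θ) n v = f * lieOp X θ n v + ⁅X, f⁆ * θ n v
  simp only [lieOp_apply, mulOp_apply, AlternatingMap.smul_apply, smul_eq_mul,
    LieRinehartRing.leibniz_mul_right, ← Finset.mul_sum]
  ring

/-- Contracting the difference with Z leaves [£_X, £_Z] - £_[X,Z], which is zero; in degree 0 both
sides vanish because d has no component there. -/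
theorem lieOp_dOp (X : A) : lieOp (R := R) X * dOp = dOp * lieOp X := by
  refine op_ext_of_anticomm (fun θ => ?_) fun Z => ?_
  · ext v
    change lieOp X (dOp θ) 0 v = 0
    rw [lieOp_zero_apply]
    exact lie_zero X
  · have h1 := contrOp_lieOp (R := R) X Z
    have h2 := contrOp_dOp (R := R) Z
    have h3 := contrOp_dOp (R := R) ⁅X, Z⁆
    have h4 := lieOp_lieOp (R := R) X Z
    linear_combination (norm := noncomm_ring) h1 * dOp + lieOp X * h2 - h2 * lieOp X + dOp * h1
      - h3 + h4

/-- The commutator of i_Z with d² is £_Z d - d £_Z = 0, so d² is determined by its component of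
degree 0, which is trivially zero. -/
theorem dOp_dOp : dOp (R := R) (A := A) * dOp = 0 := by
  refine op_ext_of_comm (fun θ => rfl) fun Z => ?_
  have h2 := contrOp_dOp (R := R) Z
  have h4 := lieOp_dOp (R := R) Z
  linear_combination (norm := noncomm_ring) h2 * dOp - dOp * h2 + h4

theorem wedgeOne_apply (φ : Module.Dual R A) {n : ℕ} (η : Form R A n) (v : Fin (n + 1) → A) :
    wedgeOne φ n η v = ∑ i : Fin (n + 1), (-1 : ℤ) ^ (i : ℕ) • (φ (v i) * η (i.removeNth v)) := by
  change AlternatingMap.alternatizeUncurryFin (φ.smulRight η) v = _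
  rw [AlternatingMap.alternatizeUncurryFin_apply]
  rfl

theorem contrOp_wedgeOp (X : A) (φ : Module.Dual R A) :
    contrOp X * wedgeOp φ = mulOp (φ X) - wedgeOp φ * contrOp X := by
  refine Op.ext_apply fun θ n v => ?_
  change wedgeOne φ n (θ n) (Fin.cons X v : Fin (n + 1) → A) =
    φ X * θ n v - wedgeOp φ (contrOp X θ) n v
  have h0 : (0 : Fin (n + 1)).removeNth (Fin.cons X v : Fin (n + 1) → A) = v := by simp
  rw [wedgeOne_apply, Fin.sum_univ_succ, h0]
  cases n with
  | zero => simp [wedgeOp_zero]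
  | succ n =>
    change _ = _ - wedgeOne φ n (contractOne n X (θ (n + 1))) v
    rw [wedgeOne_apply, sub_eq_add_neg, ← Finset.sum_neg_distrib]
    congr 1
    · simp
    · refine Finset.sum_congr rfl fun i _ => ?_
      rw [removeNth_succ_cons, Fin.cons_succ, Fin.val_succ, pow_succ, mul_neg, mul_one, neg_smul]
      rfl

theorem wedgeOp_wedgeOp (φ ψ : Module.Dual R A) :
    wedgeOp φ * wedgeOp ψ = -(wedgeOp ψ * wedgeOp φ) := by
  refine op_ext_of_comm (fun θ => ?_) fun Z => ?_
  · change (0 : Form R A 0) = -0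
    rw [neg_zero]
  have h1 := contrOp_wedgeOp Z φ
  have h2 := contrOp_wedgeOp Z ψ
  have h3 := wedgeOp_mulOp φ (ψ Z)
  have h4 := wedgeOp_mulOp ψ (φ Z)
  linear_combination (norm := noncomm_ring) h1 * wedgeOp ψ - wedgeOp φ * h2 + h2 * wedgeOp φ
    - wedgeOp ψ * h1 - h3 - h4

theorem real_smul_eq_zero_of_two {P : Op R A} (h : P + P = 0) : P = 0 := by
  have : (2 : ℝ) • P = 0 := by rw [two_smul, h]
  exact (smul_eq_zero_iff_right (by norm_num)).1 this

theorem wedgeOp_self (φ : Module.Dual R A) : wedgeOp φ * wedgeOp φ = 0 :=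
  real_smul_eq_zero_of_two (eq_neg_iff_add_eq_zero.1 (wedgeOp_wedgeOp φ φ))

/-- The differential of a function, as a one-form. -/
def diffForm (f : R) : Module.Dual R A where
  toFun X := ⁅X, f⁆
  map_add' X Y := add_lie X Y f
  map_smul' g X := by
    rw [LieRinehartRing.lie_smul_eq_mul, RingHom.id_apply, smul_eq_mul]

theorem diffForm_apply (f : R) (X : A) : diffForm f X = ⁅X, f⁆ := rfl

theorem dOp_mulOp (f : R) :
    dOp (A := A) * mulOp f = mulOp f * dOp + wedgeOp (diffForm f) := by
  refine op_ext_of_anticomm (fun θ => ?_) fun Z => ?_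
  · change (0 : Form R A 0) = f • (0 : Form R A 0) + 0
    rw [smul_zero, add_zero]
  have h1 := contrOp_dOp (R := R) Z
  have h2 := contrOp_mulOp Z f
  have h3 := lieOp_mulOp Z f
  have h4 := contrOp_wedgeOp Z (diffForm f)
  rw [diffForm_apply] at h4
  linear_combination (norm := noncomm_ring) h1 * mulOp f - dOp * h2 - h2 * dOp - mulOp f * h1 + h3
    - h4

/-- The Lie derivative of a one-form. -/
def lieForm (X : A) (φ : Module.Dual R A) : Module.Dual R A where
  toFun Y := ⁅X, φ Y⁆ - φ ⁅X, Y⁆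
  map_add' Y Z := by simp only [map_add, lie_add]; abel
  map_smul' f Y := by
    simp only [map_smul, map_add, LieRinehartRing.leibniz_smul_right, smul_eq_mul,
      LieRinehartRing.leibniz_mul_right, RingHom.id_apply]
    ring

theorem lieForm_apply (X : A) (φ : Module.Dual R A) (Y : A) :
    lieForm X φ Y = ⁅X, φ Y⁆ - φ ⁅X, Y⁆ := rfl

theorem lieOp_wedgeOp (X : A) (φ : Module.Dual R A) :
    lieOp X * wedgeOp φ = wedgeOp φ * lieOp X + wedgeOp (lieForm X φ) := by
  refine op_ext_of_anticomm (fun θ => ?_) fun Z => ?_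
  · ext v
    change lieOp X (wedgeOp φ θ) 0 v = 0 + 0
    rw [lieOp_zero_apply, add_zero]
    exact lie_zero X
  have h1 := contrOp_lieOp (R := R) X Z
  have h2 := contrOp_wedgeOp Z φ
  have h3 := contrOp_wedgeOp Z (lieForm X φ)
  have h4 := lieOp_mulOp X (φ Z)
  have h5 := contrOp_wedgeOp ⁅X, Z⁆ φ
  rw [lieForm_apply, mulOp_sub] at h3
  linear_combination (norm := noncomm_ring) h1 * wedgeOp φ + lieOp X * h2 - h2 * lieOp X
    + wedgeOp φ * h1 - h3 + h4 - h5

/-- The one-form `α` satisfies `dα = -φ ∧ α`. -/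
def IsTwistedClosed (φ α : Module.Dual R A) : Prop :=
  ∀ X Y, ⁅X, α Y⁆ - ⁅Y, α X⁆ - α ⁅X, Y⁆ = φ Y * α X - φ X * α Y

theorem IsTwistedClosed.dOp_wedgeOp {φ α : Module.Dual R A} (h : IsTwistedClosed φ α) :
    dOp * wedgeOp α = -(wedgeOp α * dOp) - wedgeOp φ * wedgeOp α := by
  refine op_ext_of_comm (fun θ => ?_) fun Z => ?_
  · change (0 : Form R A 0) = -0 - 0
    rw [neg_zero, sub_zero]
  have h1 := contrOp_dOp (R := R) Z
  have h2 := contrOp_wedgeOp Z α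
  have h3 := contrOp_wedgeOp Z φ
  have h4 := lieOp_wedgeOp Z α
  have h5 := dOp_mulOp (A := A) (α Z)
  -- £_Z α = d(α(Z)) + i_Z dα, with i_Z dα = -i_Z(φ ∧ α) = -φ(Z) α + α(Z) φ.
  have h6 : lieForm Z α = diffForm (α Z) - φ Z • α + α Z • φ := by
    ext Y
    simp only [lieForm_apply, LinearMap.add_apply, LinearMap.sub_apply, LinearMap.smul_apply,
      diffForm_apply, smul_eq_mul]
    linear_combination h Z Y
  rw [h6, wedgeOp_add, wedgeOp_sub, wedgeOp_smul, wedgeOp_smul] at h4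
  have h7 := wedgeOp_mulOp φ (α Z)
  linear_combination (norm := noncomm_ring) h1 * wedgeOp α - dOp * h2 + h2 * dOp - wedgeOp α * h1
    + h3 * wedgeOp α - wedgeOp φ * h2 + h4 - h5 - h7

/-- The one-form `φ` is closed. -/
def IsClosedForm (φ : Module.Dual R A) : Prop :=
  ∀ X Y, ⁅X, φ Y⁆ - ⁅Y, φ X⁆ - φ ⁅X, Y⁆ = 0

/-- Since φ ∧ φ = 0, a closed φ satisfies dφ = -φ ∧ φ and the twisted case applies to α = φ. -/
theorem IsClosedForm.dOp_wedgeOp {φ : Module.Dual R A} (h : IsClosedForm φ) :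
    dOp * wedgeOp φ = -(wedgeOp φ * dOp) := by
  have : IsTwistedClosed φ φ := fun X Y => by rw [h X Y]; ring
  rw [this.dOp_wedgeOp, wedgeOp_self, sub_zero]

end Cartan

/-! ### Contraction with a bisection -/

section Bisection

variable {R A : Type*} [CommRing R] [Algebra ℝ R] [LieRing A] [LieAlgebra ℝ A] [Module R A]
  [LieRingModule A R] [LieRinehartRing R A] [LieRinehartAlgebra ℝ R A]

theorem bisection_induction {p : ⋀[R]^2 A → Prop} (J : ⋀[R]^2 A)
    (mul : ∀ X Y, p (exteriorPower.ιMulti R 2 ![X, Y])) (zero : p 0)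
    (add : ∀ J K, p J → p K → p (J + K)) (smul : ∀ (f : R) J, p J → p (f • J)) : p J := by
  have : J ∈ Submodule.span R (Set.range (exteriorPower.ιMulti R 2 (M := A))) := by
    rw [exteriorPower.ιMulti_span]; trivial
  induction this using Submodule.span_induction with
  | mem x hx =>
    obtain ⟨v, rfl⟩ := hx
    have : v = ![v 0, v 1] := by ext i; fin_cases i <;> rfl
    rw [this]; exact mul _ _
  | zero => exact zero
  | add x y _ _ hx hy => exact add _ _ hx hy
  | smul f x _ hx => exact smul f x hx

theorem contrTwoOp_contrOp (J : ⋀[R]^2 A) (X : A) :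
    contrTwoOp J * contrOp X = contrOp X * contrTwoOp J := by
  induction J using bisection_induction with
  | mul Y Z =>
    rw [contrTwoOp_ιMulti]
    linear_combination (norm := noncomm_ring) contrOp Z * contrOp_anticomm (R := R) Y X
      - contrOp_anticomm (R := R) Z X * contrOp Y
  | zero => rw [contrTwoOp_zero, zero_mul, mul_zero]
  | add J K hJ hK => rw [contrTwoOp_add, add_mul, mul_add, hJ, hK]
  | smul f J hJ => rw [contrTwoOp_smul, mul_assoc, hJ, ← mul_assoc, ← contrOp_mulOp, mul_assoc]

theorem contrTwoOp_comm (J K : ⋀[R]^2 A) :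
    contrTwoOp J * contrTwoOp K = contrTwoOp K * contrTwoOp J := by
  induction J using bisection_induction with
  | mul Y Z =>
    rw [contrTwoOp_ιMulti, mul_assoc, ← contrTwoOp_contrOp, ← mul_assoc, ← contrTwoOp_contrOp,
      mul_assoc]
  | zero => rw [contrTwoOp_zero, zero_mul, mul_zero]
  | add J K hJ hK => rw [contrTwoOp_add, add_mul, mul_add, hJ, hK]
  | smul f J hJ => rw [contrTwoOp_smul, mul_assoc, hJ, ← mul_assoc, ← contrTwoOp_mulOp, mul_assoc]

/-- The commutator [£_X, i_J] stands for the contraction with the bisection £_X J, and contractions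
with bisections commute. Replacing J by f J adds only X(f) i_J, which commutes with i_K as well, so
the claim passes from products Y ∧ Z to all J. -/
theorem lieOp_contrTwoOp_comm (X : A) (J K : ⋀[R]^2 A) :
    (lieOp X * contrTwoOp J - contrTwoOp J * lieOp X) * contrTwoOp K =
      contrTwoOp K * (lieOp X * contrTwoOp J - contrTwoOp J * lieOp X) := by
  induction J using bisection_induction with
  | mul Y Z =>
    -- The right side is the contraction with [X, Y] ∧ Z + Y ∧ [X, Z].
    have : lieOp X * contrTwoOp (exteriorPower.ιMulti R 2 ![Y, Z]) -
        contrTwoOp (exteriorPower.ιMulti R 2 ![Y, Z]) * lieOp X =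
        contrOp Z * contrOp ⁅X, Y⁆ + contrOp ⁅X, Z⁆ * contrOp Y := by
      rw [contrTwoOp_ιMulti]
      linear_combination (norm := noncomm_ring) -contrOp_lieOp (R := R) X Z * contrOp Y
        - contrOp Z * contrOp_lieOp (R := R) X Y
    rw [this, add_mul, mul_add]
    simp only [mul_assoc, ← contrTwoOp_contrOp]
    simp only [← mul_assoc, ← contrTwoOp_contrOp]
  | zero => rw [contrTwoOp_zero]; noncomm_ring
  | add J K hJ hK =>
    rw [contrTwoOp_add]
    linear_combination (norm := noncomm_ring) hJ + hK
  | smul f J hJ =>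
    rw [contrTwoOp_smul]
    have h1 := lieOp_mulOp X f
    have h2 := contrTwoOp_mulOp K f
    have h3 := contrTwoOp_mulOp K ⁅X, f⁆
    have h4 := contrTwoOp_comm J K
    linear_combination (norm := noncomm_ring) mulOp f * hJ
      + h1 * contrTwoOp J * contrTwoOp K - contrTwoOp K * h1 * contrTwoOp J
      - h2 * (lieOp X * contrTwoOp J - contrTwoOp J * lieOp X) - h3 * contrTwoOp J
      + mulOp ⁅X, f⁆ * h4

theorem contractForm_ιMulti (φ : Module.Dual R A) (X Y : A) :
    contractForm φ (exteriorPower.ιMulti R 2 ![X, Y]) = φ X • Y - φ Y • X := by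
  rw [contractForm, liftTwo_ιMulti, LinearMap.mk₂_apply]

/-- This commutator is what produces the term i_{i_φ J} of the Jacobi-Lie differential when d is
replaced by d + s φ∧. -/
theorem contrTwoOp_wedgeOp (J : ⋀[R]^2 A) (φ : Module.Dual R A) :
    contrTwoOp J * wedgeOp φ = wedgeOp φ * contrTwoOp J + contrOp (contractForm φ J) := by
  induction J using bisection_induction with
  | mul X Y =>
    rw [contrTwoOp_ιMulti, contractForm_ιMulti, contrOp_sub, contrOp_smul, contrOp_smul]
    linear_combination (norm := noncomm_ring) contrOp Y * contrOp_wedgeOp X φ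
      - contrOp_wedgeOp Y φ * contrOp X + contrOp_mulOp Y (φ X)
  | zero => rw [contrTwoOp_zero, map_zero, contrOp_zero]; noncomm_ring
  | add J K hJ hK =>
    rw [contrTwoOp_add, map_add, contrOp_add]
    linear_combination (norm := noncomm_ring) hJ + hK
  | smul f J hJ =>
    rw [contrTwoOp_smul, map_smul, contrOp_smul]
    linear_combination (norm := noncomm_ring) mulOp f * hJ - wedgeOp_mulOp φ f * contrTwoOp J

end Bisection
end AVGeometry

namespace AVGeometry

/-! ### The square of the Jacobi-Lie differential -/

section Schouten

variable {R A : Type*} [CommRing R] [Algebra ℝ R] [LieRing A] [LieAlgebra ℝ A] [Module R A]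
  [LieRingModule A R] [LieRinehartRing R A] [LieRinehartAlgebra ℝ R A]

/-- The twisted differential `d + s φ ∧ ·`. -/
noncomputable def twistedOp (φ : Module.Dual R A) (s : ℝ) : Op R A := dOp + s • wedgeOp φ

/-- The contraction with the trivector `[J, J]_φ`, up to a factor. -/
noncomputable def schoutenOp (φ : Module.Dual R A) (J : ⋀[R]^2 A) : Op R A :=
  2 • (contrTwoOp J * dOp * contrTwoOp J) - dOp * contrTwoOp J * contrTwoOp J
    - contrTwoOp J * contrTwoOp J * dOp - 2 • (contrOp (contractForm φ J) * contrTwoOp J)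

theorem twistedOp_twistedOp {φ : Module.Dual R A} (hφ : IsClosedForm φ) (s : ℝ) :
    twistedOp φ s * twistedOp φ s = 0 := by
  simp only [twistedOp, mul_add, add_mul, smul_mul_assoc, mul_smul_comm, hφ.dOp_wedgeOp, dOp_dOp,
    wedgeOp_self, smul_neg, smul_zero, add_zero, zero_add]
  abel

/-- Because dα = -φ ∧ α, moving α∧ through the twisted differential uses up one unit of the weight
s. -/
theorem IsTwistedClosed.twistedOp_wedgeOp {φ α : Module.Dual R A} (h : IsTwistedClosed φ α)
    (s : ℝ) : twistedOp φ (s + 1) * wedgeOp α = -(wedgeOp α * twistedOp φ s) := by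
  simp only [twistedOp, mul_add, add_mul, smul_mul_assoc, mul_smul_comm, h.dOp_wedgeOp,
    wedgeOp_wedgeOp α φ]
  module

/-- Moving φ∧ to the left of i_J, the coefficient of φ ∧ i_J i_J is 2(s-1) - (s-2) - s = 0, and that
of the contraction with i_φ J after i_J is 2(s-1) - 2s = -2. The weight s is therefore free, and it
is chosen later to fit the degree of the form. -/
theorem schoutenOp_eq (φ : Module.Dual R A) (J : ⋀[R]^2 A) (s : ℝ) :
    schoutenOp φ J = 2 • (contrTwoOp J * twistedOp φ (s - 1) * contrTwoOp J)
      - twistedOp φ (s - 2) * contrTwoOp J * contrTwoOp J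
      - contrTwoOp J * contrTwoOp J * twistedOp φ s := by
  have h1 : contrTwoOp J * wedgeOp φ * contrTwoOp J =
      wedgeOp φ * contrTwoOp J * contrTwoOp J + contrOp (contractForm φ J) * contrTwoOp J := by
    rw [contrTwoOp_wedgeOp, add_mul]
  have h2 : contrTwoOp J * contrTwoOp J * wedgeOp φ =
      wedgeOp φ * contrTwoOp J * contrTwoOp J +
        2 • (contrOp (contractForm φ J) * contrTwoOp J) := by
    have h := contrTwoOp_wedgeOp J φ
    have h' := contrTwoOp_contrOp J (contractForm φ J)
    linear_combination (norm := noncomm_ring) contrTwoOp J * h + h * contrTwoOp J + h'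
  simp only [schoutenOp, twistedOp, mul_add, add_mul, smul_mul_assoc, mul_smul_comm, h1, h2]
  module

/-- Since i_X d + d i_X = £_X, the anticommutator with i_X reduces to minus the double commutator
[[£_X, j], j], which is zero by `lieOp_contrTwoOp_comm`; the last term of `schoutenOp` anticommutes
with i_X by itself. -/
theorem contrOp_schoutenOp (φ : Module.Dual R A) (J : ⋀[R]^2 A) (X : A) :
    contrOp X * schoutenOp φ J = -(schoutenOp φ J * contrOp X) := by
  have hd := contrOp_dOp (R := R) X
  have hc := contrTwoOp_contrOp J X
  have hL := lieOp_contrTwoOp_comm X J J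
  have hV := contrOp_anticomm (R := R) X (contractForm φ J)
  rw [schoutenOp]
  set j := contrTwoOp J
  set V := contrOp (R := R) (contractForm φ J)
  linear_combination (norm := noncomm_ring) 2 * (-hc * dOp * j + j * hd * j + j * dOp * hc)
    - hd * j * j - dOp * j * hc - dOp * hc * j + hc * j * dOp + j * hc * dOp - j * j * hd - hL
    - 2 * hV * j - 2 * V * hc

/-- The operator is tensorial: its commutator with f is minus the double commutator [[df∧, j], j],
and the inner commutator is, up to sign, the contraction with a section, which commutes with j. -/
theorem schoutenOp_mulOp (φ : Module.Dual R A) (J : ⋀[R]^2 A) (f : R) :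
    schoutenOp φ J * mulOp f = mulOp f * schoutenOp φ J := by
  have hd := dOp_mulOp (A := A) f
  have hj := contrTwoOp_mulOp J f
  have he := contrTwoOp_wedgeOp J (diffForm f)
  have hv := contrTwoOp_contrOp J (contractForm (diffForm f) J)
  have hV := contrOp_mulOp (contractForm φ J) f
  rw [schoutenOp]
  set j := contrTwoOp J
  set V := contrOp (R := R) (contractForm φ J)
  linear_combination (norm := noncomm_ring) 2 * (j * dOp * hj + j * hd * j + hj * dOp * j + he * j)
    - (dOp * j * hj + dOp * hj * j + hd * j * j)
    - (j * j * hd + j * hj * dOp + hj * j * dOp + j * he + he * j + hv)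
    - 2 * (V * hj + hV * j)

/-- The Jacobi-Lie differential on families of forms. -/
noncomputable def jacobiLieOp (φ : Module.Dual R A) (t : ℝ) (J : ⋀[R]^2 A) : Op R A :=
  contrTwoOp J * dOp - dOp * contrTwoOp J + contrOp (contractForm φ J) * (degOp + t • 1)
    + wedgeOp φ * contrTwoOp J

theorem jacobiLieOp_apply (φ : Module.Dual R A) (t : ℝ) (J : ⋀[R]^2 A) (θ : Total R A) (k : ℕ) :
    jacobiLieOp φ t J θ k = jacobiLieDiff φ t J k (θ (k + 1)) := by
  have h : ∀ (c : ℝ) (η : Form R A (k + 1)), contractOne k (contractForm φ J) (c • η + t • η) =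
      (c + t) • contractOne k (contractForm φ J) η := fun c η => by
    rw [← add_smul]; rfl
  cases k with
  | zero =>
    -- `degOp` acts before the contraction, so the degree that enters is that of the argument, one
    -- more than that of the value.
    change contractTwo 0 J (extDeriv 1 (θ 1)) - 0
      + contractOne 0 (contractForm φ J) (((0 + 1 : ℕ) : ℝ) • θ 1 + t • θ 1) + 0 =
      contractTwo 0 J (extDeriv 1 (θ 1)) + (1 + t) • contractOne 0 (contractForm φ J) (θ 1)
    rw [h, sub_zero, add_zero]
    norm_num
  | succ k =>
    change contractTwo (k + 1) J (extDeriv (k + 2) (θ (k + 2)))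
      - extDeriv k (contractTwo k J (θ (k + 2)))
      + contractOne (k + 1) (contractForm φ J) (((k + 1 + 1 : ℕ) : ℝ) • θ (k + 2) + t • θ (k + 2))
      + wedgeOne φ k (contractTwo k J (θ (k + 2))) =
      contractTwo (k + 1) J (extDeriv (k + 2) (θ (k + 2)))
      - extDeriv k (contractTwo k J (θ (k + 2)))
      + ((k + 2 : ℝ) + t) • contractOne (k + 1) (contractForm φ J) (θ (k + 2))
      + wedgeOne φ k (contractTwo k J (θ (k + 2)))
    rw [h]
    push_cast
    norm_num [add_assoc]

theorem projOp_jacobiLieOp (φ : Module.Dual R A) (t : ℝ) (J : ⋀[R]^2 A) (k : ℕ) :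
    projOp k * jacobiLieOp φ t J = jacobiLieOp φ t J * projOp (k + 1) := by
  refine Op.ext fun θ n => ?_
  rw [Op.mul_apply, Op.mul_apply, jacobiLieOp_apply, projOp_apply, projOp_apply,
    jacobiLieOp_apply]
  by_cases h : n = k <;> simp [h]

theorem degOp_projOp (k : ℕ) : degOp * projOp k = (k : ℝ) • projOp (R := R) (A := A) k := by
  refine Op.ext fun θ n => ?_
  change (n : ℝ) • projOp k θ n = (k : ℝ) • projOp k θ n
  rw [projOp_apply]
  by_cases h : n = k <;> simp [h]

/-- On n-forms the Jacobi-Lie differential is a commutator of j with twisted differentials of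
weights n + t and n + t - 1: the difference of the weights leaves exactly one φ∧ j, and
`contrTwoOp_wedgeOp` turns (n + t)[j, φ∧] into the contraction term. -/
theorem jacobiLieOp_projOp (φ : Module.Dual R A) (t : ℝ) (J : ⋀[R]^2 A) (n : ℕ) :
    jacobiLieOp φ t J * projOp n =
      (contrTwoOp J * twistedOp φ (n + t) - twistedOp φ (n + t - 1) * contrTwoOp J) * projOp n := by
  have h1 : contrTwoOp J * wedgeOp φ * projOp n =
      wedgeOp φ * contrTwoOp J * projOp n + contrOp (contractForm φ J) * projOp n := by
    rw [contrTwoOp_wedgeOp, add_mul]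
  simp only [jacobiLieOp, twistedOp, mul_add, add_mul, sub_mul, smul_mul_assoc, mul_smul_comm,
    h1, mul_assoc _ degOp, degOp_projOp, mul_one]
  module

/-- With D0, D1, D2 the twisted differentials of successive weights, both sides equal twice j D1 j
D0 + D2 j D1 j - D2 j j D0; the other terms contain D0², D1² or D2². -/
theorem jacobiLieOp_sq {φ : Module.Dual R A} (hφ : IsClosedForm φ) (t : ℝ) (J : ⋀[R]^2 A) (k : ℕ) :
    2 • (jacobiLieOp φ t J * jacobiLieOp φ t J * projOp (k + 2)) =
      (schoutenOp φ J * twistedOp φ (k + 2 + t)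
        + twistedOp φ (k + t) * schoutenOp φ J) * projOp (k + 2) := by
  have h1 := jacobiLieOp_projOp φ t J (k + 2)
  have h2 := jacobiLieOp_projOp φ t J (k + 1)
  have h3 := projOp_jacobiLieOp φ t J (k + 1)
  have h4 := schoutenOp_eq φ J (k + 2 + t)
  have e1 : ((k + 2 : ℕ) : ℝ) + t = k + 2 + t := by push_cast; ring
  have e2 : ((k + 1 : ℕ) : ℝ) + t = k + 2 + t - 1 := by push_cast; ring
  have e3 : (k : ℝ) + 2 + t - 1 - 1 = k + 2 + t - 2 := by ring
  have e4 : (k : ℝ) + t = k + 2 + t - 2 := by ring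
  rw [e1] at h1
  rw [e2, e3] at h2
  rw [e4]
  have s0 := twistedOp_twistedOp hφ (k + 2 + t)
  have s1 := twistedOp_twistedOp hφ (k + 2 + t - 1)
  have s2 := twistedOp_twistedOp hφ (k + 2 + t - 2)
  set L := jacobiLieOp φ t J
  set K := schoutenOp φ J
  set j := contrTwoOp J
  set D0 := twistedOp φ (k + 2 + t)
  set D1 := twistedOp φ (k + 2 + t - 1)
  set D2 := twistedOp φ (k + 2 + t - 2)
  set p := projOp (R := R) (A := A) (k + 2)
  set q := projOp (R := R) (A := A) (k + 1)
  -- The first factor meets forms of degree `k + 2`, the second forms of degree `k + 1`, so all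
  -- weights drop by one between them.
  have h5 : L * L * p = (j * D1 - D2 * j) * (j * D0 - D1 * j) * p := by
    linear_combination (norm := noncomm_ring) -L * h3 + h2 * L + (j * D1 - D2 * j) * h3
      + (j * D1 - D2 * j) * h1
  rw [h5]
  linear_combination (norm := noncomm_ring) -h4 * D0 * p - D2 * h4 * p - 2 * j * s1 * j * p
    + j * j * s0 * p + s2 * j * j * p

end Schouten

/-! ### The Jacobiator as the value of `schoutenOp` on products of twisted closed one-forms -/

section Jacobiator

variable {R A : Type*} [CommRing R] [Algebra ℝ R] [LieRing A] [LieAlgebra ℝ A] [Module R A]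
  [LieRingModule A R] [LieRinehartRing R A] [LieRinehartAlgebra ℝ R A]

/-- The pairing `J(α, β)`. -/
noncomputable def pair (J : ⋀[R]^2 A) (α β : Module.Dual R A) : R := β (contractForm α J)

/-- The twisted differential of a function, `df + f φ`. -/
def twistedDiff (φ : Module.Dual R A) (f : R) : Module.Dual R A := diffForm f + f • φ

theorem pair_ιMulti (X Y : A) (α β : Module.Dual R A) :
    pair (exteriorPower.ιMulti R 2 ![X, Y]) α β = α X * β Y - α Y * β X := by
  rw [pair, contractForm_ιMulti]; simp

theorem pair_bisection_add (J K : ⋀[R]^2 A) (α β : Module.Dual R A) :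
    pair (J + K) α β = pair J α β + pair K α β := by
  simp only [pair, map_add]

theorem pair_bisection_smul (f : R) (J : ⋀[R]^2 A) (α β : Module.Dual R A) :
    pair (f • J) α β = f * pair J α β := by
  simp only [pair, map_smul, smul_eq_mul]

theorem pair_bisection_zero (α β : Module.Dual R A) : pair (0 : ⋀[R]^2 A) α β = 0 := by
  simp only [pair, map_zero]

theorem pair_skew (J : ⋀[R]^2 A) (α β : Module.Dual R A) : pair J α β = -pair J β α := by
  induction J using bisection_induction with
  | mul X Y => rw [pair_ιMulti, pair_ιMulti]; ring
  | zero => rw [pair_bisection_zero, pair_bisection_zero, neg_zero]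
  | add J K hJ hK => rw [pair_bisection_add, pair_bisection_add, hJ, hK]; ring
  | smul f J hJ => rw [pair_bisection_smul, pair_bisection_smul, hJ]; ring

theorem pair_add_right (J : ⋀[R]^2 A) (α β γ : Module.Dual R A) :
    pair J α (β + γ) = pair J α β + pair J α γ := rfl

theorem pair_add_left (J : ⋀[R]^2 A) (α β γ : Module.Dual R A) :
    pair J (α + β) γ = pair J α γ + pair J β γ := by
  rw [pair_skew, pair_add_right, pair_skew J α, pair_skew J β]; ring

theorem pair_self (J : ⋀[R]^2 A) (α : Module.Dual R A) : pair J α α = 0 := by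
  induction J using bisection_induction with
  | mul X Y => rw [pair_ιMulti]; ring
  | zero => rw [pair_bisection_zero]
  | add J K hJ hK => rw [pair_bisection_add, hJ, hK, add_zero]
  | smul f J hJ => rw [pair_bisection_smul, hJ, mul_zero]

theorem twistedDiff_add (φ : Module.Dual R A) (f g : R) :
    twistedDiff φ (f + g) = twistedDiff φ f + twistedDiff φ g := by
  ext X
  simp only [twistedDiff, LinearMap.add_apply, LinearMap.smul_apply, diffForm_apply, lie_add,
    smul_eq_mul]
  ring

theorem twistedDiff_neg (φ : Module.Dual R A) (f : R) :
    twistedDiff φ (-f) = -twistedDiff φ f := by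
  ext X
  simp only [twistedDiff, LinearMap.add_apply, LinearMap.smul_apply, diffForm_apply, lie_neg,
    smul_eq_mul, LinearMap.neg_apply]
  ring

/-- The Jacobiator of the bracket of a bisection on one-forms. -/
noncomputable def jacobiator (φ : Module.Dual R A) (J : ⋀[R]^2 A) (α β γ : Module.Dual R A) : R :=
  pair J α (twistedDiff φ (pair J β γ)) + pair J β (twistedDiff φ (pair J γ α))
    + pair J γ (twistedDiff φ (pair J α β))

theorem jacobiator_add_right (φ : Module.Dual R A) (J : ⋀[R]^2 A) (α β γ γ' : Module.Dual R A) :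
    jacobiator φ J α β (γ + γ') = jacobiator φ J α β γ + jacobiator φ J α β γ' := by
  simp only [jacobiator, pair_add_left, pair_add_right, twistedDiff_add]
  ring

/-- One of the three terms contains J(α, α) = 0, and the other two cancel by skewness. With
`jacobiator_add_right` this lets the third argument be changed by a multiple of the first in the
converse direction. -/
theorem jacobiator_self (φ : Module.Dual R A) (J : ⋀[R]^2 A) (α β : Module.Dual R A) :
    jacobiator φ J α β α = 0 := by
  have h0 : twistedDiff φ (0 : R) = 0 := by
    ext X; simp [twistedDiff, diffForm_apply]
  have h : ∀ ψ : Module.Dual R A, pair J α (-ψ) = -pair J α ψ := fun ψ => rfl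
  have h' : pair J β 0 = 0 := rfl
  rw [jacobiator, pair_self, h0, pair_skew J β α, twistedDiff_neg, h, h']
  ring

theorem contrOp_oneTotal (X : A) : contrOp X (oneTotal : Total R A) = 0 := by
  funext n; ext v; rfl

theorem contrTwoOp_oneTotal (J : ⋀[R]^2 A) : contrTwoOp J (oneTotal : Total R A) = 0 := by
  funext n
  rw [contrTwoOp_apply]
  exact map_zero _

theorem dOp_oneTotal : dOp (oneTotal : Total R A) = 0 := by
  have h : ∀ X : A, ⁅X, (1 : R)⁆ = 0 := fun X => by
    have := LieRinehartRing.leibniz_mul_right X (1 : R) 1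
    simpa using this
  funext n
  cases n with
  | zero => rfl
  | succ n =>
    rw [dOp_succ]
    cases n with
    | zero =>
      ext v
      rw [extDeriv_apply]
      simp [oneTotal, h]
    | succ n => exact map_zero _

theorem contrOp_wedgeOp_oneTotal (X : A) (α : Module.Dual R A) :
    contrOp X (wedgeOp α oneTotal) = mulOp (α X) oneTotal := by
  have := DFunLike.congr_fun (contrOp_wedgeOp X α) oneTotal
  rwa [Op.sub_apply, Op.mul_apply, Op.mul_apply, contrOp_oneTotal, map_zero, sub_zero] at this

theorem contrTwoOp_wedgeOp_apply (J : ⋀[R]^2 A) (α : Module.Dual R A) (θ : Total R A) :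
    contrTwoOp J (wedgeOp α θ) = wedgeOp α (contrTwoOp J θ) + contrOp (contractForm α J) θ :=
  DFunLike.congr_fun (contrTwoOp_wedgeOp J α) θ

theorem contrTwoOp_wedgeOp_oneTotal (J : ⋀[R]^2 A) (α : Module.Dual R A) :
    contrTwoOp J (wedgeOp α oneTotal) = 0 := by
  rw [contrTwoOp_wedgeOp_apply, contrTwoOp_oneTotal, contrOp_oneTotal, map_zero, add_zero]

theorem contrTwoOp_wedgeOp_two (J : ⋀[R]^2 A) (α β : Module.Dual R A) :
    contrTwoOp J (wedgeOp α (wedgeOp β oneTotal)) = mulOp (pair J α β) oneTotal := by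
  rw [contrTwoOp_wedgeOp_apply, contrTwoOp_wedgeOp_oneTotal, contrOp_wedgeOp_oneTotal, map_zero,
    zero_add, pair]

theorem wedgeOp_mulOp_apply (α : Module.Dual R A) (f : R) (θ : Total R A) :
    wedgeOp α (mulOp f θ) = mulOp f (wedgeOp α θ) :=
  DFunLike.congr_fun (wedgeOp_mulOp α f) θ

theorem contrTwoOp_mulOp_apply (J : ⋀[R]^2 A) (f : R) (θ : Total R A) :
    contrTwoOp J (mulOp f θ) = mulOp f (contrTwoOp J θ) :=
  DFunLike.congr_fun (contrTwoOp_mulOp J f) θ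

theorem contrTwoOp_wedgeOp_three (J : ⋀[R]^2 A) (α β γ : Module.Dual R A) :
    contrTwoOp J (wedgeOp α (wedgeOp β (wedgeOp γ oneTotal))) =
      mulOp (pair J β γ) (wedgeOp α oneTotal) + mulOp (pair J γ α) (wedgeOp β oneTotal)
        + mulOp (pair J α β) (wedgeOp γ oneTotal) := by
  have h := DFunLike.congr_fun (contrOp_wedgeOp (contractForm α J) β) (wedgeOp γ oneTotal)
  rw [Op.sub_apply, Op.mul_apply, Op.mul_apply, contrOp_wedgeOp_oneTotal] at h
  rw [contrTwoOp_wedgeOp_apply, contrTwoOp_wedgeOp_two, h, wedgeOp_mulOp_apply,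
    wedgeOp_mulOp_apply, pair_skew J γ α, mulOp_neg, Op.neg_apply]
  change _ + (mulOp (pair J α β) _ - mulOp (pair J α γ) _) = _
  abel

theorem twistedOp_mulOp_oneTotal (φ : Module.Dual R A) (f : R) :
    twistedOp φ 1 (mulOp f oneTotal) = wedgeOp (twistedDiff φ f) oneTotal := by
  have h := DFunLike.congr_fun (dOp_mulOp (A := A) f) oneTotal
  rw [Op.mul_apply, Op.add_apply, Op.mul_apply, dOp_oneTotal, map_zero, zero_add] at h
  rw [twistedOp, one_smul, Op.add_apply, h, wedgeOp_mulOp_apply, twistedDiff, wedgeOp_add,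
    wedgeOp_smul]
  rfl

theorem twistedOp_wedgeOp_apply {φ α : Module.Dual R A} (h : IsTwistedClosed φ α) (s s' : ℝ)
    (hs : s = s' + 1) (θ : Total R A) :
    twistedOp φ s (wedgeOp α θ) = -wedgeOp α (twistedOp φ s' θ) := by
  rw [hs]; exact DFunLike.congr_fun (h.twistedOp_wedgeOp s') θ

theorem twistedOp_mulOp_wedgeOp {φ α : Module.Dual R A} (h : IsTwistedClosed φ α) (f : R) :
    twistedOp φ 2 (mulOp f (wedgeOp α oneTotal)) =
      wedgeOp (twistedDiff φ f) (wedgeOp α oneTotal) := by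
  rw [← wedgeOp_mulOp_apply, twistedOp_wedgeOp_apply h 2 1 (by norm_num),
    twistedOp_mulOp_oneTotal]
  have := DFunLike.congr_fun (wedgeOp_wedgeOp α (twistedDiff φ f)) oneTotal
  exact neg_eq_iff_eq_neg.2 this

theorem schoutenOp_apply (φ : Module.Dual R A) (J : ⋀[R]^2 A) (s : ℝ) (θ : Total R A) :
    schoutenOp φ J θ = 2 • contrTwoOp J (twistedOp φ (s - 1) (contrTwoOp J θ))
      - twistedOp φ (s - 2) (contrTwoOp J (contrTwoOp J θ))
      - contrTwoOp J (contrTwoOp J (twistedOp φ s θ)) :=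
  DFunLike.congr_fun (schoutenOp_eq φ J s) θ

/-- At weight 3 the product α ∧ β ∧ γ is annihilated by the twisted differential, and j² kills it
for reasons of degree, so only 2 j D_2 j survives. It differentiates the coefficients J(β, γ), J(γ,
α), J(α, β), each with weight 1, which gives the three terms of the Jacobiator. -/
theorem schoutenOp_wedgeOp_three {φ α β γ : Module.Dual R A} (hα : IsTwistedClosed φ α)
    (hβ : IsTwistedClosed φ β) (hγ : IsTwistedClosed φ γ) (J : ⋀[R]^2 A) :
    schoutenOp φ J (wedgeOp α (wedgeOp β (wedgeOp γ oneTotal))) =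
      -(2 • mulOp (jacobiator φ J α β γ) oneTotal) := by
  -- Each of the three factors lowers the weight by one, so the constant 1 is met by d itself.
  have h0 : twistedOp φ 3 (wedgeOp α (wedgeOp β (wedgeOp γ oneTotal))) = 0 := by
    rw [twistedOp_wedgeOp_apply hα 3 2 (by norm_num), twistedOp_wedgeOp_apply hβ 2 1 (by norm_num),
      twistedOp_wedgeOp_apply hγ 1 0 (by norm_num), twistedOp, zero_smul, add_zero, dOp_oneTotal]
    simp only [map_zero, neg_zero]
  rw [schoutenOp_apply φ J 3, h0, contrTwoOp_wedgeOp_three]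
  norm_num only
  simp only [map_add, map_zero, contrTwoOp_mulOp_apply, contrTwoOp_wedgeOp_oneTotal, add_zero,
    sub_zero, twistedOp_mulOp_wedgeOp hα, twistedOp_mulOp_wedgeOp hβ, twistedOp_mulOp_wedgeOp hγ,
    contrTwoOp_wedgeOp_two]
  rw [jacobiator, pair_skew J α (twistedDiff φ _), pair_skew J β (twistedDiff φ _),
    pair_skew J γ (twistedDiff φ _)]
  simp only [mulOp_add, mulOp_neg, Op.add_apply, Op.neg_apply]
  abel

theorem schoutenOp_wedgeOp_two {φ α β : Module.Dual R A} (hα : IsTwistedClosed φ α)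
    (hβ : IsTwistedClosed φ β) (J : ⋀[R]^2 A) :
    schoutenOp φ J (wedgeOp α (wedgeOp β oneTotal)) = 0 := by
  have h0 : twistedOp φ 2 (wedgeOp α (wedgeOp β oneTotal)) = 0 := by
    rw [twistedOp_wedgeOp_apply hα 2 1 (by norm_num), twistedOp_wedgeOp_apply hβ 1 0 (by norm_num),
      twistedOp, zero_smul, add_zero, dOp_oneTotal]
    simp only [map_zero, neg_zero]
  rw [schoutenOp_apply φ J 2, h0, contrTwoOp_wedgeOp_two]
  norm_num only
  rw [twistedOp_mulOp_oneTotal]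
  simp only [contrTwoOp_mulOp_apply, contrTwoOp_wedgeOp_oneTotal, contrTwoOp_oneTotal, map_zero,
    sub_zero, smul_zero]

end Jacobiator
end AVGeometry

namespace AVGeometry

/-! ### From the Jacobiator to the homology operator and back -/

section Homology

variable {R A : Type*} [CommRing R] [Algebra ℝ R] [LieRing A] [LieAlgebra ℝ A] [Module R A]
  [LieRingModule A R] [LieRinehartRing R A] [LieRinehartAlgebra ℝ R A]

theorem projOp_single (k : ℕ) (η : Form R A k) : projOp k (Pi.single k η : Total R A) = Pi.single k η := by
  funext n
  rw [projOp_apply]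
  by_cases h : n = k
  · simp [h]
  · simp [h]

theorem projOp_zero_eq (θ : Total R A) :
    projOp 0 θ = mulOp (θ 0 ![]) oneTotal := by
  funext n
  rw [projOp_apply, mulOp_apply, oneTotal]
  cases n with
  | zero =>
    ext v
    have : v = ![] := Subsingleton.elim _ _
    simp [this]
  | succ n => simp

theorem projOp_contrOp (k : ℕ) (X : A) :
    contrOp (R := R) X * projOp (k + 1) = projOp k * contrOp X := by
  refine Op.ext_apply fun θ n v => ?_
  change projOp (k + 1) θ (n + 1) (Fin.cons X v : Fin (n + 1) → A) = projOp k (contrOp X θ) n v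
  rw [projOp_apply, projOp_apply]
  by_cases h : n = k
  · simp [h, contrOp_apply]
  · simp [h]

theorem projOp_wedgeOp (k : ℕ) (α : Module.Dual R A) :
    projOp (k + 1) * wedgeOp α = wedgeOp α * projOp k := by
  refine Op.ext fun θ n => ?_
  rw [Op.mul_apply, Op.mul_apply, projOp_apply]
  cases n with
  | zero => simp [wedgeOp_zero]
  | succ n =>
    rw [wedgeOp_succ, wedgeOp_succ, projOp_apply]
    by_cases h : n = k <;> simp [h]

theorem projOp_two_wedgeOp (α β : Module.Dual R A) (f : R) :
    projOp 2 (wedgeOp α (wedgeOp β (mulOp f oneTotal))) =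
      wedgeOp α (wedgeOp β (mulOp f oneTotal)) := by
  have h1 := DFunLike.congr_fun (projOp_wedgeOp 1 α) (wedgeOp β (mulOp f oneTotal))
  have h2 := DFunLike.congr_fun (projOp_wedgeOp 0 β) (mulOp f oneTotal)
  have h3 : projOp 0 (mulOp f (oneTotal : Total R A)) = mulOp f oneTotal := by
    rw [projOp_zero_eq]
    simp [mulOp_apply, oneTotal]
  rw [Op.mul_apply, Op.mul_apply] at h1 h2
  rw [h1, h2, h3]

/-- Only degrees from 2 on matter, since the square lowers the degree by two; a form of degree `k +
2` is tested as a family concentrated in that degree. -/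
theorem isHomologyOperator_iff_sq (φ : Module.Dual R A) (t : ℝ) (J : ⋀[R]^2 A) :
    IsHomologyOperator (jacobiLieDiff φ t J) ↔
      ∀ k, jacobiLieOp φ t J * jacobiLieOp φ t J * projOp (k + 2) = 0 := by
  constructor
  · intro h k
    refine Op.ext fun θ n => ?_
    rw [Op.mul_apply, Op.mul_apply, jacobiLieOp_apply, jacobiLieOp_apply]
    exact LinearMap.congr_fun (h n) _
  · intro h k
    ext1 η
    have h1 := congrFun (DFunLike.congr_fun (h k) (Pi.single (k + 2) η)) k
    rw [Op.mul_apply, Op.mul_apply, projOp_single, jacobiLieOp_apply, jacobiLieOp_apply,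
      Pi.single_eq_same] at h1
    exact h1

/-- The identity of `jacobiLieOp_sq` is applied to the two-form α ∧ β f. The operator K kills it, so
K vanishes on its twisted differential α ∧ β ∧ (df + fφ), where K is the Jacobiator up to the factor
-2. -/
theorem jacobiator_twistedDiff_eq_zero {φ : Module.Dual R A} (hφ : IsClosedForm φ)
    {J : ⋀[R]^2 A} (h : IsHomologyOperator (jacobiLieDiff φ 1 J)) {α β : Module.Dual R A}
    (hα : IsTwistedClosed φ α) (hβ : IsTwistedClosed φ β) (f : R)
    (hf : IsTwistedClosed φ (twistedDiff φ f)) :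
    jacobiator φ J α β (twistedDiff φ f) = 0 := by
  -- For t = 1 and k = 0 the weight is 3; the factors α and β lower it to 1, which is the weight at
  -- which f has the differential df + fφ.
  have h1 := jacobiLieOp_sq hφ 1 J 0
  rw [(isHomologyOperator_iff_sq φ 1 J).1 h 0, smul_zero] at h1
  have h2 := DFunLike.congr_fun h1 (wedgeOp α (wedgeOp β (mulOp f oneTotal)))
  have e : ((0 : ℕ) : ℝ) + 2 + 1 = 3 := by norm_num
  have hK : schoutenOp φ J (wedgeOp α (wedgeOp β (mulOp f oneTotal))) = 0 := by
    have := DFunLike.congr_fun (schoutenOp_mulOp φ J f) (wedgeOp α (wedgeOp β oneTotal))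
    rw [Op.mul_apply, Op.mul_apply, schoutenOp_wedgeOp_two hα hβ, map_zero] at this
    rw [wedgeOp_mulOp_apply, wedgeOp_mulOp_apply, this]
  rw [e, Op.mul_apply, projOp_two_wedgeOp, Op.add_apply, Op.mul_apply, Op.mul_apply, hK, map_zero,
    add_zero, twistedOp_wedgeOp_apply hα 3 2 (by norm_num),
    twistedOp_wedgeOp_apply hβ 2 1 (by norm_num), twistedOp_mulOp_oneTotal, map_neg, map_neg, map_neg,
    neg_neg,
    schoutenOp_wedgeOp_three hα hβ hf, Op.zero_apply, zero_eq_neg] at h2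
  have h3 := DFunLike.congr_fun (congrFun h2 0) ![]
  change 2 • (jacobiator φ J α β (twistedDiff φ f) * 1) = 0 at h3
  rw [mul_one] at h3
  have h4 : (2 : ℝ) • jacobiator φ J α β (twistedDiff φ f) = 0 := by
    rw [← h3, two_smul, two_nsmul]
  exact (smul_eq_zero_iff_right (by norm_num)).1 h4

/-- The multiples by `χ` of all sections are spanned by finitely many sections, with coefficients in
the span of `S`. -/
def HasFrame (S : Set (Module.Dual R A)) (χ : R) : Prop :=
  ∃ (n : ℕ) (X : Fin n → A) (c : Fin n → Module.Dual R A),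
    (∀ i, c i ∈ Submodule.span R S) ∧ ∀ Y, χ • Y = ∑ i, c i Y • X i

/-- Euler's identity for forms, localized by χ. The commutator of either side with i_Y is the
contraction with χY, and both vanish on functions. -/
theorem sum_wedgeOp_contrOp {n : ℕ} {X : Fin n → A} {c : Fin n → Module.Dual R A} {χ : R}
    (h : ∀ Y, χ • Y = ∑ i, c i Y • X i) :
    ∑ i, wedgeOp (c i) * contrOp (X i) = mulOp χ * degOp := by
  refine op_ext_of_comm (fun θ => ?_) fun Y => ?_
  · change (∑ i, wedgeOp (c i) * contrOp (X i) : Op R A) θ 0 = χ • ((0 : ℕ) : ℝ) • θ 0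
    have : ∀ s : Finset (Fin n), (∑ i ∈ s, wedgeOp (c i) * contrOp (X i) : Op R A) θ 0 = 0 := fun s => by
      induction s using Finset.cons_induction with
      | empty => rfl
      | cons a s ha ih =>
        rw [Finset.sum_cons, Op.add_apply, Pi.add_apply, ih, add_zero]; rfl
    rw [this]; simp
  · have h1 : contrOp Y * degOp (R := R) = degOp * contrOp Y + contrOp Y := by
      refine Op.ext_apply fun θ n v => ?_
      change ((n + 1 : ℕ) : ℝ) • θ (n + 1) _ = (n : ℝ) • θ (n + 1) _ + θ (n + 1) _
      push_cast
      rw [add_smul, one_smul]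
    have h2 : ∀ i, contrOp Y * (wedgeOp (c i) * contrOp (X i)) =
        mulOp (c i Y) * contrOp (X i) + wedgeOp (c i) * contrOp (X i) * contrOp Y := fun i => by
      linear_combination (norm := noncomm_ring) contrOp_wedgeOp Y (c i) * contrOp (X i)
        - wedgeOp (c i) * contrOp_anticomm (R := R) Y (X i)
    have h3 : mulOp χ * contrOp Y = ∑ i, mulOp (c i Y) * contrOp (X i) := by
      rw [← contrOp_smul, h Y]
      have : ∀ s : Finset (Fin n), contrOp (R := R) (∑ i ∈ s, c i Y • X i) =
          ∑ i ∈ s, mulOp (c i Y) * contrOp (X i) := fun s => by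
        induction s using Finset.cons_induction with
        | empty => simp [contrOp_zero]
        | cons a s ha ih => rw [Finset.sum_cons, Finset.sum_cons, contrOp_add, contrOp_smul, ih]
      exact this _
    rw [mul_sub, sub_mul, Finset.mul_sum, Finset.sum_congr rfl fun i _ => h2 i,
      Finset.sum_add_distrib, ← h3, ← Finset.sum_mul]
    linear_combination (norm := noncomm_ring) -contrOp_mulOp Y χ * degOp - mulOp χ * h1

/-- Linearity over functions in each slot reduces the claim to generators, where the value is a
Jacobiator. The final `projOp 0` restricts to functions, which can be moved out. -/
theorem schoutenOp_wedgeOp_span {φ : Module.Dual R A} {J : ⋀[R]^2 A} {S : Set (Module.Dual R A)}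
    (hS : ∀ α ∈ S, IsTwistedClosed φ α)
    (hJ : ∀ α ∈ S, ∀ β ∈ S, ∀ γ ∈ S, jacobiator φ J α β γ = 0) {α β γ : Module.Dual R A}
    (hα : α ∈ Submodule.span R S) (hβ : β ∈ Submodule.span R S) (hγ : γ ∈ Submodule.span R S) :
    schoutenOp φ J * wedgeOp α * wedgeOp β * wedgeOp γ * projOp 0 = 0 := by
  have hK := schoutenOp_mulOp φ J
  induction hα using Submodule.span_induction with
  | zero => rw [wedgeOp_zero']; noncomm_ring
  | add x y _ _ hx hy =>
    rw [wedgeOp_add]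
    linear_combination (norm := noncomm_ring) hx + hy
  | smul f x _ hx =>
    rw [wedgeOp_smul]
    linear_combination (norm := noncomm_ring) mulOp f * hx +
      hK f * wedgeOp x * wedgeOp β * wedgeOp γ * projOp 0
  | mem α hα =>
    induction hβ using Submodule.span_induction with
    | zero => rw [wedgeOp_zero']; noncomm_ring
    | add x y _ _ hx hy =>
      rw [wedgeOp_add]
      linear_combination (norm := noncomm_ring) hx + hy
    | smul f x _ hx =>
      rw [wedgeOp_smul]
      linear_combination (norm := noncomm_ring) mulOp f * hx +
        (hK f * wedgeOp α + schoutenOp φ J * wedgeOp_mulOp α f) * wedgeOp x * wedgeOp γ * projOp 0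
    | mem β hβ =>
      induction hγ using Submodule.span_induction with
      | zero => rw [wedgeOp_zero']; noncomm_ring
      | add x y _ _ hx hy =>
        rw [wedgeOp_add]
        linear_combination (norm := noncomm_ring) hx + hy
      | smul f x _ hx =>
        rw [wedgeOp_smul]
        linear_combination (norm := noncomm_ring) mulOp f * hx +
          (hK f * wedgeOp α * wedgeOp β + schoutenOp φ J * wedgeOp_mulOp α f * wedgeOp β +
            schoutenOp φ J * wedgeOp α * wedgeOp_mulOp β f) * wedgeOp x * projOp 0
      | mem γ hγ =>
        refine Op.ext fun θ n => ?_
        have h := DFunLike.congr_fun (hK (θ 0 ![]))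
          (wedgeOp α (wedgeOp β (wedgeOp γ oneTotal)))
        rw [Op.mul_apply, Op.mul_apply, schoutenOp_wedgeOp_three (hS α hα) (hS β hβ) (hS γ hγ),
          hJ α hα β hβ γ hγ, mulOp_zero, Op.zero_apply, smul_zero, neg_zero, map_zero] at h
        simp only [Op.mul_apply]
        rw [projOp_zero_eq, wedgeOp_mulOp_apply, wedgeOp_mulOp_apply, wedgeOp_mulOp_apply, h]
        rfl

/-- Euler's identity is used three times to write a three-form, times χ³, through products c_i ∧ c_j
∧ c_k with function coefficients. The degrees 1, 2 and 3 that appear give the factor 6, which is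
invertible. -/
theorem mulOp_schoutenOp_projOp {φ : Module.Dual R A} {J : ⋀[R]^2 A} {S : Set (Module.Dual R A)}
    (hS : ∀ α ∈ S, IsTwistedClosed φ α)
    (hJ : ∀ α ∈ S, ∀ β ∈ S, ∀ γ ∈ S, jacobiator φ J α β γ = 0) {χ : R} (hχ : HasFrame S χ) :
    mulOp (χ * (χ * χ)) * schoutenOp φ J * projOp 3 = 0 := by
  obtain ⟨n, X, c, hc, h⟩ := hχ
  have hs := sum_wedgeOp_contrOp h
  have hp : ∀ (k : ℕ), ∑ i, wedgeOp (c i) * contrOp (X i) * projOp k = (k : ℝ) • (mulOp χ * projOp k) :=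
    fun k => by
      rw [← Finset.sum_mul, hs, mul_assoc, degOp_projOp, mul_smul_comm]
  have h0 : ∑ i, ∑ j, ∑ k, schoutenOp φ J * wedgeOp (c i) * wedgeOp (c j) * wedgeOp (c k) *
      projOp 0 * contrOp (X k) * contrOp (X j) * contrOp (X i) = 0 :=
    Finset.sum_eq_zero fun i _ => Finset.sum_eq_zero fun j _ => Finset.sum_eq_zero fun k _ => by
      rw [schoutenOp_wedgeOp_span hS hJ (hc i) (hc j) (hc k)]; noncomm_ring
  -- The innermost sum acts on one-forms, the next on two-forms and the last on three-forms, so they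
  -- yield χ times 1, 2 and 3.
  have h1 : ∀ i j, ∑ k, schoutenOp φ J * wedgeOp (c i) * wedgeOp (c j) * wedgeOp (c k) *
      projOp 0 * contrOp (X k) * contrOp (X j) * contrOp (X i) =
      mulOp χ * schoutenOp φ J * wedgeOp (c i) *
        (wedgeOp (c j) * contrOp (X j) * projOp 2) * contrOp (X i) := fun i j => by
    have e : ∀ k, schoutenOp φ J * wedgeOp (c i) * wedgeOp (c j) * wedgeOp (c k) *
      projOp 0 * contrOp (X k) * contrOp (X j) * contrOp (X i) =
      schoutenOp φ J * wedgeOp (c i) * wedgeOp (c j) * (wedgeOp (c k) * contrOp (X k) * projOp 1) *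
        contrOp (X j) * contrOp (X i) := fun k => by
      rw [mul_assoc (wedgeOp (c k)), projOp_contrOp]; noncomm_ring
    rw [Finset.sum_congr rfl fun k _ => e k, ← Finset.sum_mul, ← Finset.sum_mul, ← Finset.mul_sum,
      hp 1, Nat.cast_one, one_smul, mul_assoc (wedgeOp (c j)) (contrOp (X j)), projOp_contrOp]
    linear_combination (norm := noncomm_ring)
      (schoutenOp_mulOp φ J χ * wedgeOp (c i) * wedgeOp (c j) +
        schoutenOp φ J * wedgeOp_mulOp (c i) χ * wedgeOp (c j) +
        schoutenOp φ J * wedgeOp (c i) * wedgeOp_mulOp (c j) χ) *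
        projOp 1 * contrOp (X j) * contrOp (X i)
  have h2 : ∀ i, ∑ j, mulOp χ * schoutenOp φ J * wedgeOp (c i) *
        (wedgeOp (c j) * contrOp (X j) * projOp 2) * contrOp (X i) =
      (2 : ℝ) • (mulOp χ * mulOp χ * schoutenOp φ J *
        (wedgeOp (c i) * contrOp (X i) * projOp 3)) := fun i => by
    rw [← Finset.sum_mul, ← Finset.mul_sum, hp 2, Nat.cast_ofNat, mul_smul_comm, smul_mul_assoc,
      mul_assoc (wedgeOp (c i)) (contrOp (X i)), projOp_contrOp]
    congr 1
    linear_combination (norm := noncomm_ring)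
      mulOp χ * (schoutenOp_mulOp φ J χ * wedgeOp (c i) +
        schoutenOp φ J * wedgeOp_mulOp (c i) χ) * projOp 2 * contrOp (X i)
  simp only [h1, h2] at h0
  rw [← Finset.smul_sum, ← Finset.mul_sum, hp 3, mul_smul_comm, smul_smul] at h0
  have h3 := (smul_eq_zero_iff_right (by norm_num)).1 h0
  rw [mulOp_mul, mulOp_mul]
  linear_combination (norm := noncomm_ring) h3 -
    mulOp χ * mulOp χ * schoutenOp_mulOp φ J χ * projOp 3

/-- The operator has degree -3, so its component of degree 0 sees only the component of degree 3. -/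
theorem projOp_schoutenOp_apply (φ : Module.Dual R A) (J : ⋀[R]^2 A) (θ : Total R A) :
    schoutenOp φ J θ 0 = schoutenOp φ J (projOp 3 θ) 0 := by
  have h : ∀ ψ : Total R A, schoutenOp φ J ψ 0 = 2 • contractTwo 0 J (extDeriv 1 (contractTwo 1 J (ψ 3)))
      - 0 - contractTwo 0 J (contractTwo 2 J (extDeriv 3 (ψ 3))) -
        2 • contractOne 0 (contractForm φ J) (contractTwo 1 J (ψ 3)) := fun ψ => rfl
  rw [h, h, projOp_apply, if_pos rfl]

/-- By anticommutation with contractions, K = 0 as soon as it vanishes on three-forms. There its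
values are functions annihilated by χ³ for every χ with a frame, and `hframe` says that such
functions are zero. -/
theorem isHomologyOperator_of_jacobiator {φ : Module.Dual R A} (hφ : IsClosedForm φ)
    {J : ⋀[R]^2 A} {S : Set (Module.Dual R A)} (hS : ∀ α ∈ S, IsTwistedClosed φ α)
    (hJ : ∀ α ∈ S, ∀ β ∈ S, ∀ γ ∈ S, jacobiator φ J α β γ = 0)
    (hframe : ∀ f : R, (∀ χ, HasFrame S χ → χ * (χ * χ) * f = 0) → f = 0) (t : ℝ) :
    IsHomologyOperator (jacobiLieDiff φ t J) := by
  have hK : schoutenOp φ J = 0 := by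
    refine op_ext_of_anticomm (fun θ => ?_) fun X => ?_
    · rw [projOp_schoutenOp_apply]
      ext v
      refine hframe _ fun χ hχ => ?_
      exact DFunLike.congr_fun (congrFun (DFunLike.congr_fun
        (mulOp_schoutenOp_projOp hS hJ hχ) θ) 0) v
    · rw [sub_zero, contrOp_schoutenOp]
  rw [isHomologyOperator_iff_sq]
  intro k
  have h := jacobiLieOp_sq hφ t J k
  rw [hK, zero_mul, mul_zero, add_zero, zero_mul, two_nsmul] at h
  exact real_smul_eq_zero_of_two h

theorem jacobiLieDiff_zero (t : ℝ) (J : ⋀[R]^2 A) :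
    jacobiLieDiff (0 : Module.Dual R A) t J = lieDiff J := by
  have h : contractForm (0 : Module.Dual R A) J = 0 := by
    induction J using bisection_induction with
    | mul X Y => rw [contractForm_ιMulti]; simp
    | zero => exact map_zero _
    | add J K hJ hK => rw [map_add, hJ, hK, add_zero]
    | smul f J hJ => rw [map_smul, hJ, smul_zero]
  funext k
  ext η v
  have h1 : ∀ (k : ℕ) (η : Form R A (k + 1)), contractOne k (0 : A) η = 0 := fun k η => by
    ext v
    exact η.map_coord_zero 0 rfl
  cases k with
  | zero =>
    change (lieDiff J 0 η + (1 + t) • contractOne 0 (contractForm 0 J) η) v = lieDiff J 0 η v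
    rw [h, h1, smul_zero, add_zero]
  | succ k =>
    have h2 : wedgeOne (0 : Module.Dual R A) k (contractTwo k J η) = 0 := by
      ext v; simp [wedgeOne_apply]
    change (lieDiff J (k + 1) η + ((k + 2 : ℝ) + t) • contractOne (k + 1) (contractForm 0 J) η +
      wedgeOne 0 k (contractTwo k J η)) v = lieDiff J (k + 1) η v
    rw [h, h1, h2, smul_zero, add_zero, add_zero]

end Homology
end AVGeometry

namespace AVGeometry

/-! ### Hadamard's lemma -/

section Hadamard

variable {V : Type*} [NormedAddCommGroup V] [NormedSpace ℝ V]

/-- The integral is the convolution, evaluated at 0, of the indicator of (0, 1] with a compactly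
supported function depending smoothly on x, so smoothness of convolutions with parameters applies.
-/
theorem contDiff_parametric_integral {g : V → ℝ → ℝ}
    (hg : ContDiff ℝ ∞ fun p : V × ℝ => g p.1 p.2) :
    ContDiff ℝ ∞ fun x => ∫ τ in (0 : ℝ)..1, g x τ := by
  -- The bump is 1 on [-1, 1], which contains all -τ for τ in (0, 1], so the cut-off does not alter
  -- the integral; the sign in `g'` undoes the reflection in the convolution.
  let β : ContDiffBump (0 : ℝ) := ⟨1, 2, by norm_num, by norm_num⟩
  let g' : V → ℝ → ℝ := fun x y => β y * g x (-y)
  let f : ℝ → ℝ := (Set.Ioc (0 : ℝ) 1).indicator 1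
  have hf : MeasureTheory.LocallyIntegrable f MeasureTheory.volume := by
    refine MeasureTheory.Integrable.locallyIntegrable ?_
    rw [MeasureTheory.integrable_indicator_iff measurableSet_Ioc]
    exact MeasureTheory.integrableOn_const (by simp)
  have hg' : ContDiffOn ℝ ∞ (Function.uncurry g') (Set.univ ×ˢ Set.univ) := by
    refine ContDiff.contDiffOn ?_
    exact (β.contDiff.comp contDiff_snd).mul (hg.comp (contDiff_fst.prodMk contDiff_snd.neg))
  have h := MeasureTheory.contDiffOn_convolution_right_with_param_comp (n := ⊤)
    (μ := MeasureTheory.volume)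
    (ContinuousLinearMap.mul ℝ ℝ) (v := fun _ : V => (0 : ℝ)) contDiffOn_const isOpen_univ
    (isCompact_closedBall (0 : ℝ) 2)
    (g := g') (fun p x _ hx => by
      have : β x = 0 := by
        refine β.zero_of_le_dist ?_
        rw [Metric.mem_closedBall, not_le] at hx
        exact hx.le
      simp [g', this]) hf hg'
  rw [contDiffOn_univ] at h
  convert h using 2 with x
  rw [MeasureTheory.convolution, intervalIntegral.integral_of_le zero_le_one,
    ← MeasureTheory.integral_indicator measurableSet_Ioc]
  refine MeasureTheory.integral_congr_ae (Filter.Eventually.of_forall fun t => ?_)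
  by_cases ht : t ∈ Set.Ioc (0 : ℝ) 1
  · have : β (0 - t) = 1 := by
      refine β.one_of_mem_closedBall ?_
      rw [Metric.mem_closedBall, Real.dist_eq]
      have : |0 - t - 0| = t := by rw [sub_zero, zero_sub, abs_neg, abs_of_pos ht.1]
      rw [this]; exact ht.2
    simp only [f, g', ContinuousLinearMap.mul_apply', this]
    simp [ht]
  · simp [f, ht]

/-- F(x) - F(x₀) is the integral of the derivative along the segment from x₀ to x; expanding x - x₀
in the basis gives the functions G_i. -/
theorem hadamard [FiniteDimensional ℝ V] {ι : Type*} [Fintype ι] (b : Module.Basis ι ℝ V)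
    {F : V → ℝ} (hF : ContDiff ℝ ∞ F) (x₀ : V) :
    ∃ G : ι → V → ℝ, (∀ i, ContDiff ℝ ∞ (G i)) ∧ (∀ i, G i x₀ = fderiv ℝ F x₀ (b i)) ∧
      ∀ x, F x = F x₀ + ∑ i, b.repr (x - x₀) i * G i x := by
  have hd : ContDiff ℝ ∞ (fderiv ℝ F) := hF.fderiv_right (by simp)
  have hl : ContDiff ℝ ∞ fun p : V × ℝ => x₀ + p.2 • (p.1 - x₀) :=
    contDiff_const.add (contDiff_snd.smul (contDiff_fst.sub contDiff_const))
  have hg : ∀ v : V, ContDiff ℝ ∞ fun p : V × ℝ => fderiv ℝ F (x₀ + p.2 • (p.1 - x₀)) v :=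
    fun v => (hd.comp hl).clm_apply contDiff_const
  refine ⟨fun i x => ∫ τ in (0 : ℝ)..1, fderiv ℝ F (x₀ + τ • (x - x₀)) (b i),
    fun i => contDiff_parametric_integral (hg (b i)), fun i => by simp, fun x => ?_⟩
  have hc : ∀ (x v : V), Continuous fun τ : ℝ => fderiv ℝ F (x₀ + τ • (x - x₀)) v := fun x v =>
    (hg v).continuous.comp (continuous_const.prodMk continuous_id)
  have h1 : ∫ τ in (0 : ℝ)..1, fderiv ℝ F (x₀ + τ • (x - x₀)) (x - x₀) = F x - F x₀ := by
    have := intervalIntegral.integral_eq_sub_of_hasDerivAt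
      (f := fun τ : ℝ => F (x₀ + τ • (x - x₀)))
      (f' := fun τ => fderiv ℝ F (x₀ + τ • (x - x₀)) (x - x₀)) (a := 0) (b := 1)
      (fun τ _ => by
        have hF' := (hF.differentiable (by simp) (x₀ + τ • (x - x₀))).hasFDerivAt
        have hl' : HasDerivAt (fun τ : ℝ => x₀ + τ • (x - x₀)) (x - x₀) τ := by
          simpa using ((hasDerivAt_id τ).smul_const (x - x₀)).const_add x₀
        exact hF'.comp_hasDerivAt τ hl')
      ((hc x (x - x₀)).intervalIntegrable _ _)
    simpa using this
  have h2 : ∀ τ : ℝ, fderiv ℝ F (x₀ + τ • (x - x₀)) (x - x₀) =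
      ∑ i, b.repr (x - x₀) i * fderiv ℝ F (x₀ + τ • (x - x₀)) (b i) := fun τ => by
    have := congrArg (fderiv ℝ F (x₀ + τ • (x - x₀))) (b.sum_repr (x - x₀)).symm
    simpa only [map_sum, map_smul, smul_eq_mul] using this
  simp only [h2] at h1
  rw [intervalIntegral.integral_finsetSum fun i _ =>
    (((hc x (b i)).const_mul _).intervalIntegrable _ _)] at h1
  simp only [intervalIntegral.integral_const_mul] at h1
  rw [h1]; ring

end Hadamard

/-! ### Point derivations of smooth functions -/

section PointDerivation

variable {V N : Type*} [NormedAddCommGroup V] [NormedSpace ℝ V] [FiniteDimensional ℝ V]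
  [TopologicalSpace N] [ChartedSpace V N] [IsManifold 𝓘(ℝ, V) ∞ N] [T2Space N]

/-- The product of a bump function with a function that is smooth on the chart domain. -/
noncomputable def bumpMul {p : N} (ρ : SmoothBumpFunction 𝓘(ℝ, V) p) (g : N → ℝ)
    (hg : ContMDiffOn 𝓘(ℝ, V) 𝓘(ℝ, ℝ) ∞ g (chartAt V p).source) : SmoothFn V N :=
  ⟨fun x => ρ x • g x, ρ.contMDiff_smul hg⟩

theorem chart_comp_contMDiffOn (p : N) {g : V → ℝ} (hg : ContDiff ℝ ∞ g) :
    ContMDiffOn 𝓘(ℝ, V) 𝓘(ℝ, ℝ) ∞ (fun x => g (extChartAt 𝓘(ℝ, V) p x)) (chartAt V p).source :=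
  hg.contMDiff.comp_contMDiffOn contMDiffOn_extChartAt

/-- A derivation at `p` of the algebra of smooth functions. -/
structure IsPointDerivation (p : N) (D : SmoothFn V N →ₗ[ℝ] ℝ) : Prop where
  leibniz : ∀ f g, D (f * g) = f p * D g + g p * D f

namespace IsPointDerivation

variable {p : N} {D : SmoothFn V N →ₗ[ℝ] ℝ} (hD : IsPointDerivation p D)

include hD in
theorem map_one : D 1 = 0 := by
  have := hD.leibniz 1 1
  simpa using this

include hD in
-- Derivations are local: (f - g)ρ = 0 for a bump function ρ supported where f = g, and Leibniz at p
-- gives D(f - g) = 0.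
theorem map_congr {f g : SmoothFn V N} (h : f =ᶠ[nhds p] g) : D f = D g := by
  obtain ⟨ρ, -, hρ⟩ := (SmoothBumpFunction.nhds_basis_support (I := 𝓘(ℝ, V)) h).mem_iff.1 h
  let r : SmoothFn V N := ⟨ρ, ρ.contMDiff⟩
  have hr : r p = 1 := ρ.eq_one
  have h0 : (f - g) * r = 0 := by
    ext x
    by_cases hx : x ∈ Function.support ρ
    · have : f x = g x := hρ hx
      change (f x - g x) * ρ x = 0
      rw [this, sub_self, zero_mul]
    · change (f x - g x) * ρ x = 0
      rw [Function.notMem_support.1 hx, mul_zero]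
  have h1 := hD.leibniz (f - g) r
  have h2 : (f - g) p = 0 := sub_eq_zero.2 h.self_of_nhds
  rw [h0, h2, hr, map_zero, zero_mul, zero_add, one_mul, map_sub] at h1
  exact (sub_eq_zero.1 h1.symm)

include hD in
theorem map_mul_eq_zero {f g : SmoothFn V N} (hf : f p = 0) (hg : g p = 0) : D (f * g) = 0 := by
  rw [hD.leibniz, hf, hg, zero_mul, zero_mul, add_zero]

include hD in
/-- Point derivations vanish on functions with vanishing differential. -/
theorem eq_zero_of_mfderiv_eq_zero {f : SmoothFn V N}
    (hf : mfderiv 𝓘(ℝ, V) 𝓘(ℝ, ℝ) f p = 0) : D f = 0 := by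
  obtain ⟨ρ⟩ : Nonempty (SmoothBumpFunction 𝓘(ℝ, V) p) := inferInstance
  let e := extChartAt 𝓘(ℝ, V) p
  let β := ρ.toContDiffBump
  -- The function in the chart, cut off so as to be smooth on the whole model space, as Hadamard's
  -- lemma requires.
  let F : V → ℝ := fun x => β x * f (e.symm x)
  have hF : ContDiff ℝ ∞ F := by
    rw [contDiff_iff_contDiffAt]
    intro x
    by_cases hx : x ∈ e.target
    · have h1 : ContMDiffAt 𝓘(ℝ, V) 𝓘(ℝ, ℝ) ∞ (fun x => f (e.symm x)) x :=
        (f.contMDiff.comp_contMDiffOn (contMDiffOn_extChartAt_symm p)).contMDiffAt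
          ((isOpen_extChartAt_target p).mem_nhds hx)
      exact β.contDiffAt.mul h1.contDiffAt
    · have hx' : x ∉ Metric.closedBall (e p) ρ.rOut := fun h =>
        hx (ρ.closedBall_subset ⟨h, by simp⟩)
      have : F =ᶠ[nhds x] fun _ => 0 := by
        filter_upwards [Metric.isClosed_closedBall.isOpen_compl.mem_nhds hx'] with y hy
        have : β y = 0 := β.zero_of_le_dist (by
          have := Metric.mem_closedBall.not.1 hy
          exact (not_le.1 this).le)
        simp only [F, this, zero_mul]
      exact contDiffAt_const.congr_of_eventuallyEq this
  have hFf : F =ᶠ[nhds (e p)] fun x => f (e.symm x) := by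
    filter_upwards [β.eventuallyEq_one] with x hx
    simp only [F, hx, Pi.one_apply, one_mul]
  have hF0 : fderiv ℝ F (e p) = 0 := by
    rw [hFf.fderiv_eq]
    have hm : MDifferentiableAt 𝓘(ℝ, V) 𝓘(ℝ, ℝ) f p :=
      f.contMDiff.mdifferentiableAt (by simp)
    have h : fderivWithin ℝ (fun x => f (e.symm x)) (Set.range 𝓘(ℝ, V)) (e p) = 0 :=
      hm.mfderiv.symm.trans hf
    rwa [modelWithCornersSelf_coe, Set.range_id, fderivWithin_univ] at h
  let b := Module.finBasis ℝ V
  obtain ⟨G, hG, hG0, hGF⟩ := hadamard b hF (e p)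
  let y : Fin (Module.finrank ℝ V) → SmoothFn V N := fun i =>
    bumpMul ρ _ (chart_comp_contMDiffOn p
      (g := fun x => b.coord i (x - e p))
      ((LinearMap.toContinuousLinearMap (b.coord i)).contDiff.comp (contDiff_id.sub contDiff_const)))
  let g : Fin (Module.finrank ℝ V) → SmoothFn V N := fun i =>
    bumpMul ρ _ (chart_comp_contMDiffOn p (hG i))
  -- Near p, f is a constant plus a sum of products y_i g_i. Here y_i(p) = 0, and g_i(p) is a
  -- partial derivative of f at p, hence zero, so D kills every product.
  have hev : f =ᶠ[nhds p] (f p • (1 : SmoothFn V N) + ∑ i, y i * g i : SmoothFn V N) := by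
    have hs : e.source ∈ nhds p := extChartAt_source_mem_nhds p
    have hc : Filter.Tendsto e (nhds p) (nhds (e p)) := continuousAt_extChartAt p
    filter_upwards [ρ.eventuallyEq_one, hs, hc.eventually hFf] with x hx hxs hxF
    have hsum : ∀ s : Finset (Fin (Module.finrank ℝ V)), (∑ i ∈ s, y i * g i : SmoothFn V N) x =
        ∑ i ∈ s, y i x * g i x := fun s => by
      induction s using Finset.cons_induction with
      | empty => rfl
      | cons a s ha ih =>
        rw [Finset.sum_cons, Finset.sum_cons, SmoothFn.add_apply, ih, SmoothFn.mul_apply]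
    have h1 : F (e p) = f p := by
      rw [hFf.self_of_nhds]
      exact congrArg f (e.left_inv (mem_extChartAt_source p))
    have h2 : F (e x) = f x := by
      rw [hxF]
      exact congrArg f (e.left_inv hxs)
    rw [SmoothFn.add_apply, SmoothFn.smul_apply, SmoothFn.one_apply, hsum, mul_one, ← h2, hGF, h1]
    congr 1
    refine Finset.sum_congr rfl fun i _ => ?_
    have hx1 : ρ x = 1 := hx
    have : y i x * g i x = (ρ x * b.coord i (e x - e p)) * (ρ x * G i (e x)) := rfl
    rw [this, hx1, one_mul, one_mul, Module.Basis.coord_apply]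
  rw [hD.map_congr hev, map_add, map_smul, hD.map_one, smul_zero, zero_add, map_sum]
  refine Finset.sum_eq_zero fun i _ => hD.map_mul_eq_zero ?_ ?_
  · change ρ p * b.coord i (e p - e p) = 0
    rw [sub_self, map_zero, mul_zero]
  · change ρ p * G i (e p) = 0
    rw [hG0, hF0]; simp

end IsPointDerivation

end PointDerivation
end AVGeometry

noncomputable section

namespace AVGeometry

namespace AVBundle

/-! ### Existence of a global section -/

section GlobalSection

variable {E F M Z : Type*} [NormedAddCommGroup E] [NormedSpace ℝ E] [FiniteDimensional ℝ E]
  [NormedAddCommGroup F] [NormedSpace ℝ F]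
  [TopologicalSpace M] [ChartedSpace E M] [IsManifold 𝓘(ℝ, E) ∞ M] [T2Space M] [SigmaCompactSpace M]
  [TopologicalSpace Z] [ChartedSpace F Z] [AddAction ℝ Z]

/-- Averaging the fibre coordinates of local trivializations with a partition of unity keeps the
slope along the fibres equal to 1. -/
theorem exists_fibre_coordinate (P : AVBundle E F M Z) :
    ∃ H : SmoothFn F Z, ∀ (t : ℝ) (z : Z), H (t +ᵥ z) = H z + t := by
  choose U e hU hm hs ht he hes h1 h2 using P.exists_trivialization
  obtain ⟨ρ, hρ⟩ := SmoothPartitionOfUnity.exists_isSubordinate 𝓘(ℝ, E) isClosed_univ U hU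
    fun m _ => Set.mem_iUnion_of_mem m (hm m)
  have hU0 : ∀ m z, ρ m (P.proj z) ≠ 0 → z ∈ (e m).source := fun m z hz => by
    rw [hs]
    exact hρ m (subset_tsupport _ hz)
  have hfin : ∀ x, (Function.support fun m => ρ m x).Finite := fun x =>
    ρ.locallyFinite.point_finite x
  let g : M → Z → ℝ := fun m z => ρ m (P.proj z) * (e m z).2
  have hg : ∀ m, ContMDiff 𝓘(ℝ, F) 𝓘(ℝ, ℝ) ∞ (g m) := fun m => by
    refine contMDiff_of_tsupport fun z hz => ?_
    have hz' : P.proj z ∈ tsupport (ρ m) := by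
      have hsub : Function.support (g m) ⊆ P.proj ⁻¹' tsupport (ρ m) := fun y hy =>
        subset_tsupport _ (left_ne_zero_of_mul hy)
      exact closure_minimal hsub
        ((isClosed_tsupport _).preimage P.contMDiff_proj.continuous) hz
    have hzs : z ∈ (e m).source := by
      rw [hs]; exact hρ m hz'
    have he2 : ContMDiffAt 𝓘(ℝ, F) 𝓘(ℝ, ℝ) ∞ (fun z => (e m z).2) z :=
      (contMDiff_snd.comp_contMDiffOn (he m)).contMDiffAt ((e m).open_source.mem_nhds hzs)
    exact (((ρ m).contMDiff.comp P.contMDiff_proj) z).mul he2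
  have hlf : LocallyFinite fun m => Function.support (g m) := by
    refine (ρ.locallyFinite.preimage_continuous P.contMDiff_proj.continuous).subset
      fun m y hy => ?_
    exact left_ne_zero_of_mul hy
  refine ⟨⟨fun z => ∑ᶠ m, g m z, contMDiff_finsum hg hlf⟩, fun t z => ?_⟩
  change ∑ᶠ m, g m (t +ᵥ z) = ∑ᶠ m, g m z + t
  have h : ∀ m, g m (t +ᵥ z) = g m z + ρ m (P.proj z) * t := fun m => by
    simp only [g, P.proj_vadd]
    by_cases h0 : ρ m (P.proj z) = 0
    · rw [h0]; ring
    · rw [h2 m z (hU0 m z h0)]; ring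
  rw [finsum_congr h, finsum_add_distrib, ← finsum_mul' _ _ (hfin _),
    ρ.sum_eq_one (Set.mem_univ _), one_mul]
  · exact (hfin (P.proj z)).subset fun m hm => left_ne_zero_of_mul hm
  · exact (hfin (P.proj z)).subset fun m hm => left_ne_zero_of_mul hm

/-- The section is the zero set of the fibre coordinate H: the point z shifted by -H(z) depends only
on the fibre of z. -/
theorem nonempty_section (P : AVBundle E F M Z) : Nonempty P.Section := by
  obtain ⟨H, hH⟩ := P.exists_fibre_coordinate
  have hfib : ∀ z w, P.proj z = P.proj w → (-H z) +ᵥ z = (-H w) +ᵥ w := fun z w h => by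
    obtain ⟨t, rfl⟩ := exists_vadd_eq h
    rw [hH, vadd_vadd]
    congr 1; ring
  let s : M → Z := fun m => (-H (P.proj_surjective m).choose) +ᵥ (P.proj_surjective m).choose
  refine ⟨⟨s, fun m => ?_, fun m => ?_⟩⟩
  · obtain ⟨U, e, hU, hm, hs, ht, -, he, h1, h2⟩ := P.exists_trivialization m
    have hc : ContMDiffOn 𝓘(ℝ, E) 𝓘(ℝ, F) ∞ (fun m => e.symm (m, (0 : ℝ))) U := by
      refine he.comp (t := e.target)
        (contMDiffOn_id.prodMk contMDiffOn_const) fun m hm => ?_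
      rw [ht]; exact ⟨hm, trivial⟩
    have hc' : ContMDiffAt 𝓘(ℝ, E) 𝓘(ℝ, F) ∞ (fun m => e.symm (m, (0 : ℝ))) m :=
      hc.contMDiffAt (hU.mem_nhds hm)
    have hsm : ContMDiffAt 𝓘(ℝ, E) 𝓘(ℝ, F) ∞
        (fun m => (-H (e.symm (m, (0 : ℝ)))) +ᵥ e.symm (m, (0 : ℝ))) m :=
      ContMDiffAt.comp m (P.contMDiff_vadd _)
        (((H.contMDiff _).comp m hc').neg.prodMk hc')
    refine hsm.congr_of_eventuallyEq ?_
    filter_upwards [hU.mem_nhds hm] with m hm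
    refine hfib _ _ ?_
    have : ((m, 0) : M × ℝ) ∈ e.target := by rw [ht]; exact ⟨hm, trivial⟩
    rw [(P.proj_surjective m).choose_spec, ← h1 _ (e.map_target this), e.right_inv this]
  · change P.proj (_ +ᵥ _) = m
    rw [P.proj_vadd, (P.proj_surjective m).choose_spec]

end GlobalSection

end AVBundle

/-! ### Vector fields from families of curves -/

section Chain

theorem mfderiv_eq_zero_of_comp {V N V' N' H' : Type*} [NormedAddCommGroup V] [NormedSpace ℝ V]
    [TopologicalSpace N] [ChartedSpace V N] [NormedAddCommGroup V'] [NormedSpace ℝ V']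
    [TopologicalSpace H'] [TopologicalSpace N'] [ChartedSpace H' N'] {I' : ModelWithCorners ℝ V' H'}
    {f : N → ℝ} {Φ : N → N'} {W : N' → ℝ} {p : N}
    (hΦ : MDifferentiableAt 𝓘(ℝ, V) I' Φ p) (hW : MDifferentiableAt I' 𝓘(ℝ, ℝ) W (Φ p))
    (hW0 : mfderiv I' 𝓘(ℝ, ℝ) W (Φ p) = 0)
    (hf : f =ᶠ[nhds p] W ∘ Φ) : mfderiv 𝓘(ℝ, V) 𝓘(ℝ, ℝ) f p = 0 := by
  have h1 := hW.hasMFDerivAt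
  rw [hW0] at h1
  have h2 := (h1.comp p hΦ.hasMFDerivAt).congr_of_eventuallyEq hf
  rw [ContinuousLinearMap.zero_comp] at h2
  exact h2.mfderiv

/-- No flow property is needed: Γ(z, 0) = z already gives the Leibniz rule. Smoothness is asked only
at t = 0 over the support of χ, because the curves used later come from a chart. -/
theorem exists_derivation_of_curves {V N : Type*} [NormedAddCommGroup V] [NormedSpace ℝ V]
    [TopologicalSpace N] [ChartedSpace V N] [IsManifold 𝓘(ℝ, V) ∞ N]
    (χ : SmoothFn V N) (Γ : N → ℝ → N) (hΓ0 : ∀ z ∈ tsupport χ, Γ z 0 = z)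
    (hΓ : ∀ z ∈ tsupport χ,
      ContMDiffAt (𝓘(ℝ, V).prod 𝓘(ℝ, ℝ)) 𝓘(ℝ, V) ∞ (fun q : N × ℝ => Γ q.1 q.2) (z, 0)) :
    ∃ D : Derivation ℝ (SmoothFn V N) (SmoothFn V N), ∀ u z,
      D u z = χ z * deriv (fun t : ℝ => u (Γ z t)) 0 := by
  have hu : ∀ (u : SmoothFn V N), ∀ z ∈ tsupport χ,
      ContMDiffAt (𝓘(ℝ, V).prod 𝓘(ℝ, ℝ)) 𝓘(ℝ, ℝ) ∞ (fun q : N × ℝ => u (Γ q.1 q.2)) (z, 0) :=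
    fun u z hz => (u.contMDiff _).comp (z, (0 : ℝ)) (hΓ z hz)
  have hd : ∀ (u : SmoothFn V N), ∀ z ∈ tsupport χ,
      DifferentiableAt ℝ (fun t : ℝ => u (Γ z t)) 0 := fun u z hz => by
    have h : ContMDiffAt 𝓘(ℝ, ℝ) 𝓘(ℝ, ℝ) ∞ (fun t : ℝ => u (Γ z t)) 0 :=
      ContMDiffAt.comp (g := fun q : N × ℝ => u (Γ q.1 q.2)) (f := fun t : ℝ => (z, t)) (0 : ℝ)
        (hu u z hz) (contMDiffAt_const.prodMk contMDiffAt_id)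
    exact h.contDiffAt.differentiableAt (by simp)
  have hs : ∀ u : SmoothFn V N, ContMDiff 𝓘(ℝ, V) 𝓘(ℝ, ℝ) ∞
      fun z => χ z * deriv (fun t : ℝ => u (Γ z t)) 0 := fun u => by
    refine contMDiff_of_tsupport fun z₀ hz₀ => ?_
    have hz : z₀ ∈ tsupport χ := tsupport_mul_subset_left hz₀
    refine (χ.contMDiff z₀).mul ?_
    have : IsManifold 𝓘(ℝ, V) 1 N := IsManifold.of_le (n := ∞) (by simp)
    have := ContMDiffAt.mfderiv_apply (n := ∞) (m := ∞) (x₀ := z₀)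
      (fun (z : N) (t : ℝ) => u (Γ z t)) (fun _ => (0 : ℝ)) id (fun _ => (1 : ℝ))
      (hu u z₀ hz) contMDiffAt_const contMDiffAt_id contMDiffAt_const
      (by simp)
    simpa [inTangentCoordinates_model_space, mfderiv_eq_fderiv] using this
  have h0 : ∀ z, z ∉ tsupport χ → χ z = 0 := fun z hz => image_eq_zero_of_notMem_tsupport hz
  refine ⟨Derivation.mk'
    { toFun := fun u => ⟨_, hs u⟩
      map_add' := fun u v => ?_
      map_smul' := fun c u => ?_ } fun u v => ?_, fun u z => rfl⟩
  · ext z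
    change χ z * deriv ((fun t : ℝ => u (Γ z t)) + fun t : ℝ => v (Γ z t)) 0 =
      χ z * deriv _ 0 + χ z * deriv _ 0
    by_cases hz : z ∈ tsupport χ
    · rw [deriv_add (hd u z hz) (hd v z hz), mul_add]
    · rw [h0 z hz]; ring
  · ext z
    change χ z * deriv (c • fun t : ℝ => u (Γ z t)) 0 = c * (χ z * deriv _ 0)
    by_cases hz : z ∈ tsupport χ
    · rw [deriv_const_smul _ (hd u z hz), smul_eq_mul]; ring
    · rw [h0 z hz]; ring
  · ext z
    change χ z * deriv ((fun t : ℝ => u (Γ z t)) * fun t : ℝ => v (Γ z t)) 0 =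
      u z * (χ z * deriv _ 0) + v z * (χ z * deriv _ 0)
    by_cases hz : z ∈ tsupport χ
    · rw [deriv_mul (hd u z hz) (hd v z hz)]
      simp only [hΓ0 z hz]
      ring
    · rw [h0 z hz]; ring

end Chain

end AVGeometry
end

/-! ### Vector fields on Z: uniqueness, horizontal fields and coordinates -/

noncomputable section

namespace AVGeometry

theorem SmoothFn.sum_apply {V N ι : Type*} [NormedAddCommGroup V] [NormedSpace ℝ V]
    [TopologicalSpace N] [ChartedSpace V N] (s : Finset ι) (f : ι → SmoothFn V N) (x : N) :
    (∑ i ∈ s, f i : SmoothFn V N) x = ∑ i ∈ s, f i x := by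
  induction s using Finset.cons_induction with
  | empty => rfl
  | cons a s ha ih => rw [Finset.sum_cons, Finset.sum_cons, SmoothFn.add_apply, ih]

namespace AVBundle

variable {E F M Z : Type*} [NormedAddCommGroup E] [NormedSpace ℝ E] [FiniteDimensional ℝ E]
  [NormedAddCommGroup F] [NormedSpace ℝ F] [FiniteDimensional ℝ F]
  [TopologicalSpace M] [ChartedSpace E M] [IsManifold 𝓘(ℝ, E) ∞ M] [T2Space M]
  [TopologicalSpace Z] [ChartedSpace F Z] [IsManifold 𝓘(ℝ, F) ∞ Z] [T2Space Z]
  [AddAction ℝ Z] (P : AVBundle E F M Z)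

theorem eq_neg_affFun_vadd (σ : P.Section) (z : Z) :
    (-P.affFun σ z) +ᵥ σ.toFun (P.proj z) = z := by
  rw [← P.affFun_vadd σ z, vadd_vadd, neg_add_cancel, zero_vadd]

theorem affFun_neg_vadd (σ : P.Section) (a : ℝ) (m : M) :
    P.affFun σ ((-a) +ᵥ σ.toFun m) = a := by
  refine P.affFun_eq σ ?_
  rw [P.proj_vadd, σ.proj_toFun, vadd_vadd, add_neg_cancel, zero_vadd]

/-- A point derivation of the smooth functions on `Z` that vanishes on the pull-backs and on one
affine function is zero. -/
theorem pointDerivation_eq_zero (σ : P.Section) {z₀ : Z} {D : SmoothFn F Z →ₗ[ℝ] ℝ}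
    (hD : IsPointDerivation z₀ D) (h1 : ∀ f, D (P.pull f) = 0) (h2 : D (P.affFun σ) = 0)
    (u : SmoothFn F Z) : D u = 0 := by
  have hsm : ContMDiff (𝓘(ℝ, E).prod 𝓘(ℝ, ℝ)) 𝓘(ℝ, ℝ) ∞
      fun q : M × ℝ => u ((-q.2) +ᵥ σ.toFun q.1) :=
    u.contMDiff.comp (P.contMDiff_vadd.comp
      (contMDiff_snd.neg.prodMk (σ.contMDiff_toFun.comp contMDiff_fst)))
  let s₀ := P.affFun σ z₀
  let m₀ := P.proj z₀
  let f : SmoothFn E M := ⟨fun m => u ((-s₀) +ᵥ σ.toFun m),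
    hsm.comp (contMDiff_id.prodMk contMDiff_const)⟩
  have hk : ContMDiff 𝓘(ℝ, ℝ) 𝓘(ℝ, ℝ) ∞ fun s : ℝ => u ((-s) +ᵥ σ.toFun m₀) :=
    hsm.comp (contMDiff_const.prodMk contMDiff_id)
  let c := deriv (fun s : ℝ => u ((-s) +ᵥ σ.toFun m₀)) s₀
  -- In the coordinates (m, s) = (π, F_σ) on Z, subtract from u its restriction to s = s₀ and the
  -- linear term c s. Both partial differentials of W at (m₀, s₀) vanish, and on the subtracted
  -- terms D is zero by hypothesis.
  let W : M × ℝ → ℝ := fun q => u ((-q.2) +ᵥ σ.toFun q.1) - f q.1 - c * q.2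
  have hW : ContMDiff (𝓘(ℝ, E).prod 𝓘(ℝ, ℝ)) 𝓘(ℝ, ℝ) ∞ W :=
    (hsm.sub (f.contMDiff.comp contMDiff_fst)).sub (contMDiff_const.mul contMDiff_snd)
  have hΦ : ContMDiff 𝓘(ℝ, F) (𝓘(ℝ, E).prod 𝓘(ℝ, ℝ)) ∞ fun z => (P.proj z, P.affFun σ z) :=
    P.contMDiff_proj.prodMk (P.affFun σ).contMDiff
  have hWd : MDifferentiableAt (𝓘(ℝ, E).prod 𝓘(ℝ, ℝ)) 𝓘(ℝ, ℝ) W (m₀, s₀) :=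
    (hW _).mdifferentiableAt (by simp)
  have hW0 : mfderiv (𝓘(ℝ, E).prod 𝓘(ℝ, ℝ)) 𝓘(ℝ, ℝ) W (m₀, s₀) = 0 := by
    have e1 : (fun m => W (m, s₀)) = fun _ => -(c * s₀) := by
      funext m
      change u ((-s₀) +ᵥ σ.toFun m) - u ((-s₀) +ᵥ σ.toFun m) - c * s₀ = _
      ring
    have d1 : mfderiv 𝓘(ℝ, E) 𝓘(ℝ, ℝ) (fun m => W (m, s₀)) m₀ = 0 := by
      rw [e1]; exact mfderiv_const
    have d2 : mfderiv 𝓘(ℝ, ℝ) 𝓘(ℝ, ℝ) (fun s => W (m₀, s)) s₀ = 0 := by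
      rw [mfderiv_eq_fderiv]
      have h3 : HasDerivAt (fun s : ℝ => u ((-s) +ᵥ σ.toFun m₀) - f m₀ - c * s) (c - c * 1) s₀ :=
        (((hk.contDiff.differentiable (by simp) s₀).hasDerivAt).sub_const _).sub
          ((hasDerivAt_id s₀).const_mul c)
      rw [mul_one, sub_self] at h3
      have h4 := h3.hasFDerivAt.fderiv
      have h5 : ContinuousLinearMap.toSpanSingleton ℝ (0 : ℝ) = 0 := by ext; simp
      exact h4.trans h5
    rw [mfderiv_prod_eq_add_comp hWd]
    change (mfderiv 𝓘(ℝ, E) 𝓘(ℝ, ℝ) (fun m => W (m, s₀)) m₀).comp _ +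
      (mfderiv 𝓘(ℝ, ℝ) 𝓘(ℝ, ℝ) (fun s => W (m₀, s)) s₀).comp _ = 0
    rw [d1, d2, ContinuousLinearMap.zero_comp, ContinuousLinearMap.zero_comp, add_zero]
  have hw : D (u - P.pull f - c • P.affFun σ) = 0 := by
    refine hD.eq_zero_of_mfderiv_eq_zero (mfderiv_eq_zero_of_comp (W := W)
      ((hΦ z₀).mdifferentiableAt (by simp)) hWd hW0 (Filter.Eventually.of_forall fun z => ?_))
    change u z - f (P.proj z) - c * P.affFun σ z =
      u ((-P.affFun σ z) +ᵥ σ.toFun (P.proj z)) - f (P.proj z) - c * P.affFun σ z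
    rw [eq_neg_affFun_vadd]
  rw [map_sub, map_sub, h1, map_smul, h2, smul_zero, sub_zero, sub_zero] at hw
  exact hw

/-- The value at a point of a derivation. -/
def evalDerivation {V N : Type*} [NormedAddCommGroup V] [NormedSpace ℝ V]
    [TopologicalSpace N] [ChartedSpace V N] (D : SmoothFn V N →ₗ[ℝ] SmoothFn V N) (z : N) :
    SmoothFn V N →ₗ[ℝ] ℝ where
  toFun u := D u z
  map_add' u v := by rw [map_add]; rfl
  map_smul' c u := by rw [map_smul]; rfl

theorem derivation_eq_zero (σ : P.Section) {D : Derivation ℝ (SmoothFn F Z) (SmoothFn F Z)}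
    (h1 : ∀ f, D (P.pull f) = 0) (h2 : D (P.affFun σ) = 0) : D = 0 := by
  ext u z
  refine P.pointDerivation_eq_zero σ (z₀ := z) (D := evalDerivation D.toLinearMap z) ⟨fun f g => ?_⟩
    (fun f => ?_) ?_ u
  · change D (f * g) z = f z * D g z + g z * D f z
    rw [D.leibniz]; rfl
  · change D (P.pull f) z = 0
    rw [h1]; rfl
  · change D (P.affFun σ) z = 0
    rw [h2]; rfl

theorem derivation_ext (σ : P.Section) {D D' : Derivation ℝ (SmoothFn F Z) (SmoothFn F Z)}
    (h1 : ∀ f, D (P.pull f) = D' (P.pull f)) (h2 : D (P.affFun σ) = D' (P.affFun σ)) : D = D' :=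
  sub_eq_zero.1 (P.derivation_eq_zero σ
    (fun f => by rw [Derivation.sub_apply, h1, sub_self])
    (by rw [Derivation.sub_apply, h2, sub_self]))

/-- The commutator of X_Z with D is again a derivation, so its vanishing needs to be tested only on
pull-backs and on F_σ. -/
theorem mem_tildeT_of_affFun (σ : P.Section) {D : Derivation ℝ (SmoothFn F Z) (SmoothFn F Z)}
    (h1 : ∀ f, P.fundField (D (P.pull f)) = 0) (h2 : P.fundField (D (P.affFun σ)) = 0) :
    D ∈ P.TildeT := by
  refine P.derivation_eq_zero σ (D := ⁅P.fundField, D⁆) (fun f => ?_) ?_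
  · rw [Derivation.commutator_apply, h1, fundField_pull, map_zero, sub_zero]
  · rw [Derivation.commutator_apply, h2, fundField_affFun, Derivation.map_one_eq_zero, sub_zero]

theorem fundField_eq_zero_of_vadd {u : SmoothFn F Z} (h : ∀ (t : ℝ) z, u (t +ᵥ z) = u z) :
    P.fundField u = 0 := by
  ext z
  rw [fundField_apply]
  simp [h]

/-- The derivative of a function along the coordinate line of direction `v` through `p`, in the chart
at `m₀`. -/
def chartDeriv (m₀ : M) (v : E) (f : M → ℝ) (p : M) : ℝ :=
  deriv (fun t : ℝ => f ((extChartAt 𝓘(ℝ, E) m₀).symm (extChartAt 𝓘(ℝ, E) m₀ p + t • v))) 0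

/-- Invariant vector fields that are horizontal for a section and project to a coordinate field. -/
theorem exists_horizontal (σ : P.Section) (m₀ : M) (v : E) (χ : SmoothFn E M)
    (hχ : tsupport χ ⊆ (chartAt E m₀).source) :
    ∃ X : P.TildeT, X.1 (P.affFun σ) = 0 ∧
      ∀ (f : SmoothFn E M) z, X.1 (P.pull f) z = χ (P.proj z) * chartDeriv m₀ v f (P.proj z) := by
  let e := extChartAt 𝓘(ℝ, E) m₀
  -- The curve moves the base point along a coordinate line and keeps F_σ constant.
  let Γ : Z → ℝ → Z := fun z t =>
    (-P.affFun σ z) +ᵥ σ.toFun (e.symm (e (P.proj z) + t • v))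
  have hts : ∀ z ∈ tsupport (P.pull χ), P.proj z ∈ (chartAt E m₀).source := fun z hz => by
    refine hχ ?_
    have hsub : Function.support (P.pull χ) ⊆ P.proj ⁻¹' tsupport χ := fun y hy =>
      subset_tsupport _ hy
    exact closure_minimal hsub ((isClosed_tsupport _).preimage P.contMDiff_proj.continuous) hz
  have hes : e.source = (chartAt E m₀).source := extChartAt_source 𝓘(ℝ, E) m₀
  obtain ⟨D, hD⟩ := exists_derivation_of_curves (P.pull χ) Γ
    (fun z hz => by
      have : P.proj z ∈ e.source := by rw [hes]; exact hts z hz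
      simp only [Γ, zero_smul, add_zero, e.left_inv this, eq_neg_affFun_vadd])
    (fun z hz => by
      have hz' := hts z hz
      have hz'' : P.proj z ∈ e.source := by rw [hes]; exact hz'
      have c1 : ContMDiffAt (𝓘(ℝ, F).prod 𝓘(ℝ, ℝ)) 𝓘(ℝ, E) ∞
          (fun q : Z × ℝ => e (P.proj q.1)) (z, 0) :=
        ContMDiffAt.comp (z, (0 : ℝ)) (g := e) (f := fun q : Z × ℝ => P.proj q.1)
          (contMDiffAt_extChartAt' hz') ((P.contMDiff_proj z).comp (z, (0 : ℝ)) contMDiffAt_fst)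
      have c2 : ContMDiffAt (𝓘(ℝ, F).prod 𝓘(ℝ, ℝ)) 𝓘(ℝ, E) ∞
          (fun q : Z × ℝ => e (P.proj q.1) + q.2 • v) (z, 0) :=
        c1.add (contMDiffAt_snd.smul contMDiffAt_const)
      have c3 : ContMDiffAt (𝓘(ℝ, F).prod 𝓘(ℝ, ℝ)) 𝓘(ℝ, E) ∞
          (fun q : Z × ℝ => e.symm (e (P.proj q.1) + q.2 • v)) (z, 0) := by
        refine ContMDiffAt.comp (z, (0 : ℝ)) (g := e.symm)
          (f := fun q : Z × ℝ => e (P.proj q.1) + q.2 • v) ?_ c2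
        refine (contMDiffOn_extChartAt_symm m₀).contMDiffAt
          ((isOpen_extChartAt_target m₀).mem_nhds ?_)
        simp only [zero_smul, add_zero]
        exact e.map_source hz''
      exact (P.contMDiff_vadd _).comp (z, (0 : ℝ))
        ((((P.affFun σ).contMDiff z).comp (z, (0 : ℝ)) contMDiffAt_fst).neg.prodMk
          ((σ.contMDiff_toFun _).comp (z, (0 : ℝ)) c3)))
  have hDa : D (P.affFun σ) = 0 := by
    ext z
    rw [hD]
    have : (fun t : ℝ => P.affFun σ (Γ z t)) = fun _ => P.affFun σ z := by
      funext t
      exact P.affFun_neg_vadd σ _ _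
    rw [this, deriv_const, mul_zero]; rfl
  have hDp : ∀ (f : SmoothFn E M) z,
      D (P.pull f) z = χ (P.proj z) * chartDeriv m₀ v f (P.proj z) := fun f z => by
    rw [hD, pull_apply, chartDeriv]
    have : (fun t : ℝ => P.pull f (Γ z t)) =
        fun t : ℝ => f (e.symm (e (P.proj z) + t • v)) := by
      funext t
      rw [pull_apply, P.proj_vadd, σ.proj_toFun]
    rw [this]
  refine ⟨⟨D, P.mem_tildeT_of_affFun σ (fun f => P.fundField_eq_zero_of_vadd fun t z => ?_) ?_⟩,
    hDa, hDp⟩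
  · rw [hDp, hDp, P.proj_vadd]
  · rw [hDa, map_zero]

/-- A derivation of functions on `M` is determined near `m₀` by its values on coordinates. -/
theorem exists_coordinates (m₀ : M) :
    ∃ (χ : SmoothFn E M) (ψ : Fin (Module.finrank ℝ E) → SmoothFn E M),
      χ m₀ ≠ 0 ∧ tsupport χ ⊆ (chartAt E m₀).source ∧
      ∀ p, χ p ≠ 0 → ∀ D : SmoothFn E M →ₗ[ℝ] ℝ, IsPointDerivation p D → ∀ f : SmoothFn E M,
        D f = ∑ i, D (ψ i) * chartDeriv m₀ (Module.finBasis ℝ E i) f p := by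
  let e := extChartAt 𝓘(ℝ, E) m₀
  let b := Module.finBasis ℝ E
  obtain ⟨ρ⟩ : Nonempty (SmoothBumpFunction 𝓘(ℝ, E) m₀) := inferInstance
  have hn : {x | ρ =ᶠ[nhds x] 1} ∈ nhds m₀ := eventually_eventually_nhds.2 ρ.eventuallyEq_one
  -- ρ' is supported where ρ is locally equal to 1, so near any point with χ ≠ 0 the functions ψ_i
  -- are the genuine coordinates.
  obtain ⟨ρ', -, hρ'⟩ := (SmoothBumpFunction.nhds_basis_support (I := 𝓘(ℝ, E)) hn).mem_iff.1 hn
  have hcoord : ∀ i, ContDiff ℝ ∞ (b.coord i) := fun i =>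
    (LinearMap.toContinuousLinearMap (b.coord i)).contDiff
  refine ⟨⟨ρ', ρ'.contMDiff⟩, fun i => bumpMul ρ _ (chart_comp_contMDiffOn m₀ (hcoord i)),
    ?_, ρ'.tsupport_subset_chartAt_source, fun p hp D hD f => ?_⟩
  · change ρ' m₀ ≠ 0
    rw [ρ'.eq_one]; exact one_ne_zero
  have hρp : ρ =ᶠ[nhds p] 1 := hρ' hp
  have hps : p ∈ (chartAt E m₀).source := ρ'.support_subset_source hp
  have hps' : p ∈ e.source := by rw [extChartAt_source]; exact hps
  set ψ : Fin (Module.finrank ℝ E) → SmoothFn E M := fun i =>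
    bumpMul ρ _ (chart_comp_contMDiffOn m₀ (hcoord i)) with hψ
  let c : Fin (Module.finrank ℝ E) → ℝ := fun i => chartDeriv m₀ (b i) f p
  have hfs : DifferentiableAt ℝ (fun y => f (e.symm y)) (e p) := by
    have h1 : ContMDiffAt 𝓘(ℝ, E) 𝓘(ℝ, ℝ) ∞ (fun x => f (e.symm x)) (e p) :=
      (f.contMDiff.comp_contMDiffOn (contMDiffOn_extChartAt_symm m₀)).contMDiffAt
        ((isOpen_extChartAt_target m₀).mem_nhds (e.map_source hps'))
    exact h1.contDiffAt.differentiableAt (by simp)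
  have hc : ∀ i, c i = fderiv ℝ (fun y => f (e.symm y)) (e p) (b i) := fun i => by
    have hl : HasDerivAt (fun t : ℝ => e p + t • b i) (b i) 0 := by
      simpa using ((hasDerivAt_id (0 : ℝ)).smul_const (b i)).const_add (e p)
    have hf' : HasFDerivAt (fun y => f (e.symm y)) (fderiv ℝ (fun y => f (e.symm y)) (e p))
        (e p + (0 : ℝ) • b i) := by
      rw [zero_smul, add_zero]; exact hfs.hasFDerivAt
    exact (hf'.comp_hasDerivAt (0 : ℝ) hl).deriv
  let L : E →L[ℝ] ℝ := LinearMap.toContinuousLinearMap (∑ i, c i • b.coord i)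
  -- W is f in the chart minus its linear part, so its differential at the image of p is zero and D
  -- kills f - ∑ c_i ψ_i.
  let W : E → ℝ := fun y => f (e.symm y) - L y
  have hL : L = fderiv ℝ (fun y => f (e.symm y)) (e p) := by
    refine ContinuousLinearMap.coe_injective (b.ext fun j => ?_)
    change (∑ i, c i • b.coord i) (b j) = fderiv ℝ (fun y => f (e.symm y)) (e p) (b j)
    rw [← hc, LinearMap.sum_apply, Finset.sum_eq_single j]
    · simp
    · intro i _ hij
      simp [hij.symm]
    · simp
  have hWd : HasFDerivAt W (0 : E →L[ℝ] ℝ) (e p) := by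
    have := hfs.hasFDerivAt.sub L.hasFDerivAt
    rw [hL, sub_self] at this
    rw [← hL] at this
    exact this
  have hD0 : D (f - ∑ i, c i • ψ i) = 0 := by
    refine hD.eq_zero_of_mfderiv_eq_zero (mfderiv_eq_zero_of_comp (I' := 𝓘(ℝ, E)) (Φ := e) (W := W)
      ((contMDiffAt_extChartAt' (n := ∞) hps).mdifferentiableAt (by simp))
      hWd.hasMFDerivAt.mdifferentiableAt hWd.hasMFDerivAt.mfderiv ?_)
    filter_upwards [hρp, (isOpen_extChartAt_source m₀).mem_nhds hps'] with x hx hxs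
    have h1 : (∑ i, c i • ψ i : SmoothFn E M) x = ∑ i, c i * b.coord i (e x) := by
      rw [SmoothFn.sum_apply]
      refine Finset.sum_congr rfl fun i _ => ?_
      change c i * (ρ x * b.coord i (e x)) = _
      rw [hx, Pi.one_apply, one_mul]
    have h2 : L (e x) = ∑ i, c i * b.coord i (e x) := by
      change (∑ i, c i • b.coord i) (e x) = _
      rw [LinearMap.sum_apply]; rfl
    change f x - (∑ i, c i • ψ i : SmoothFn E M) x = f (e.symm (e x)) - L (e x)
    rw [h1, h2, e.left_inv hxs]
  rw [map_sub, map_sum, sub_eq_zero] at hD0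
  rw [hD0]
  refine Finset.sum_congr rfl fun i _ => ?_
  rw [map_smul, smul_eq_mul, mul_comm]

end AVBundle

end AVGeometry
end

/-! ### Brackets of sections of Z in terms of J(ev σ, ev τ) -/

noncomputable section

namespace AVGeometry

theorem IsTwistedClosed.sub {R A : Type*} [CommRing R] [Algebra ℝ R] [LieRing A] [LieAlgebra ℝ A]
    [Module R A] [LieRingModule A R] [LieRinehartRing R A] [LieRinehartAlgebra ℝ R A]
    {φ α β : Module.Dual R A} (hα : IsTwistedClosed φ α) (hβ : IsTwistedClosed φ β) :
    IsTwistedClosed φ (α - β) := fun X Y => by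
  simp only [LinearMap.sub_apply, lie_sub]
  linear_combination hα X Y - hβ X Y

namespace AVBundle

variable {E F M Z : Type*} [NormedAddCommGroup E] [NormedSpace ℝ E]
  [NormedAddCommGroup F] [NormedSpace ℝ F]
  [TopologicalSpace M] [ChartedSpace E M]
  [TopologicalSpace Z] [ChartedSpace F Z] [IsManifold 𝓘(ℝ, F) ∞ Z]
  [AddAction ℝ Z] {P : AVBundle E F M Z}

section AffineBrackets

theorem affFun_injective : Function.Injective P.affFun := fun σ τ h => by
  ext m
  obtain ⟨z, rfl⟩ := P.proj_surjective m
  rw [← affFun_vadd, ← affFun_vadd, h]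

theorem affFun_vadd_section (f : SmoothFn E M) (σ : P.Section) :
    P.affFun (f +ᵥ σ) = P.pull f + P.affFun σ := by
  ext z
  refine P.affFun_eq _ ?_
  rw [SmoothFn.add_apply, pull_apply, ← vadd_vadd, affFun_vadd]
  rfl

theorem exists_vadd_section_eq (σ τ : P.Section) : ∃ f : SmoothFn E M, f +ᵥ σ = τ := by
  have h : P.fundField (P.affFun τ - P.affFun σ) = 0 := by
    rw [map_sub, fundField_affFun, fundField_affFun, sub_self]
  refine ⟨P.descend _ h, affFun_injective ?_⟩
  rw [affFun_vadd_section, pull_descend, sub_add_cancel]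

variable {A : Type*} [LieRing A] [LieAlgebra ℝ A] [Module (SmoothFn E M) A]
  [LieRingModule A (SmoothFn E M)] [LieRinehartRing (SmoothFn E M) A]
  [LieRinehartAlgebra ℝ (SmoothFn E M) A]

/-- The linear part of the bracket of a bisection, `f ↦ J(α, df + f φ)`. -/
def pairTwistedDiff (φ α : Module.Dual (SmoothFn E M) A) (J : ⋀[SmoothFn E M]^2 A) :
    SmoothFn E M →ₗ[ℝ] SmoothFn E M where
  toFun f := pair J α (twistedDiff φ f)
  map_add' f g := by rw [twistedDiff_add, pair_add_right]
  map_smul' c f := by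
    simp only [pair, twistedDiff, LinearMap.add_apply, LinearMap.smul_apply, diffForm_apply,
      lie_smul, smul_eq_mul, smul_mul_assoc, smul_add, RingHom.id_apply]

/-- The vector field of a section of a Lie algebroid. -/
def anchorDerivation (X : A) : Derivation ℝ (SmoothFn E M) (SmoothFn E M) :=
  Derivation.mk' (LieModule.toEnd ℝ A (SmoothFn E M) X) fun f g => by
    simp only [LieModule.toEnd_apply_apply, LieRinehartRing.leibniz_mul_right, smul_eq_mul]
    ring

variable {φ : Module.Dual (SmoothFn E M) A} {ev : P.Section → Module.Dual (SmoothFn E M) A}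
  (hev : ∀ (f : SmoothFn E M) σ, ev (f +ᵥ σ) = ev σ + twistedDiff φ f)
  {J : ⋀[SmoothFn E M]^2 A} {B : P.Section → P.Section → SmoothFn E M}
  (hB : ∀ σ τ, B σ τ = pair J (ev σ) (ev τ))

include hev hB

theorem isAffineWith_right (σ : P.Section) :
    IsAffineWith (B σ) (pairTwistedDiff φ (ev σ) J) := fun f τ => by
  rw [hB, hB, hev, pair_add_right]; rfl

theorem isAffineWith_left (τ : P.Section) :
    IsAffineWith (fun σ => B σ τ) (-pairTwistedDiff φ (ev τ) J) := fun f σ => by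
  change B (f +ᵥ σ) τ = B σ τ + -pair J (ev τ) (twistedDiff φ f)
  rw [hB, hB, hev, pair_add_left, ← pair_skew]

/-- Skewness and affinity come with the form J(ev σ, ev τ), and the linear part of {σ, ·} is f ↦
J(ev σ, df + fφ); only the Jacobi identity is a condition on J. -/
theorem isAffineLieBracket_iff :
    IsAffineLieBracket B ↔ ∀ σ₁ σ₂ σ₃, jacobiator φ J (ev σ₁) (ev σ₂) (ev σ₃) = 0 := by
  have hl : ∀ σ f, linPart B σ f = pair J (ev σ) (twistedDiff φ f) := fun σ f => by
    rw [linPart, isAffineWith_right hev hB σ f σ, add_sub_cancel_left]; rfl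
  have hj : ∀ σ₁ σ₂ σ₃,
      linPart B σ₁ (B σ₂ σ₃) + linPart B σ₂ (B σ₃ σ₁) + linPart B σ₃ (B σ₁ σ₂) =
        jacobiator φ J (ev σ₁) (ev σ₂) (ev σ₃) := fun σ₁ σ₂ σ₃ => by
    rw [hl, hl, hl, hB, hB, hB, jacobiator]
  constructor
  · intro h σ₁ σ₂ σ₃
    rw [← hj, h.jacobi]
  · intro h
    exact ⟨fun τ => ⟨_, isAffineWith_left hev hB τ⟩, fun σ => ⟨_, isAffineWith_right hev hB σ⟩,
      fun σ τ => by rw [hB, hB, pair_skew], fun σ₁ σ₂ σ₃ => by rw [hj, h]⟩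

omit hev in
theorem isAffineDerivation_right
    (hev : ∀ (f : SmoothFn E M) σ, ev (f +ᵥ σ) = ev σ + twistedDiff 0 f) (σ : P.Section) :
    IsAffineDerivation (B σ) := by
  refine ⟨anchorDerivation (contractForm (ev σ) J), fun f τ => ?_⟩
  rw [isAffineWith_right hev hB σ f τ]
  congr 1
  change ⁅contractForm (ev σ) J, f⁆ + f * 0 = ⁅contractForm (ev σ) J, f⁆
  rw [mul_zero, add_zero]

theorem isAffineFirstOrder_right (σ : P.Section) : IsAffineFirstOrder (B σ) := by
  refine ⟨anchorDerivation (contractForm (ev σ) J), φ (contractForm (ev σ) J), fun f τ => ?_⟩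
  rw [isAffineWith_right hev hB σ f τ]
  congr 1
  change ⁅contractForm (ev σ) J, f⁆ + f * φ (contractForm (ev σ) J) =
    ⁅contractForm (ev σ) J, f⁆ + φ (contractForm (ev σ) J) * f
  rw [mul_comm]

/-- The third section is written as f + σ₁, so the third one-form is ev σ₁ plus df + fφ. The first
part contributes nothing by `jacobiator_self`, the second nothing by the homology condition at t =
1. -/
theorem isAffineLieBracket_of_isHomologyOperator (hφ : IsClosedForm φ)
    (hcl : ∀ σ, IsTwistedClosed φ (ev σ)) (h : IsHomologyOperator (jacobiLieDiff φ 1 J)) :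
    IsAffineLieBracket B := by
  rw [isAffineLieBracket_iff hev hB]
  intro σ₁ σ₂ σ₃
  obtain ⟨f, rfl⟩ := exists_vadd_section_eq σ₁ σ₃
  have hf : IsTwistedClosed φ (twistedDiff φ f) := by
    have := (hcl (f +ᵥ σ₁)).sub (hcl σ₁)
    rwa [hev, add_sub_cancel_left] at this
  rw [hev, jacobiator_add_right, jacobiator_self,
    jacobiator_twistedDiff_eq_zero hφ h (hcl σ₁) (hcl σ₂) f hf, add_zero]

theorem isHomologyOperator_of_isAffineLieBracket (hφ : IsClosedForm φ)
    (hcl : ∀ σ, IsTwistedClosed φ (ev σ))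
    (hframe : ∀ m, ∃ χ : SmoothFn E M, χ m ≠ 0 ∧ HasFrame (Set.range ev) χ)
    (h : IsAffineLieBracket B) (t : ℝ) : IsHomologyOperator (jacobiLieDiff φ t J) := by
  rw [isAffineLieBracket_iff hev hB] at h
  refine isHomologyOperator_of_jacobiator hφ (S := Set.range ev) ?_ ?_ (fun f hf => ?_) t
  · rintro _ ⟨σ, rfl⟩; exact hcl σ
  · rintro _ ⟨σ₁, rfl⟩ _ ⟨σ₂, rfl⟩ _ ⟨σ₃, rfl⟩; exact h _ _ _
  · ext m
    obtain ⟨χ, hm, hχ⟩ := hframe m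
    have := DFunLike.congr_fun (hf χ hχ) m
    change χ m * (χ m * χ m) * f m = 0 at this
    exact (mul_eq_zero_iff_left (mul_ne_zero hm (mul_ne_zero hm hm))).1 this

end AffineBrackets

/-! ### The one-forms D ↦ D(σ) on both algebroids -/

namespace TildeT

theorem eval_vadd (f : SmoothFn E M) (σ : P.Section) :
    eval (f +ᵥ σ) = eval σ + twistedDiff 0 f := by
  ext1 X
  refine P.pull_injective ?_
  rw [pull_eval, affFun_vadd_section, map_add]
  change _ = P.pull (eval σ X + (⁅X, f⁆ + f * 0))
  rw [mul_zero, add_zero, map_add, pull_eval, pull_anchor, add_comm]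

theorem isTwistedClosed_eval (σ : P.Section) : IsTwistedClosed 0 (eval σ) := fun X Y => by
  refine P.pull_injective ?_
  simp only [map_sub, pull_anchor, pull_eval, coe_lie, LinearMap.zero_apply, zero_mul, sub_self,
    map_zero]

theorem bracketT_eq_pair (Λ : ⋀[SmoothFn E M]^2 P.TildeT) (σ τ : P.Section) :
    bracketT Λ σ τ = pair Λ (eval σ) (eval τ) := by
  induction Λ using bisection_induction with
  | mul X Y => rw [bracketT_ιMulti, pair_ιMulti]
  | zero => rw [pair_bisection_zero, bracketT, map_zero]
  | add J K hJ hK => rw [pair_bisection_add, ← hJ, ← hK, bracketT, map_add]; rfl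
  | smul f J hJ => rw [pair_bisection_smul, ← hJ, bracketT, map_smul]; rfl

theorem coe_sum {ι : Type*} (s : Finset ι) (X : ι → P.TildeT) (u : SmoothFn F Z) :
    (∑ i ∈ s, X i).1 u = ∑ i ∈ s, (X i).1 u := by
  induction s using Finset.cons_induction with
  | empty => rfl
  | cons a s ha ih => rw [Finset.sum_cons, Finset.sum_cons, coe_add, ih]

/-- The vector field `X_Z` as a section of `T̃Z`. -/
def fund (P : AVBundle E F M Z) : P.TildeT := ⟨P.fundField, lie_self _⟩

end TildeT

namespace TildeL

theorem eval_vadd (f : SmoothFn E M) (σ : P.Section) :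
    eval (f +ᵥ σ) = eval σ + twistedDiff phi f := by
  ext1 D
  refine P.pull_injective ?_
  rw [pull_eval, affFun_vadd_section, map_add]
  change _ = P.pull (eval σ D + (⁅D, f⁆ + f * phi D))
  rw [map_add, map_add, map_mul, pull_eval, pull_anchor, pull_phi]
  ring

/-- The anchor differs from the action of D on basic functions by multiplication with D(1); this
difference is exactly the term -φ⁰ ∧ ev σ. -/
theorem isTwistedClosed_eval (σ : P.Section) : IsTwistedClosed phi (eval σ) := fun D D' => by
  refine P.pull_injective ?_
  simp only [map_sub, map_mul, pull_anchor, pull_eval, coe_lie, pull_phi]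
  ring

theorem isClosedForm_phi : IsClosedForm (phi (P := P)) := fun D D' => by
  refine P.pull_injective ?_
  simp only [map_sub, pull_anchor, coe_lie, pull_phi, map_zero]
  ring

theorem bracketL_eq_pair (J : ⋀[SmoothFn E M]^2 P.TildeL) (σ τ : P.Section) :
    bracketL J σ τ = pair J (eval σ) (eval τ) := by
  induction J using bisection_induction with
  | mul X Y => rw [bracketL_ιMulti, pair_ιMulti]
  | zero => rw [pair_bisection_zero, bracketL, map_zero]
  | add J K hJ hK => rw [pair_bisection_add, ← hJ, ← hK, bracketL, map_add]; rfl
  | smul f J hJ => rw [pair_bisection_smul, ← hJ, bracketL, map_smul]; rfl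

/-- Invariant vector fields are affine first-order differential operators. -/
def ofTildeT (P : AVBundle E F M Z) : P.TildeT →ₗ[SmoothFn E M] P.TildeL where
  toFun X := ⟨X.1.toLinearMap, X.1, X.2, 0, by simp, fun u => by simp⟩
  map_add' X Y := rfl
  map_smul' f X := rfl

/-- The operator `F_σ X_Z - 1`. -/
def euler (σ : P.Section) : P.TildeL :=
  ⟨(LinearMap.mulLeft ℝ (P.affFun σ)) ∘ₗ P.fundField.toLinearMap - LinearMap.id,
    0, P.TildeT.zero_mem, P.affFun σ, by rw [fundField_affFun, Derivation.map_one_eq_zero],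
    fun u => by
      rw [fundField_affFun, one_mul, Derivation.coe_zero, Pi.zero_apply, zero_add]
      rfl⟩

/-- A function ψ affine along the fibres is (X_Z ψ) F_σ plus a basic function. The basic part times
X_Z joins the invariant field, and the rest is X_Z(ψ) times F_σ X_Z - 1, with φ⁰(D) = -X_Z(ψ). -/
theorem exists_eq_ofTildeT_sub (σ : P.Section) (D : P.TildeL) :
    ∃ X : P.TildeT, ∀ u, D.1 u = X.1 u - P.pull (phi D) * (P.affFun σ * P.fundField u - u) := by
  obtain ⟨X, hX, ψ, hψ, h⟩ := D.2
  have h0 : P.fundField (ψ - P.fundField ψ * P.affFun σ) = 0 := by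
    simp [hψ, fundField_affFun]
  have hphi : P.pull (phi D) = -P.fundField ψ := by
    rw [pull_phi, h]
    simp
  refine ⟨⟨X, hX⟩ + P.descend _ h0 • TildeT.fund P, fun u => ?_⟩
  rw [TildeT.coe_add, TildeT.coe_smul, pull_descend, hphi, h]
  change _ = X u + _ * P.fundField u - _
  ring

end TildeL

/-! ### Local frames with coefficients in the span of the ev σ -/

section Frames

variable [FiniteDimensional ℝ E] [FiniteDimensional ℝ F] [IsManifold 𝓘(ℝ, E) ∞ M] [T2Space M]
  [T2Space Z]

/-- Both sides are derivations on Z, so they are compared on pull-backs and on F_σ. The vertical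
field X_Z kills pull-backs and sends F_σ to 1, while the horizontal fields kill F_σ and project to χ
times coordinate fields. -/
theorem TildeT.exists_frame (σ : P.Section) (m₀ : M) :
    ∃ (χ : SmoothFn E M) (ψ : Fin (Module.finrank ℝ E) → SmoothFn E M)
      (X : Fin (Module.finrank ℝ E) → P.TildeT), χ m₀ ≠ 0 ∧
      ∀ Y : P.TildeT, χ • Y = eval σ Y • (χ • TildeT.fund P) + ∑ i, ⁅Y, ψ i⁆ • X i := by
  obtain ⟨χ, ψ, hm, hχ, hψ⟩ := exists_coordinates (E := E) m₀
  choose X hX1 hX2 using fun i => P.exists_horizontal σ m₀ (Module.finBasis ℝ E i) χ hχ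
  refine ⟨χ, ψ, X, hm, fun Y => Subtype.ext (P.derivation_ext σ (fun f => ?_) ?_)⟩
  · rw [coe_smul, coe_add, coe_smul, coe_smul, coe_sum]
    change _ = P.pull (eval σ Y) * (P.pull χ * P.fundField (P.pull f)) + _
    rw [fundField_pull, mul_zero, mul_zero, zero_add]
    ext z
    rw [← pull_anchor Y]
    simp only [SmoothFn.sum_apply, coe_smul, SmoothFn.mul_apply, hX2, pull_apply]
    -- Where χ vanishes, so do the horizontal fields, and there is nothing to compare.
    by_cases hp : χ (P.proj z) = 0
    · simp [hp]
    · have h := hψ (P.proj z) hp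
        (evalDerivation (LieModule.toEnd ℝ P.TildeT (SmoothFn E M) Y) (P.proj z)) ⟨fun f g => by
          change ⁅Y, f * g⁆ (P.proj z) = f (P.proj z) * ⁅Y, g⁆ (P.proj z) +
            g (P.proj z) * ⁅Y, f⁆ (P.proj z)
          rw [LieRinehartRing.leibniz_mul_right]
          simp only [smul_eq_mul, SmoothFn.add_apply, SmoothFn.mul_apply]
          ring⟩ f
      change ⁅Y, f⁆ (P.proj z) = ∑ i, ⁅Y, ψ i⁆ (P.proj z) * _ at h
      rw [h, Finset.mul_sum]
      exact Finset.sum_congr rfl fun i _ => by ring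
  · rw [coe_smul, coe_add, coe_smul, coe_smul, coe_sum]
    change _ = P.pull (eval σ Y) * (P.pull χ * P.fundField (P.affFun σ)) + _
    rw [fundField_affFun, pull_eval, mul_one, mul_comm, Finset.sum_eq_zero, add_zero]
    intro i _
    rw [coe_smul, hX1, mul_zero]

theorem TildeT.hasFrame (σ : P.Section) (m₀ : M) :
    ∃ χ : SmoothFn E M, χ m₀ ≠ 0 ∧ HasFrame (Set.range (eval (P := P))) χ := by
  obtain ⟨χ, ψ, X, hm, h⟩ := exists_frame σ m₀
  have hs : ∀ τ : P.Section, eval τ ∈ Submodule.span (SmoothFn E M) (Set.range (eval (P := P))) :=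
    fun τ => Submodule.subset_span ⟨τ, rfl⟩
  refine ⟨χ, hm, _, Fin.cons (χ • TildeT.fund P) X,
    Fin.cons (eval σ) fun i => twistedDiff 0 (ψ i), fun i => ?_, fun Y => ?_⟩
  · refine Fin.cases (hs σ) (fun i => ?_) i
    have := Submodule.sub_mem _ (hs (ψ i +ᵥ σ)) (hs σ)
    rwa [eval_vadd, add_sub_cancel_left] at this
  · rw [Fin.sum_univ_succ, h Y]
    simp only [Fin.cons_zero, Fin.cons_succ, twistedDiff, smul_zero, add_zero, diffForm_apply]

/-- The frame of invariant fields is completed by F_σ X_Z - 1, whose coefficient is -φ⁰(D). The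
one-form φ⁰ lies in the span because it is ev(1 + σ) - ev σ, and then so does df = ev(f + σ) - ev σ
- f φ⁰. -/
theorem TildeL.hasFrame (σ : P.Section) (m₀ : M) :
    ∃ χ : SmoothFn E M, χ m₀ ≠ 0 ∧ HasFrame (Set.range (eval (P := P))) χ := by
  obtain ⟨χ, ψ, X, hm, h⟩ := TildeT.exists_frame σ m₀
  have hs : ∀ τ : P.Section, eval τ ∈ Submodule.span (SmoothFn E M) (Set.range (eval (P := P))) :=
    fun τ => Submodule.subset_span ⟨τ, rfl⟩
  have htw : ∀ f, twistedDiff (phi (P := P)) f ∈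
      Submodule.span (SmoothFn E M) (Set.range (eval (P := P))) := fun f => by
    have := Submodule.sub_mem _ (hs (f +ᵥ σ)) (hs σ)
    rwa [eval_vadd, add_sub_cancel_left] at this
  have hphi : phi (P := P) ∈ Submodule.span (SmoothFn E M) (Set.range (eval (P := P))) := by
    have h1 : twistedDiff (phi (P := P)) 1 = phi := by
      ext1 D
      refine P.pull_injective ?_
      change P.pull (⁅D, (1 : SmoothFn E M)⁆ + 1 * phi D) = _
      rw [map_add, pull_anchor]
      simp
    rw [← h1]; exact htw 1
  have hdiff : ∀ f, diffForm f ∈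
      Submodule.span (SmoothFn E M) (Set.range (eval (P := P))) := fun f => by
    have := Submodule.sub_mem _ (htw f) (Submodule.smul_mem _ f hphi)
    rwa [twistedDiff, add_sub_cancel_right] at this
  refine ⟨χ, hm, _, Fin.cons (-(χ • euler σ)) (Fin.cons (ofTildeT P (χ • TildeT.fund P))
    fun i => ofTildeT P (X i)), Fin.cons phi (Fin.cons (eval σ) fun i => diffForm (ψ i)),
    fun i => ?_, fun D => ?_⟩
  · refine Fin.cases hphi (fun i => ?_) i
    exact Fin.cases (hs σ) (fun i => hdiff _) i
  · obtain ⟨Y, hY⟩ := exists_eq_ofTildeT_sub σ D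
    have hD : D = ofTildeT P Y - phi D • euler σ := by
      ext1 u
      rw [hY]; rfl
    have hev : eval σ D = TildeT.eval σ Y := P.pull_injective (by
      rw [pull_eval, TildeT.pull_eval, hY, fundField_affFun]
      ring)
    have hanc : ∀ f : SmoothFn E M, ⁅D, f⁆ = ⁅Y, f⁆ := fun f => P.pull_injective (by
      rw [pull_anchor, TildeT.pull_anchor, hY, hY, fundField_pull, Derivation.map_one_eq_zero,
        Derivation.map_one_eq_zero]
      ring)
    rw [Fin.sum_univ_succ, Fin.sum_univ_succ]
    simp only [Fin.cons_zero, Fin.cons_succ, diffForm_apply, hev, hanc, ← map_smul, ← map_sum]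
    rw [← map_add, ← h Y, map_smul]
    conv_lhs => rw [hD]
    rw [smul_sub, smul_comm χ, smul_neg, sub_eq_add_neg, add_comm]

end Frames

end AVBundle

end AVGeometry

end

theorem mainTheorem5 {E F M Z : Type*}
    [NormedAddCommGroup E] [NormedSpace ℝ E] [FiniteDimensional ℝ E]
    [NormedAddCommGroup F] [NormedSpace ℝ F] [FiniteDimensional ℝ F]
    [TopologicalSpace M] [ChartedSpace E M] [IsManifold 𝓘(ℝ, E) ∞ M]
    [T2Space M] [SigmaCompactSpace M]
    [TopologicalSpace Z] [ChartedSpace F Z] [IsManifold 𝓘(ℝ, F) ∞ Z]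
    [T2Space Z] [SigmaCompactSpace Z]
    [AddAction ℝ Z] (P : AVGeometry.AVBundle E F M Z) :
    (∀ Λ : ⋀[AVGeometry.SmoothFn E M]^2 P.TildeT,
      AVGeometry.AVBundle.IsAffPoisson (AVGeometry.AVBundle.bracketT Λ) ↔
        AVGeometry.IsHomologyOperator (AVGeometry.lieDiff Λ)) ∧
    (∀ J : ⋀[AVGeometry.SmoothFn E M]^2 P.TildeL,
      AVGeometry.AVBundle.IsAffJacobi (AVGeometry.AVBundle.bracketL J) ↔
        ∀ t : ℝ, AVGeometry.IsHomologyOperator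
          (AVGeometry.jacobiLieDiff AVGeometry.AVBundle.TildeL.phi t J)) := by
  open AVGeometry AVBundle in
  obtain ⟨σ⟩ := nonempty_section P
  have h0 : IsClosedForm (0 : Module.Dual (SmoothFn E M) P.TildeT) := fun X Y => by simp
  refine ⟨fun Λ => ?_, fun J => ?_⟩
  · have hB := TildeT.bracketT_eq_pair Λ
    -- For φ = 0 the operator does not depend on t; t = 1 is the value that the converse uses.
    rw [← jacobiLieDiff_zero 1 Λ]
    exact ⟨fun h => isHomologyOperator_of_isAffineLieBracket TildeT.eval_vadd hB h0
        TildeT.isTwistedClosed_eval (TildeT.hasFrame σ) h.1 1,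
      fun h => ⟨isAffineLieBracket_of_isHomologyOperator TildeT.eval_vadd hB h0
        TildeT.isTwistedClosed_eval h, isAffineDerivation_right hB TildeT.eval_vadd⟩⟩
  · have hB := TildeL.bracketL_eq_pair J
    exact ⟨fun h => isHomologyOperator_of_isAffineLieBracket TildeL.eval_vadd hB
        TildeL.isClosedForm_phi TildeL.isTwistedClosed_eval (TildeL.hasFrame σ) h.1,
      fun h => ⟨isAffineLieBracket_of_isHomologyOperator TildeL.eval_vadd hB
        TildeL.isClosedForm_phi TildeL.isTwistedClosed_eval (h 1),
        isAffineFirstOrder_right TildeL.eval_vadd hB⟩⟩
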